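/- Let $n\ge 3$. A set $A\subseteq\mathbb F_5^n$ is called \emph{sum-free} if there are no $x,y,z\in A$ with $x+y=z$. A sum-free set $A\subseteq\mathbb F_5^n$ is called \emph{normal} if there is an affine hyperplane $H\subseteq\mathbb F_5^n$ not containing the origin such that $A\subseteq H\cup(-H)$. Let $\Lambda\subseteq\mathbb F_5^3$ be the $28$-element set $$\Lambda=\bigl(\{(1,0),(-1,0),(0,1),(0,-1)\}\times\mathbb F_5\bigr)\cup\{(-1,2,0),(-1,2,1),(2,1,1),(2,1,2),(1,-2,0),(1,-2,-1),(-2,-1,-1),(-2,-1,-2)\},$$ and call a subset of $\mathbb F_5^n$ a \emph{VL-set} if it is the image of $\Lambda\times\mathbb F_5^{n-3}$ under some linear automorphism of $\mathbb F_5^n$ (where $\mathbb F_5^3\times\mathbb F_5^{n-3}$ is identified with $\mathbb F_5^n$). If $A\subseteq\mathbb F_5^n$ is sum-free with $|A|\ge 28\cdot 5^{n-3}$, and some affine subspace $T$ of $\mathbb F_5^n$ of codimension $2$ satisfies $|A\cap T|>3\cdot 5^{n-3}$, then $A$ is normal or a VL-set. -/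

import Mathlib

/-- A subset of an abelian group is sum-free if `x + y = z` has no solution inside it. -/
def IsSumFree {G : Type*} [AddCommGroup G] (A : Set G) : Prop :=
  ∀ x ∈ A, ∀ y ∈ A, x + y ∉ A

/-- `T` is a (nonempty) affine subspace of `𝔽₅ⁿ` of codimension `k`. -/
def HasCodim {n : ℕ} (T : AffineSubspace (ZMod 5) (Fin n → ZMod 5)) (k : ℕ) : Prop :=
  (T : Set (Fin n → ZMod 5)).Nonempty ∧ Module.finrank (ZMod 5) T.direction + k = n

/-- A sum-free set is normal if it is contained in `H ∪ (-H)` for some affine hyperplane `H`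
not passing through the origin. -/
def IsNormalSumFree {n : ℕ} (A : Set (Fin n → ZMod 5)) : Prop :=
  IsSumFree A ∧ ∃ H : AffineSubspace (ZMod 5) (Fin n → ZMod 5),
    HasCodim H 1 ∧ 0 ∉ H ∧ ∀ x ∈ A, x ∈ H ∨ -x ∈ H

/-- The set `Λ ⊆ 𝔽₅³` with `28` elements. -/
def Lambda : Set (Fin 3 → ZMod 5) :=
  {p | ∃ z : ZMod 5, p = ![1, 0, z] ∨ p = ![-1, 0, z] ∨ p = ![0, 1, z] ∨ p = ![0, -1, z]} ∪
  {![-1, 2, 0], ![-1, 2, 1], ![2, 1, 1], ![2, 1, 2],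
   ![1, -2, 0], ![1, -2, -1], ![-2, -1, -1], ![-2, -1, -2]}

/-- A subset of `𝔽₅ⁿ` is a VL-set if some linear isomorphism `𝔽₅ⁿ ≃ 𝔽₅³ × 𝔽₅ⁿ⁻³` maps it onto
`Λ × 𝔽₅ⁿ⁻³`. (For `n < 3` there is no such isomorphism.) -/
def IsVLSet {n : ℕ} (A : Set (Fin n → ZMod 5)) : Prop :=
  ∃ φ : (Fin n → ZMod 5) ≃ₗ[ZMod 5] (Fin 3 → ZMod 5) × (Fin (n - 3) → ZMod 5),
    φ '' A = Lambda ×ˢ (Set.univ : Set (Fin (n - 3) → ZMod 5))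

/-! Put `q = 5 ^ (n - 3)` and suppose that `A` is not normal. A linear map onto `𝔽₅²` cuts `A` into
25 fibres, each lying in a coset of `5 * q` points, and the proof studies the 25 fibre sizes
(`Profile`). Sum-freeness gives local inequalities. If the fibre over `g` is nonempty, those over
`h` and `g + h` together have at most `5 * q` points. If all three are nonempty and one has more
than `m * q` points, the other two have at most `(5 - m) * q` together; this is a Kneser-type
estimate, proved by iterated Dyson transforms (`exists_dyson_stable`, `le_card_add`). An element of
`A` over `d` forces density at most `2 / 5` on the lines in direction `d`, since `A` meets each
translate of the subgroup it generates at most twice. Non-normality enters through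
`two_mul_card_level_le`: every affine hyperplane carries at most `25 / 2 * q` points of `A`.

The dense flat misses the origin, so coordinates can be chosen that place it over `(1, 0)`. In rows
parallel to `(1, 0)`, two neighbouring nonempty fibres have small total size. Hence a row of maximal
weight among those off the origin is either small or supported on one of three patterns
(`cycle_cases`). The patterns are settled by decision trees whose leaves are Farkas combinations of
the inequalities above; the kernel checks the trees, and `Tree.sound` transfers the result to
profiles.

If no flat of codimension 2 has more than `4 * q` points of `A`, the inequalities leave only one
extremal profile: `4 * q` at `(1, 0)` and `q` at every point off the row of the origin
(`Profile.constant_of_sparse`). There the gap of `A` over `(1, 0)` acts by translation on the next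
row, so that `A` contains a whole flat of codimension 2, a contradiction (`exists_denser`). Hence
some flat has more than `4 * q` points, and the certificates then confine the support to eight
points (`Profile.exceptional_of_dense`).

On that support the total forces four full fibres and four fibres of size `2 * q`, the latter
permuted cyclically by doubling. A stabiliser argument (`exists_stable_double`) yields a third
coordinate on which one of these four depends, and doubling carries the description round the cycle,
giving the preimage of `Λ` (`exists_map_Lambda`). -/

/-! ### Linear certificates for density profiles on `𝔽₅²`

A point `(i, j)` of `𝔽₅²` is encoded by the number `i + 5 * j`. -/

namespace Certificate

/-- The point of `𝔽₅²` with a given code. -/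
def pt (c : ℕ) : ZMod 5 × ZMod 5 := ((c : ZMod 5), ((c / 5 : ℕ) : ZMod 5))

/-- Addition on codes. -/
def addN (g h : ℕ) : ℕ := (g % 5 + h % 5) % 5 + 5 * ((g / 5 + h / 5) % 5)

/-- Subtraction on codes. -/
def subN (g h : ℕ) : ℕ := (g % 5 + 4 * (h % 5)) % 5 + 5 * ((g / 5 + 4 * (h / 5)) % 5)

theorem pt_encode (a b : ℕ) : pt (a % 5 + 5 * b) = ((a : ZMod 5), (b : ZMod 5)) := by
  have h5 : (5 : ZMod 5) = 0 := by decide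
  have : (a % 5 + 5 * b) / 5 = b := by omega
  simp [pt, this, h5]

theorem pt_addN (g h : ℕ) : pt (addN g h) = pt g + pt h := by
  rw [addN, pt_encode]
  simp [pt]

theorem pt_subN (g h : ℕ) : pt (subN g h) = pt g - pt h := by
  have h4 : (4 : ZMod 5) = -1 := by decide
  rw [subN, pt_encode]
  simp [pt, h4, sub_eq_add_neg]

/-- The neighbours of `g`: the points forming a sum relation with `g` and `(1, 0)`. -/
def nbrs (g : ℕ) : List ℕ := [addN g 1, subN g 1, subN 1 g]

/-- The four nonzero multiples of `d`. -/
def multiples (d : ℕ) : List ℕ := [d, addN d d, addN d (addN d d), addN (addN d d) (addN d d)]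

/-- The line through `g` in direction `d`. -/
def line (d g : ℕ) : List ℕ := g :: (multiples d).map (addN g)

/-- The row with second coordinate `j`. -/
def row (j : ℕ) : List ℕ := [5 * j, 5 * j + 1, 5 * j + 2, 5 * j + 3, 5 * j + 4]

/-- Total weight of a list of points. -/
def wt (y : ℕ → ℕ) (l : List ℕ) : ℕ := (l.map y).sum

/-- The system of inequalities the certificates refer to: `y` is the profile in units of `q`,
every value is at most `H`, the weight at `(1, 0)` exceeds `5 - E`, and twice the weight of row `1`,
a row of maximal weight, is at least `r`. -/
structure System (y : ℕ → ℕ) (q E H r : ℕ) : Prop where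
  pos : 0 < q
  bound : ∀ g, y g ≤ H * q
  add_sub : ∀ g h, y (addN g (subN h g)) = y h
  pair : ∀ g h, 0 < y g → y h + y (addN g h) ≤ 5 * q
  pairSum : ∀ g h, 0 < y (addN g h) → y g + y h ≤ 5 * q
  triple : ∀ g h m, 0 < y g → 0 < y h → 0 < y (addN g h) → m * q < y g →
    y h + y (addN g h) + m * q ≤ 5 * q
  tripleSum : ∀ g h m, 0 < y g → 0 < y h → 0 < y (addN g h) → m * q < y (addN g h) →
    y g + y h + m * q ≤ 5 * q
  edge : ∀ g h, h ∈ nbrs g → 0 < y g → 0 < y h → y g + y h ≤ E * q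
  line : ∀ d g, pt d ≠ 0 → 2 * wt y (line d g) ≤ 25 * q
  dir : ∀ d g, pt d ≠ 0 → (∃ h ∈ multiples d, 0 < y h) → wt y (Certificate.line d g) ≤ 10 * q
  rows : ∀ j, j = 2 ∨ j = 3 ∨ j = 4 → wt y (row j) ≤ wt y (row 1)
  first : r * q ≤ 2 * wt y (row 1)
  total : 28 * q ≤ wt y (List.range 25)

/-- Facts recorded along a branch of a certificate. -/
inductive Fact
  | gt (g m : ℕ)
  | le (g m : ℕ)
  | nf (g : ℕ)
  | dir (d : ℕ)

/-- A point is non-free if it is empty or has a nonempty neighbour. -/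
def NonFree (y : ℕ → ℕ) (g : ℕ) : Prop := y g = 0 ∨ ∃ h ∈ nbrs g, 0 < y h

/-- The meaning of a fact. -/
def Fact.Holds (y : ℕ → ℕ) (q : ℕ) : Fact → Prop
  | .gt g m => m * q < y g
  | .le g m => y g ≤ m * q
  | .nf g => NonFree y g
  | .dir d => ∃ h ∈ multiples d, 0 < y h

/-- `lower S g = m + 1` records that the weight at `g` exceeds `m`. -/
def lower : List Fact → ℕ → ℕ
  | [], _ => 0
  | .gt h m :: S, g => bif Nat.beq g h then max (m + 1) (lower S g) else lower S g
  | _ :: S, g => lower S g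

/-- The upper bound for the weight at `g` that is recorded in `S`. -/
def upper (H : ℕ) : List Fact → ℕ → ℕ
  | [], _ => H
  | .le h m :: S, g => bif Nat.beq g h then min m (upper H S g) else upper H S g
  | _ :: S, g => upper H S g

/-- Whether `S` says that `g` is nonempty. -/
def nonempty (S : List Fact) (g : ℕ) : Bool := Nat.ble 1 (lower S g)

/-- Whether `S` contains the flag `nf g`. -/
def flagged : List Fact → ℕ → Bool
  | [], _ => false
  | .nf h :: S, g => Nat.beq g h || flagged S g
  | _ :: S, g => flagged S g

/-- Whether `S` says that `g` is non-free. -/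
def nonFree (S : List Fact) (g : ℕ) : Bool := flagged S g || (nbrs g).any (nonempty S)

/-- Whether `S` contains the flag `dir d`. -/
def dirFlagged : List Fact → ℕ → Bool
  | [], _ => false
  | .dir h :: S, g => Nat.beq g h || dirFlagged S g
  | _ :: S, g => dirFlagged S g

/-- Whether `S` says that some nonzero multiple of `d` is nonempty. -/
def directed (S : List Fact) (d : ℕ) : Bool := dirFlagged S d || (multiples d).any (nonempty S)

theorem beq_eq_false {g h : ℕ} (hgh : g ≠ h) : Nat.beq g h = false := by
  cases hb : Nat.beq g h with
  | false => rfl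
  | true => exact absurd (Nat.eq_of_beq_eq_true hb) hgh

/-! ### Correctness of the facts looked up in a branch. -/

section

variable {y : ℕ → ℕ} {q E H r : ℕ} {S : List Fact}

theorem lt_of_lt_lower (hS : ∀ f ∈ S, f.Holds y q) {g m : ℕ} (hm : m < lower S g) :
    m * q < y g := by
  induction S with
  | nil => simp [lower] at hm
  | cons f S ih =>
    have hS' : ∀ f ∈ S, f.Holds y q := fun f hf => hS f (List.mem_cons_of_mem _ hf)
    have hf := hS f List.mem_cons_self
    cases f with
    | gt h k =>
      by_cases hgh : g = h
      · subst hgh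
        simp only [lower, Nat.beq_refl, cond_true] at hm
        rcases lt_max_iff.1 hm with h1 | h1
        · exact lt_of_le_of_lt (Nat.mul_le_mul_right q (Nat.lt_succ_iff.1 h1)) hf
        · exact ih hS' h1
      · have := beq_eq_false hgh
        simp only [lower, this, cond_false] at hm
        exact ih hS' hm
    | le h k => exact ih hS' hm
    | nf h => exact ih hS' hm
    | dir h => exact ih hS' hm

theorem le_upper (hb : ∀ g, y g ≤ H * q) (hS : ∀ f ∈ S, f.Holds y q) (g : ℕ) :
    y g ≤ upper H S g * q := by
  induction S with
  | nil => exact hb g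
  | cons f S ih =>
    have ih := ih fun f hf => hS f (List.mem_cons_of_mem _ hf)
    have hf := hS f List.mem_cons_self
    cases f with
    | le h k =>
      by_cases hgh : g = h
      · subst hgh
        simp only [upper, Nat.beq_refl, cond_true]
        rcases le_total k (upper H S g) with h1 | h1
        · rw [min_eq_left h1]; exact hf
        · rw [min_eq_right h1]; exact ih
      · have := beq_eq_false hgh
        simpa only [upper, this, cond_false] using ih
    | gt h k => exact ih
    | nf h => exact ih
    | dir h => exact ih

theorem pos_of_nonempty (hS : ∀ f ∈ S, f.Holds y q) {g : ℕ} (h : nonempty S g = true) :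
    0 < y g := by
  have := lt_of_lt_lower hS (g := g) (m := 0)
    (Nat.le_of_ble_eq_true h)
  simpa using this

theorem nonFree_of_flagged (hS : ∀ f ∈ S, f.Holds y q) {g : ℕ} (h : flagged S g = true) :
    NonFree y g := by
  induction S with
  | nil => simp [flagged] at h
  | cons f S ih =>
    have ih := ih fun f hf => hS f (List.mem_cons_of_mem _ hf)
    have hf := hS f List.mem_cons_self
    cases f with
    | nf k =>
      simp only [flagged, Bool.or_eq_true] at h
      rcases h with h | h
      · rw [Nat.eq_of_beq_eq_true h]; exact hf
      · exact ih h
    | gt k m => exact ih h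
    | le k m => exact ih h
    | dir k => exact ih h

theorem nonFree_spec (hS : ∀ f ∈ S, f.Holds y q) {g : ℕ} (h : nonFree S g = true) :
    NonFree y g := by
  simp only [nonFree, Bool.or_eq_true, List.any_eq_true] at h
  rcases h with h | ⟨k, hk, h⟩
  · exact nonFree_of_flagged hS h
  · exact Or.inr ⟨k, hk, pos_of_nonempty hS h⟩

theorem directed_spec (hS : ∀ f ∈ S, f.Holds y q) {d : ℕ} (h : directed S d = true) :
    ∃ h ∈ multiples d, 0 < y h := by
  simp only [directed, Bool.or_eq_true, List.any_eq_true] at h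
  rcases h with h | ⟨k, hk, h⟩
  · induction S with
    | nil => simp [dirFlagged] at h
    | cons f S ih =>
      have ih := ih fun f hf => hS f (List.mem_cons_of_mem _ hf)
      have hf := hS f List.mem_cons_self
      cases f with
      | dir k =>
        simp only [dirFlagged, Bool.or_eq_true] at h
        rcases h with h | h
        · rw [Nat.eq_of_beq_eq_true h]; exact hf
        · exact ih h
      | gt k m => exact ih h
      | le k m => exact ih h
      | nf k => exact ih h
  · exact ⟨k, hk, pos_of_nonempty hS h⟩

theorem NonFree.le (h : System y q E H r) {g : ℕ} (hg : NonFree y g) : y g ≤ E * q := by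
  rcases Nat.eq_zero_or_pos (y g) with h0 | h0
  · simp [h0]
  · rcases hg with h1 | ⟨k, hk, hpos⟩
    · omega
    · have := h.edge g k hk h0 hpos
      omega

/-- If both points are nonempty, they form a sum relation with the heavy point `(1, 0)`, which is
the `edge` inequality. If one is empty, the other is still bounded by `E * q` because some neighbour
of its own is nonempty. -/
theorem NonFree.add_le (h : System y q E H r) {g k : ℕ} (hg : NonFree y g) (hk : NonFree y k)
    (hgk : k ∈ nbrs g) : y g + y k ≤ E * q := by
  have h1 := hg.le h
  have h2 := hk.le h
  rcases Nat.eq_zero_or_pos (y g) with h0 | h0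
  · omega
  · rcases Nat.eq_zero_or_pos (y k) with h3 | h3
    · omega
    · exact h.edge g k hgk h0 h3

end

/-- The linear inequality `2 * ∑ lhs + const * q ≤ 2 * ∑ rhs + bound * q`, strict if `strict`. -/
structure Lin where
  lhs : List ℕ
  rhs : List ℕ
  const : ℕ
  bound : ℕ
  strict : Bool

/-- The meaning of a linear inequality. -/
def Lin.Holds (y : ℕ → ℕ) (q : ℕ) (c : Lin) : Prop :=
  2 * wt y c.lhs + c.const * q + (bif c.strict then 1 else 0) ≤ 2 * wt y c.rhs + c.bound * q

/-- The kinds of inequalities used in certificates. -/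
inductive Con
  | up (g : ℕ)
  | low (g : ℕ)
  | nf (g : ℕ)
  | edge (g h : ℕ)
  | pair (g h : ℕ)
  | sum (g h : ℕ)
  | add (g h : ℕ)
  | sub (g h : ℕ)
  | tri (g h : ℕ)
  | top (g h : ℕ)
  | side (g h : ℕ)
  | line (d g : ℕ)
  | dir (d g : ℕ)
  | row (j : ℕ)
  | first

/-- A trivial inequality. -/
def Lin.trivial : Lin := ⟨[], [], 0, 0, false⟩

/-- The inequality with left hand side `l`, upper bound `b`, valid under the condition `c`. -/
def Lin.when (c : Bool) (l : List ℕ) (b : ℕ) : Lin :=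
  bif c then ⟨l, [], 0, b, false⟩ else Lin.trivial

/-- The linear inequality of each kind that is available in the state `S`. -/
def Con.lin (E H r : ℕ) (S : List Fact) : Con → Lin
  | up g => ⟨[g], [], 0, 2 * upper H S g, false⟩
  | low g => bif nonempty S g then ⟨[], [g], 2 * (lower S g - 1), 0, true⟩ else Lin.trivial
  | nf g => Lin.when (nonFree S g) [g] (2 * E)
  | edge g h => Lin.when (nonFree S g && nonFree S h && (nbrs g).any (Nat.beq h)) [g, h] (2 * E)
  | pair g h => Lin.when (nonempty S g) [h, addN g h] 10
  | sum g h => Lin.when (nonempty S (addN g h)) [g, h] 10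
  | add g h => Lin.when (nonempty S g && nonempty S h) [addN g h]
      (2 * (7 - (lower S g + lower S h)))
  | sub g h => Lin.when (nonempty S g && nonempty S h) [subN h g]
      (2 * (7 - (lower S g + lower S h)))
  | tri g h => Lin.when (nonempty S g && nonempty S h && nonempty S (addN g h))
      [g, h, addN g h] 12
  | top g h => Lin.when (nonempty S g && nonempty S h && nonempty S (addN g h)) [g, h]
      (2 * (6 - lower S (addN g h)))
  | side g h => Lin.when (nonempty S g && nonempty S h && nonempty S (addN g h)) [h, addN g h]
      (2 * (6 - lower S g))
  | line d g => Lin.when (Nat.ble 1 d && Nat.ble d 24) (Certificate.line d g) 25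
  | dir d g => Lin.when (Nat.ble 1 d && Nat.ble d 24 && directed S d) (Certificate.line d g) 20
  | row j => bif Nat.ble 2 j && Nat.ble j 4 then
      ⟨Certificate.row j, Certificate.row 1, 0, 0, false⟩ else Lin.trivial
  | first => ⟨[], Certificate.row 1, r, 0, false⟩

theorem Lin.when_holds {y : ℕ → ℕ} {q : ℕ} {c : Bool} {l : List ℕ} {b : ℕ}
    (h : c = true → 2 * wt y l ≤ b * q) : (Lin.when c l b).Holds y q := by
  cases c with
  | false => simp [Lin.when, Lin.trivial, Lin.Holds, wt]
  | true => simpa [Lin.when, Lin.Holds, wt] using h rfl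

theorem pt_ne_zero {d : ℕ} (h1 : 1 ≤ d) (h2 : d ≤ 24) : pt d ≠ 0 := by
  interval_cases d <;> decide

/-! ### Correctness of the linear inequalities offered to the leaves. -/

section

variable {y : ℕ → ℕ} {q E H r : ℕ} {S : List Fact}

theorem lower_pred (hS : ∀ f ∈ S, f.Holds y q) {g : ℕ} (h : nonempty S g = true) :
    ∃ m, lower S g = m + 1 ∧ m * q < y g := by
  have h1 : 1 ≤ lower S g := by simpa [nonempty] using h
  obtain ⟨m, hm⟩ := Nat.exists_eq_add_of_le' h1
  exact ⟨m, hm, lt_of_lt_lower hS (by omega)⟩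

/-- If `c` is positive, the triple inequality applies and the lower bound on `b` is subtracted from
it. When `k + m ≥ 5` this is impossible, and the truncated subtraction then correctly says that `c`
vanishes. -/
theorem two_levels {a b c k m : ℕ} (hq : 0 < q) (ha : 0 < c → k * q < a ∧ b + c + k * q ≤ 5 * q)
    (hb : m * q < b) : c ≤ (5 - (k + m)) * q := by
  rcases Nat.eq_zero_or_pos c with h0 | h0
  · simp [h0]
  · obtain ⟨-, h1⟩ := ha h0
    have h2 : (k + m) * q < 5 * q := by rw [add_mul]; omega
    have h3 : k + m < 5 := lt_of_mul_lt_mul_right h2 hq.le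
    rw [Nat.sub_mul, add_mul]
    omega

/-- The triple inequality is used at the largest `m` with `m * q < a`. Rounding loses at most one
unit, since `a ≤ (m + 1) * q`; this turns `5` into `6`. -/
theorem three_le {a b c : ℕ} (hq : 0 < q)
    (h : ∀ m, m * q < a → b + c + m * q ≤ 5 * q) (ha : 0 < a) : a + b + c ≤ 6 * q := by
  have h1 := h ((a - 1) / q) (by
    have := Nat.div_mul_le_self (a - 1) q
    omega)
  have h2 := Nat.lt_div_mul_add (a := a - 1) hq
  omega

theorem Con.lin_holds (h : System y q E H r) (hS : ∀ f ∈ S, f.Holds y q) (c : Con) :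
    (c.lin E H r S).Holds y q := by
  cases c with
  | up g =>
    have := le_upper h.bound hS g
    simp only [lin, Lin.Holds, wt, List.map_cons, List.map_nil, List.sum_cons, List.sum_nil,
      cond_false, mul_assoc]
    omega
  | low g =>
    cases hg : nonempty S g with
    | false => simp [lin, hg, Lin.Holds, Lin.trivial, wt]
    | true =>
      obtain ⟨m, hm, hlt⟩ := lower_pred hS hg
      simp only [lin, hg, hm, Lin.Holds, wt, List.map_cons, List.map_nil, List.sum_cons,
        List.sum_nil, cond_true, mul_assoc, Nat.add_sub_cancel]
      omega
  | nf g =>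
    refine Lin.when_holds fun hc => ?_
    have := (nonFree_spec hS hc).le h
    simp only [wt, List.map_cons, List.map_nil, List.sum_cons, List.sum_nil, mul_assoc]
    omega
  | edge g k =>
    refine Lin.when_holds fun hc => ?_
    simp only [Bool.and_eq_true, List.any_eq_true] at hc
    obtain ⟨⟨h1, h2⟩, x, hx, hkx⟩ := hc
    rw [← Nat.eq_of_beq_eq_true hkx] at hx
    have := (nonFree_spec hS h1).add_le h (nonFree_spec hS h2) hx
    simp only [wt, List.map_cons, List.map_nil, List.sum_cons, List.sum_nil, mul_assoc]
    omega
  | pair g k =>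
    refine Lin.when_holds fun hc => ?_
    have := h.pair g k (pos_of_nonempty hS hc)
    simp only [wt, List.map_cons, List.map_nil, List.sum_cons, List.sum_nil]
    omega
  | sum g k =>
    refine Lin.when_holds fun hc => ?_
    have := h.pairSum g k (pos_of_nonempty hS hc)
    simp only [wt, List.map_cons, List.map_nil, List.sum_cons, List.sum_nil]
    omega
  | add g k =>
    refine Lin.when_holds fun hc => ?_
    simp only [Bool.and_eq_true] at hc
    obtain ⟨m, hm, hmq⟩ := lower_pred hS hc.1
    obtain ⟨l, hl, hlq⟩ := lower_pred hS hc.2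
    have := two_levels h.pos (fun hp => ⟨hmq, h.triple g k m (pos_of_nonempty hS hc.1)
      (pos_of_nonempty hS hc.2) hp hmq⟩) hlq
    -- `lower` is one more than the recorded strict level, so two levels account for the shift from
    -- `5` to `7`.
    rw [hm, hl, show 7 - (m + 1 + (l + 1)) = 5 - (m + l) by omega]
    simp only [wt, List.map_cons, List.map_nil, List.sum_cons, List.sum_nil, mul_assoc]
    omega
  | sub g k =>
    refine Lin.when_holds fun hc => ?_
    simp only [Bool.and_eq_true] at hc
    obtain ⟨m, hm, hmq⟩ := lower_pred hS hc.1
    obtain ⟨l, hl, hlq⟩ := lower_pred hS hc.2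
    -- The relation used here is `g + (k - g) = k`, with the difference as the unknown term.
    have hk := h.add_sub g k
    have := two_levels h.pos (c := y (subN k g)) (b := y k) (fun hp => ⟨hmq, by
      have := h.triple g (subN k g) m (pos_of_nonempty hS hc.1) hp
        (hk ▸ pos_of_nonempty hS hc.2) hmq
      omega⟩) hlq
    rw [hm, hl, show 7 - (m + 1 + (l + 1)) = 5 - (m + l) by omega]
    simp only [wt, List.map_cons, List.map_nil, List.sum_cons, List.sum_nil, mul_assoc]
    omega
  | tri g k =>
    refine Lin.when_holds fun hc => ?_
    simp only [Bool.and_eq_true] at hc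
    have h1 := pos_of_nonempty hS hc.1.1
    have := three_le h.pos (fun m hm => h.triple g k m h1
      (pos_of_nonempty hS hc.1.2) (pos_of_nonempty hS hc.2) hm) h1
    simp only [wt, List.map_cons, List.map_nil, List.sum_cons, List.sum_nil]
    omega
  | top g k =>
    refine Lin.when_holds fun hc => ?_
    simp only [Bool.and_eq_true] at hc
    obtain ⟨m, hm, hmq⟩ := lower_pred hS hc.2
    have h1 := h.tripleSum g k m (pos_of_nonempty hS hc.1.1)
      (pos_of_nonempty hS hc.1.2) (pos_of_nonempty hS hc.2) hmq
    rw [hm, show 6 - (m + 1) = 5 - m by omega, mul_assoc, Nat.sub_mul]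
    simp only [wt, List.map_cons, List.map_nil, List.sum_cons, List.sum_nil]
    omega
  | side g k =>
    refine Lin.when_holds fun hc => ?_
    simp only [Bool.and_eq_true] at hc
    obtain ⟨m, hm, hmq⟩ := lower_pred hS hc.1.1
    have h1 := h.triple g k m (pos_of_nonempty hS hc.1.1)
      (pos_of_nonempty hS hc.1.2) (pos_of_nonempty hS hc.2) hmq
    rw [hm, show 6 - (m + 1) = 5 - m by omega, mul_assoc, Nat.sub_mul]
    simp only [wt, List.map_cons, List.map_nil, List.sum_cons, List.sum_nil]
    omega
  | line d g =>
    refine Lin.when_holds fun hc => ?_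
    simp only [Bool.and_eq_true, Nat.ble_eq] at hc
    -- The bound `25 / 2` is the only half-integral one; it is the reason why all linear
    -- inequalities are kept in doubled form.
    exact h.line d g (pt_ne_zero hc.1 hc.2)
  | dir d g =>
    refine Lin.when_holds fun hc => ?_
    simp only [Bool.and_eq_true, Nat.ble_eq] at hc
    have := h.dir d g (pt_ne_zero hc.1.1 hc.1.2) (directed_spec hS hc.2)
    omega
  | row j =>
    cases hj : (Nat.ble 2 j && Nat.ble j 4) with
    | false => simp [lin, hj, Lin.Holds, Lin.trivial, wt]
    | true =>
      simp only [lin, hj, cond_true, Lin.Holds, cond_false]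
      simp only [Bool.and_eq_true, Nat.ble_eq] at hj
      have := h.rows j (by omega)
      omega
  | first =>
    have := h.first
    simpa [lin, Lin.Holds, wt] using this

end

/-- The number of occurrences of `g` in `l`. -/
def count (g : ℕ) : List ℕ → ℕ
  | [] => 0
  | h :: l => bif Nat.beq g h then count g l + 1 else count g l

/-- A weighted sum over a list of inequalities. -/
def weighted (f : Lin → ℕ) : List (ℕ × Lin) → ℕ
  | [] => 0
  | (m, c) :: l => m * f c + weighted f l

/-- `1` for a strict inequality, `0` otherwise. -/
def Lin.gap (c : Lin) : ℕ := bif c.strict then 1 else 0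

/-- Whether the combination of the inequalities `l` with `t` times the total is contradictory when
the points satisfying `z` have weight zero. -/
def refutes (z : ℕ → Bool) (t : ℕ) (l : List (ℕ × Lin)) : Bool :=
  (l.all fun c => c.2.rhs.all fun g => Nat.ble g 24) &&
  ((List.range 25).all fun g => z g || Nat.ble (t + weighted (fun c => count g c.rhs) l)
    (weighted (fun c => count g c.lhs) l)) &&
  (Nat.ble (weighted Lin.bound l + 1) (56 * t + weighted Lin.const l) ||
    (Nat.ble (weighted Lin.bound l) (56 * t + weighted Lin.const l) &&
      Nat.ble 1 (weighted Lin.gap l)))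

/-- A certificate: a binary decision tree whose leaves are linear refutations, with `goal` marking
the branches that survive. -/
inductive Tree
  | goal
  | leaf (t : ℕ) (l : List (ℕ × Con))
  | level (g m : ℕ) (yes no : Tree)
  | free (g : ℕ) (yes no : Tree)
  | dir (d : ℕ) (yes no : Tree)

/-- Validity of a certificate in a state. -/
def Tree.check (E H r : ℕ) (good : List Fact → Bool) : Tree → List Fact → Bool
  | goal, S => good S
  | leaf t l, S => refutes (fun g => Nat.beq (upper H S g) 0) t
      (l.map fun c => (c.1, c.2.lin E H r S))
  | level g m yes no, S => yes.check E H r good (.gt g m :: S) && no.check E H r good (.le g m :: S)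
  | free g yes no, S =>
    yes.check E H r good (.gt g 0 :: ((nbrs g).map fun h => Fact.le h 0) ++ S) &&
      no.check E H r good (.nf g :: S)
  | dir d yes no, S => yes.check E H r good (.dir d :: S) &&
      no.check E H r good (((multiples d).map fun h => Fact.le h 0) ++ S)

/-! ### Soundness of Farkas refutations and of decision trees. -/

section

variable {y : ℕ → ℕ} {q E H r : ℕ} {S : List Fact}

/-- For left-hand sides an inequality suffices, since dropping codes beyond `n` only weakens them.
Right-hand sides need the equality below, hence the range test on them in `refutes`. -/
theorem sum_count_mul_le (l : List ℕ) (n : ℕ) :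
    ∑ g ∈ Finset.range n, count g l * y g ≤ wt y l := by
  induction l with
  | nil => simp [count]
  | cons h l ih =>
    have : ∀ g, count g (h :: l) * y g = count g l * y g + if g = h then y g else 0 := by
      intro g
      by_cases hg : g = h
      · subst hg; simp [count, add_mul]
      · simp [count, beq_eq_false hg, hg]
    simp only [this, Finset.sum_add_distrib, Finset.sum_ite_eq', wt, List.map_cons, List.sum_cons]
    simp only [wt] at ih
    split_ifs <;> omega

theorem sum_count_mul_eq (l : List ℕ) (n : ℕ) (hl : ∀ g ∈ l, g < n) :
    ∑ g ∈ Finset.range n, count g l * y g = wt y l := by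
  induction l with
  | nil => simp [count, wt]
  | cons h l ih =>
    have ih := ih fun g hg => hl g (List.mem_cons_of_mem _ hg)
    have : ∀ g, count g (h :: l) * y g = count g l * y g + if g = h then y g else 0 := by
      intro g
      by_cases hg : g = h
      · subst hg; simp [count, add_mul]
      · simp [count, beq_eq_false hg, hg]
    simp only [this, Finset.sum_add_distrib, Finset.sum_ite_eq', wt, List.map_cons, List.sum_cons]
    simp only [wt] at ih
    have := hl h List.mem_cons_self
    simp only [Finset.mem_range, this, if_true]
    omega

theorem weighted_mono {f f' : Lin → ℕ} {l : List (ℕ × Lin)} (h : ∀ c ∈ l, f c.2 ≤ f' c.2) :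
    weighted f l ≤ weighted f' l := by
  induction l with
  | nil => simp [weighted]
  | cons c l ih =>
    exact add_le_add (Nat.mul_le_mul_left _ (h c List.mem_cons_self))
      (ih fun c hc => h c (List.mem_cons_of_mem _ hc))

theorem weighted_add (f f' : Lin → ℕ) (l : List (ℕ × Lin)) :
    weighted (fun c => f c + f' c) l = weighted f l + weighted f' l := by
  induction l with
  | nil => simp [weighted]
  | cons c l ih => simp only [weighted, ih]; ring

theorem weighted_mul (f : Lin → ℕ) (k : ℕ) (l : List (ℕ × Lin)) :
    weighted (fun c => f c * k) l = weighted f l * k := by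
  induction l with
  | nil => simp [weighted]
  | cons c l ih => simp only [weighted, ih]; ring

theorem weighted_sum (f : ℕ → Lin → ℕ) (s : Finset ℕ) (l : List (ℕ × Lin)) :
    weighted (fun c => ∑ g ∈ s, f g c) l = ∑ g ∈ s, weighted (f g) l := by
  induction l with
  | nil => simp [weighted]
  | cons c l ih => simp only [weighted, ih, Finset.sum_add_distrib, Finset.mul_sum]

theorem wt_range (n : ℕ) : wt y (List.range n) = ∑ g ∈ Finset.range n, y g := by
  induction n with
  | zero => simp [wt]
  | succ n ih =>
    rw [Finset.sum_range_succ, ← ih]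
    simp [wt, List.range_succ]

/-- This is the easy direction of Farkas' lemma. The combined left-hand coefficients dominate the
right-hand ones plus `t` at every point that may be nonempty, so adding everything gives `t` doubled
copies of the total. As the total is at least `28 * q`, these contribute `56 * t`, and the constants
contradict each other, either strictly or through a strict inequality in the combination. -/
theorem not_refutes (hq : 0 < q) (htot : 28 * q ≤ wt y (List.range 25)) {t : ℕ}
    {l : List (ℕ × Lin)} {z : ℕ → Bool} (hz : ∀ g, z g = true → y g = 0)
    (hl : ∀ c ∈ l, c.2.Holds y q) : refutes z t l ≠ true := by
  intro h
  simp only [refutes, Bool.and_eq_true, Bool.or_eq_true, List.all_eq_true, Nat.ble_eq,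
    List.mem_range] at h
  obtain ⟨⟨hr, hc⟩, hb⟩ := h
  have h1 : weighted (fun c => (wt y c.lhs * 2 + c.const * q) + c.gap) l ≤
      weighted (fun c => wt y c.rhs * 2 + c.bound * q) l :=
    weighted_mono fun c hc => by
      have := hl c hc
      simp only [Lin.Holds, Lin.gap] at this ⊢
      omega
  simp only [weighted_add, weighted_mul] at h1
  have h2 : weighted (fun c => wt y c.rhs) l =
      ∑ g ∈ Finset.range 25, weighted (fun c => count g c.rhs) l * y g := by
    simp only [← weighted_mul]
    rw [← weighted_sum]
    exact le_antisymm
      (weighted_mono fun c hc' => (sum_count_mul_eq _ _ fun g hg => by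
        have := hr c hc' g hg; omega).ge)
      (weighted_mono fun c hc' => (sum_count_mul_le _ _))
  have h3 : ∑ g ∈ Finset.range 25, weighted (fun c => count g c.lhs) l * y g ≤
      weighted (fun c => wt y c.lhs) l := by
    simp only [← weighted_mul]
    rw [← weighted_sum]
    exact weighted_mono fun c hc' => (sum_count_mul_le _ _)
  have h4 : t * wt y (List.range 25) + weighted (fun c => wt y c.rhs) l ≤
      weighted (fun c => wt y c.lhs) l := by
    refine le_trans ?_ h3
    rw [h2, wt_range, Finset.mul_sum, ← Finset.sum_add_distrib]
    refine Finset.sum_le_sum fun g hg => ?_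
    rw [← add_mul]
    rcases hc g (Finset.mem_range.1 hg) with h' | h'
    · simp [hz g h']
    · exact Nat.mul_le_mul_right _ h'
  have h5 : t * (28 * q) ≤ t * wt y (List.range 25) := Nat.mul_le_mul_left _ htot
  have h6 : (56 * t + weighted Lin.const l) * q + weighted Lin.gap l ≤
      weighted Lin.bound l * q := by
    have : (56 * t + weighted Lin.const l) * q = 2 * (t * (28 * q)) + weighted Lin.const l * q := by
      ring
    omega
  rcases hb with hb | ⟨hb, hs⟩
  · have := Nat.mul_le_mul_right q hb
    rw [add_mul, one_mul] at this
    omega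
  · have := Nat.mul_le_mul_right q hb
    omega

/-- Every inner node splits on a statement or its negation, so some branch consists of true facts.
It cannot end in a refuted leaf, hence it ends in a `goal`. The arbitrary conclusion `P` lets the
same induction serve for contradictions and for the two surviving patterns. -/
theorem Tree.sound {P : Prop} {good : List Fact → Bool} (h : System y q E H r)
    (hgood : ∀ S : List Fact, (∀ f ∈ S, f.Holds y q) → good S = true → P) (T : Tree) :
    ∀ S : List Fact, (∀ f ∈ S, f.Holds y q) → T.check E H r good S = true → P := by
  have cons : ∀ {f : Fact} {S : List Fact}, f.Holds y q → (∀ f ∈ S, f.Holds y q) →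
      ∀ f' ∈ f :: S, f'.Holds y q := by
    intro f S hf hS f' hf'
    rcases List.mem_cons.1 hf' with rfl | h'
    exacts [hf, hS _ h']
  have zeros : ∀ {l : List ℕ} {S : List Fact}, (∀ g ∈ l, y g = 0) → (∀ f ∈ S, f.Holds y q) →
      ∀ f' ∈ (l.map fun h => Fact.le h 0) ++ S, f'.Holds y q := by
    intro l S hl hS f' hf'
    rcases List.mem_append.1 hf' with h' | h'
    · obtain ⟨g, hg, rfl⟩ := List.mem_map.1 h'
      simp [Fact.Holds, hl g hg]
    · exact hS _ h'
  induction T with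
  | goal => exact fun S hS hc => hgood S hS hc
  | leaf t l =>
    intro S hS hc
    -- Points with recorded upper bound zero are empty, so their coefficients need not be compared.
    refine absurd hc (not_refutes h.pos h.total (fun g hg => ?_) fun c hc' => ?_)
    · have := le_upper h.bound hS g
      rw [Nat.eq_of_beq_eq_true hg] at this
      omega
    obtain ⟨c', -, rfl⟩ := List.mem_map.1 hc'
    exact Con.lin_holds h hS _
  | level g m yes no ihy ihn =>
    intro S hS hc
    simp only [check, Bool.and_eq_true] at hc
    rcases lt_or_ge (m * q) (y g) with h' | h'
    · exact ihy _ (cons (f := .gt g m) h' hS) hc.1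
    · exact ihn _ (cons (f := .le g m) h' hS) hc.2
  | free g yes no ihy ihn =>
    intro S hS hc
    simp only [check, Bool.and_eq_true] at hc
    by_cases h' : NonFree y g
    · exact ihn _ (cons (f := .nf g) h' hS) hc.2
    · simp only [NonFree, not_or, not_exists, not_and, not_lt, Nat.le_zero] at h'
      exact ihy _ (cons (f := .gt g 0) (by simpa [Fact.Holds] using Nat.pos_of_ne_zero h'.1)
        (zeros h'.2 hS)) hc.1
  | dir d yes no ihy ihn =>
    intro S hS hc
    simp only [check, Bool.and_eq_true] at hc
    by_cases h' : ∃ h ∈ multiples d, 0 < y h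
    · exact ihy _ (cons (f := .dir d) h' hS) hc.1
    · simp only [not_exists, not_and, not_lt, Nat.le_zero] at h'
      exact ihn _ (zeros h' hS) hc.2

end

end Certificate

/-! ### The explicit decision trees and their verification. -/

namespace Certificate

/-- Certificate for the case: a row of maximal weight is supported on three points, one
isolated; weight above `4` at `(1, 0)`. -/
def tripleTree : Tree :=
  .level 3 0 (.leaf 2 [(2, .edge 3 4), (3, .edge 7 8), (5, .pair 3 5), (3, .pair 3 7), (2, .sum 7
  1), (2, .row 2), (2, .row 3), (2, .row 4)]) (.level 5 3 (.level 24 0 (.leaf 2 [(1, .add 5 5), (1,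
  .sub 5 1), (5, .edge 7 8), (1, .edge 7 24), (1, .edge 8 23), (1, .pair 7 5), (1, .pair 8 5), (1,
  .pair 24 1), (2, .pair 24 5), (1, .pair 24 11), (1, .line 9 1), (1, .row 2), (2, .row 3), (1, .row
  4)]) (.level 16 2 (.leaf 1 [(1, .add 5 5), (1, .sub 5 16), (1, .sub 1 16), (1, .add 1 16), (1,
  .sub 16 5), (1, .sub 5 1), (1, .edge 8 23), (1, .sum 20 12), (1, .pair 16 13), (1, .side 16 16),
  (1, .line 9 1)]) (.level 15 0 (.leaf 7 [(4, .add 5 5), (7, .sub 5 1), (10, .edge 7 8), (7, .edge 8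
  23), (4, .pair 7 5), (5, .pair 7 22), (7, .sum 7 1), (4, .pair 8 5), (7, .pair 15 5), (4, .pair 15
  11), (2, .pair 15 14), (2, .line 9 1), (3, .row 2), (7, .row 3), (6, .low 1)]) (.level 19 2 (.leaf
  1 [(1, .add 5 5), (1, .sub 19 1), (1, .sub 5 19), (1, .sub 19 5), (1, .sub 1 19), (1, .sub 5 1),
  (1, .edge 8 23), (1, .pair 7 22), (1, .sum 7 1), (1, .pair 8 5), (1, .pair 8 11), (1, .pair 8
  17)]) (.free 19 (.leaf 3 [(1, .add 5 5), (3, .up 19), (2, .sub 5 1), (4, .edge 7 8), (1, .edge 8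
  23), (1, .pair 7 1), (2, .pair 7 22), (2, .sum 7 1), (1, .pair 8 5), (2, .pair 8 17), (1, .sum 14
  5), (3, .pair 19 16), (1, .line 6 4), (2, .row 2), (1, .row 4)]) (.level 19 0 (.leaf 6 [(2, .add 5
  5), (4, .sub 5 1), (9, .edge 7 8), (2, .edge 8 23), (2, .edge 12 19), (4, .edge 18 19), (1, .pair
  7 1), (4, .pair 7 22), (3, .sum 7 1), (2, .pair 8 5), (4, .pair 8 17), (2, .sum 18 1), (2, .sum 14
  5), (6, .pair 19 16), (2, .line 6 4), (4, .row 2), (2, .row 4)]) (.level 16 0 (.leaf 2 [(1, .add 5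
  5), (2, .up 16), (1, .sub 5 1), (3, .edge 7 8), (1, .edge 8 23), (1, .pair 7 5), (1, .pair 7 18),
  (1, .pair 8 4), (1, .pair 8 5), (1, .pair 16 1), (1, .sum 17 4), (1, .sum 11 5), (1, .line 9 1),
  (1, .row 2), (1, .row 4)]) (.leaf 12 [(5, .add 5 5), (12, .sub 5 1), (13, .edge 7 8), (7, .edge 8
  23), (5, .pair 7 5), (6, .pair 7 18), (7, .pair 7 22), (7, .sum 7 1), (5, .pair 8 5), (6, .pair 8
  17), (5, .line 6 4), (5, .line 9 1), (7, .row 2), (1, .row 3)])))))))) (.leaf 1 [(4, .up 5), (3,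
  .edge 7 8), (1, .sum 8 4), (1, .sum 7 1), (1, .row 2), (1, .row 3), (1, .row 4)]))

/-- Certificate for the case: a row of maximal weight is supported on one point; weight
above `4` at `(1, 0)`. -/
def singleTree : Tree :=
  .free 4 (.free 5 (.free 10 (.leaf 1 [(1, .up 1), (1, .up 4), (2, .sum 5 5), (1, .row 2), (1, .row
  3), (1, .row 4)]) (.free 24 (.leaf 1 [(1, .sum 24 5), (1, .pair 24 5), (1, .line 9 1), (1, .row
  2), (1, .row 3)]) (.free 15 (.leaf 8 [(3, .up 1), (2, .sum 24 5), (3, .pair 5 24), (5, .pair 15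
  5), (5, .pair 15 15), (5, .line 6 4), (5, .line 9 1), (8, .row 2), (3, .row 3), (3, .row 4)])
  (.free 17 (.leaf 9 [(4, .up 1), (5, .nf 15), (5, .sum 24 5), (5, .pair 5 5), (5, .pair 17 5), (1,
  .sum 12 5), (4, .pair 17 12), (5, .line 6 1), (5, .line 6 4), (4, .row 2), (4, .row 3), (4, .row
  4)]) (.free 12 (.leaf 9 [(4, .up 1), (5, .nf 15), (5, .sum 24 5), (5, .pair 5 5), (1, .pair 12 5),
  (4, .pair 12 17), (5, .pair 12 23), (5, .line 9 1), (5, .line 9 4), (4, .row 2), (4, .row 3), (4,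
  .row 4)]) (.free 18 (.leaf 14 [(6, .up 1), (1, .nf 12), (7, .nf 15), (8, .sum 24 5), (8, .pair 5
  5), (1, .pair 5 11), (1, .pair 5 15), (8, .pair 18 5), (7, .pair 18 11), (8, .line 9 1), (7, .line
  9 4), (6, .row 2), (6, .row 3), (6, .row 4)]) (.level 10 0 (.leaf 2 [(2, .up 1), (2, .edge 15 16),
  (2, .edge 17 18), (3, .sum 5 5), (2, .pair 10 19), (2, .row 2), (2, .row 4)]) (.level 15 0 (.leaf
  5 [(1, .edge 11 12), (3, .edge 12 19), (2, .edge 16 17), (3, .edge 17 18), (2, .edge 18 19), (2,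
  .sum 24 5), (2, .sum 22 13), (2, .pair 15 1), (1, .sum 16 4), (2, .pair 15 5), (3, .pair 15 11),
  (4, .pair 15 14), (5, .pair 15 15), (2, .pair 15 23), (1, .row 2), (3, .row 4)]) (.free 13 (.leaf
  2 [(1, .up 1), (1, .sum 24 5), (1, .pair 13 16), (3, .pair 13 22), (1, .line 6 1), (1, .line 6 4),
  (1, .row 2), (1, .row 3), (1, .row 4)]) (.level 11 0 (.free 19 (.leaf 14 [(9, .up 1), (5, .nf 13),
  (1, .sum 24 5), (4, .pair 5 24), (10, .pair 11 5), (5, .sum 22 19), (10, .sum 14 5), (5, .line 6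
  1), (10, .line 6 4), (4, .row 2), (4, .row 3), (9, .row 4)]) (.leaf 3 [(1, .nf 17), (3, .nf 19),
  (2, .edge 13 18), (1, .pair 5 24), (2, .pair 11 1), (3, .pair 11 5), (1, .pair 11 14), (2, .line 6
  4), (1, .line 9 1), (1, .row 2), (2, .row 4)])) (.free 14 (.leaf 5 [(1, .up 4), (3, .nf 12), (2,
  .pair 5 24), (4, .pair 14 5), (2, .sum 23 16), (5, .line 9 1), (2, .line 9 4), (1, .row 3), (3,
  .row 4)]) (.leaf 1 [(1, .up 1), (1, .up 4), (3, .up 5), (1, .edge 12 13), (1, .edge 13 14), (1,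
  .row 3), (1, .row 4)])))))))))))) (.leaf 1 [(1, .up 1), (1, .up 4), (4, .nf 5), (1, .row 2), (1,
  .row 3), (1, .row 4)])) (.leaf 1 [(1, .up 1), (4, .up 5), (1, .edge 3 4), (1, .row 2), (1, .row
  3), (1, .row 4)])

/-- Certificate for the case: a row of maximal weight is supported on two non-adjacent
points; no weight above `4`. -/
def doubleTreeOfBound : Tree :=
  .dir 5 (.level 3 0 (.leaf 1 [(1, .up 1), (1, .edge 3 4), (4, .pair 3 6), (1, .row 2), (1, .row 3),
  (1, .row 4)]) (.level 20 0 (.dir 7 (.dir 8 (.free 9 (.level 11 0 (.leaf 1 [(1, .up 9), (1, .nf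
  21), (1, .nf 24), (1, .edge 6 20), (1, .pair 11 23), (2, .pair 20 6), (1, .pair 20 9), (1, .row
  2), (1, .row 3), (1, .low 1)]) (.leaf 2 [(1, .nf 21), (1, .nf 24), (1, .edge 6 20), (1, .pair 6
  9), (1, .pair 9 9), (5, .pair 20 6), (2, .pair 20 9), (1, .pair 20 14), (1, .dir 8 1), (1, .row
  2), (2, .row 3), (1, .row 4), (4, .low 1)])) (.leaf 1 [(3, .nf 9), (4, .pair 20 6), (1, .pair 20
  9), (1, .row 2), (1, .row 3), (1, .row 4), (3, .low 1)])) (.leaf 16 [(3, .nf 21), (3, .nf 24), (3,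
  .edge 6 20), (9, .pair 6 9), (3, .pair 6 12), (9, .pair 9 9), (46, .pair 20 6), (16, .pair 20 9),
  (3, .sum 16 9), (9, .pair 20 14), (3, .pair 20 17), (3, .line 8 1), (7, .row 2), (13, .row 3),
  (13, .row 4), (33, .low 1)])) (.leaf 1 [(2, .up 9), (1, .nf 24), (1, .edge 6 20), (1, .edge 21
  22), (2, .pair 20 6), (1, .pair 20 9), (1, .row 2), (1, .row 3), (1, .low 1)])) (.level 22 0
  (.level 23 0 (.leaf 3 [(2, .nf 21), (3, .edge 9 22), (3, .edge 23 24), (1, .pair 6 6), (1, .pair 9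
  6), (5, .pair 22 9), (1, .pair 22 14), (3, .pair 23 6), (1, .pair 23 13), (1, .dir 5 1), (2, .row
  2), (3, .row 3), (3, .low 1)]) (.level 18 0 (.leaf 1 [(2, .up 6), (1, .edge 9 22), (1, .pair 18
  6), (1, .pair 22 4), (2, .pair 22 9), (1, .row 2), (1, .row 3), (1, .low 1)]) (.level 12 0 (.leaf
  1 [(1, .edge 9 22), (1, .sum 6 6), (1, .pair 12 24), (1, .pair 22 4), (2, .pair 22 9), (1, .row
  2), (1, .row 3), (1, .low 1)]) (.level 10 0 (.dir 7 (.leaf 4 [(1, .sum 17 17), (4, .sum 9 6), (2,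
  .pair 22 9), (2, .tri 6 9), (2, .dir 5 1), (2, .dir 5 4), (2, .dir 7 4), (2, .row 2), (2, .row 3),
  (2, .row 4)]) (.leaf 4 [(2, .pair 9 13), (1, .pair 9 15), (2, .pair 10 1), (1, .sum 11 4), (6,
  .sum 9 6), (2, .pair 10 19), (1, .sum 21 1), (1, .pair 22 9), (3, .tri 6 9), (1, .line 7 4), (1,
  .row 2), (2, .row 3), (3, .row 4)])) (.leaf 11 [(8, .edge 9 22), (7, .pair 9 13), (4, .pair 9 15),
  (1, .pair 22 4), (1, .pair 22 9), (3, .pair 22 14), (10, .dir 5 1), (7, .dir 5 4), (3, .line 7 4),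
  (1, .row 2), (4, .row 3)]))))) (.level 10 0 (.free 4 (.free 11 (.leaf 0 [(1, .low 10)]) (.free 14
  (.leaf 0 [(1, .low 10)]) (.free 16 (.leaf 0 [(1, .low 10)]) (.free 19 (.leaf 2 [(1, .up 1), (1,
  .pair 6 23), (1, .pair 9 13), (3, .sum 9 6), (1, .tri 6 9), (1, .dir 5 1), (1, .dir 5 4), (1, .row
  2), (1, .row 3), (1, .row 4)]) (.level 10 1 (.leaf 1 [(1, .up 1), (1, .up 4), (4, .top 6 9), (1,
  .row 2), (1, .row 3), (1, .row 4)]) (.level 23 1 (.leaf 1 [(1, .up 1), (1, .up 9), (3, .sum 9 6),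
  (1, .side 23 6), (1, .row 2), (1, .row 3), (1, .row 4)]) (.level 4 1 (.level 18 2 (.leaf 5 [(3,
  .add 18 18), (3, .up 10), (3, .sub 18 1), (5, .sub 1 18), (5, .add 1 18), (2, .pair 6 15), (3,
  .pair 10 4), (2, .sum 11 4), (1, .pair 10 16), (3, .pair 10 24), (3, .pair 18 16), (5, .side 18
  18), (1, .dir 5 1), (3, .line 8 1), (2, .row 2), (2, .row 4)]) (.level 4 2 (.level 12 3 (.leaf 2
  [(2, .up 10), (2, .sub 1 12), (2, .add 1 12), (2, .sub 12 4), (2, .sub 12 1), (2, .add 12 12), (2,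
  .pair 6 12), (2, .pair 10 4), (1, .top 6 6), (2, .sum 21 16), (2, .line 8 1), (2, .low 12)])
  (.level 4 3 (.level 12 2 (.leaf 6 [(6, .up 10), (6, .sub 1 12), (4, .up 12), (6, .add 1 12), (4,
  .sub 12 4), (4, .up 18), (4, .sub 12 1), (2, .add 12 12), (2, .pair 6 15), (6, .pair 10 4), (10,
  .sum 9 6), (4, .pair 10 16), (1, .top 6 6), (2, .line 8 1), (2, .row 3), (4, .row 4)]) (.free 12
  (.leaf 1 [(1, .up 1), (1, .up 10), (1, .up 12), (1, .pair 10 4), (3, .sum 9 6), (1, .row 3), (1,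
  .row 4)]) (.free 18 (.leaf 1 [(1, .up 4), (1, .up 10), (1, .edge 11 12), (1, .sum 14 1), (3, .sum
  9 6), (1, .row 3), (1, .row 4)]) (.level 13 0 (.free 23 (.leaf 1 [(1, .up 1), (1, .top 6 23), (1,
  .sum 9 9), (1, .pair 13 21), (2, .pair 23 6), (1, .row 2), (1, .row 3), (1, .low 4)]) (.free 24
  (.free 13 (.leaf 3 [(1, .up 4), (3, .up 10), (2, .pair 9 13), (2, .pair 9 15), (1, .sum 9 6), (2,
  .pair 10 19), (1, .pair 10 24), (1, .tri 9 9), (3, .dir 5 1), (1, .row 3)]) (.free 15 (.leaf 2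
  [(2, .up 10), (2, .edge 13 18), (1, .sum 17 17), (2, .pair 10 4), (2, .pair 10 21), (2, .sum 12
  1), (2, .tri 9 15)]) (.leaf 4 [(4, .up 10), (2, .edge 11 15), (2, .edge 12 13), (2, .edge 13 18),
  (1, .sum 17 17), (2, .pair 10 4), (2, .sum 9 6), (2, .pair 10 21), (2, .pair 10 24), (2, .sum 12
  1), (2, .dir 5 1), (2, .dir 5 4), (2, .row 3)]))) (.leaf 4 [(4, .up 4), (2, .up 10), (1, .edge 11
  12), (4, .edge 23 24), (2, .sum 14 1), (6, .sum 9 6), (3, .pair 10 21), (1, .sum 12 1), (2, .tri 9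
  9), (1, .dir 5 1), (2, .row 2), (4, .row 3)]))) (.leaf 1 [(1, .up 4), (1, .up 10), (1, .edge 11
  12), (1, .sum 14 1), (3, .sum 9 6), (1, .row 3), (1, .row 4)]))))) (.leaf 1 [(1, .up 1), (1, .up
  4), (4, .sum 9 6), (1, .row 2), (1, .row 3), (1, .row 4)]))) (.leaf 1 [(1, .up 1), (1, .up 4), (4,
  .sum 9 6), (1, .row 2), (1, .row 3), (1, .row 4)]))) (.leaf 1 [(1, .up 1), (1, .up 4), (4, .sum 9
  6), (1, .row 2), (1, .row 3), (1, .row 4)])))))))) (.leaf 1 [(1, .up 1), (1, .nf 4), (4, .sum 9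
  6), (1, .row 2), (1, .row 3), (1, .row 4)])) (.level 13 0 (.level 12 0 (.leaf 2 [(2, .up 4), (2,
  .edge 13 14), (2, .sum 11 1), (1, .sum 6 6), (3, .sum 9 9), (2, .tri 6 6), (2, .row 3), (2, .row
  4)]) (.level 23 0 (.leaf 4 [(3, .pair 13 1), (2, .sum 9 9), (3, .pair 13 23), (3, .pair 23 1), (4,
  .pair 23 6), (3, .tri 9 9), (3, .dir 5 1), (1, .row 2), (4, .row 3), (1, .row 4), (5, .low 1)])
  (.dir 7 (.leaf 4 [(2, .pair 6 18), (1, .sum 17 17), (2, .pair 13 1), (2, .tri 9 9), (4, .dir 5 1),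
  (2, .dir 5 4), (2, .dir 7 4), (2, .row 3), (2, .low 1)]) (.leaf 3 [(2, .up 4), (2, .up 6), (1,
  .pair 6 18), (1, .pair 9 13), (1, .pair 9 15), (2, .tri 9 9), (3, .dir 5 1), (1, .dir 5 4), (2,
  .row 3)])))) (.level 18 2 (.leaf 11 [(1, .up 4), (6, .add 18 18), (10, .sub 1 18), (3, .add 1 18),
  (3, .pair 6 15), (3, .pair 18 11), (6, .pair 18 16), (10, .side 18 18), (4, .dir 5 1), (7, .dir 5
  4), (7, .line 8 1), (4, .row 2), (1, .row 3), (4, .row 4)]) (.level 17 2 (.leaf 2 [(1, .up 1), (3,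
  .add 17 17), (2, .sub 17 1), (1, .add 1 17), (1, .pair 6 6), (1, .pair 6 23), (1, .pair 9 15), (1,
  .sum 11 6), (1, .pair 17 12), (1, .side 17 17), (1, .pair 17 19), (1, .dir 5 1), (1, .row 3), (1,
  .row 4)]) (.free 11 (.leaf 6 [(1, .up 1), (1, .up 17), (5, .up 18), (1, .sum 17 14), (1, .pair 6
  23), (1, .sum 23 11), (3, .pair 11 6), (3, .pair 11 23), (5, .dir 5 1), (5, .dir 5 4), (1, .row
  3), (1, .row 4)]) (.free 16 (.leaf 18 [(2, .up 1), (16, .up 18), (8, .pair 6 6), (2, .pair 6 23),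
  (8, .sum 12 9), (7, .sum 23 23), (16, .dir 5 1), (16, .dir 5 4), (2, .row 2), (2, .row 3), (2,
  .row 4)]) (.free 19 (.leaf 1 [(1, .pair 6 17), (1, .dir 5 1), (1, .dir 5 4)]) (.level 19 1 (.leaf
  5 [(2, .sub 19 1), (4, .sub 1 19), (1, .edge 11 15), (1, .sum 17 14), (1, .pair 6 23), (3, .pair
  19 17), (4, .dir 5 1), (4, .dir 5 4), (3, .dir 8 1), (1, .row 3), (1, .row 4), (2, .low 1)])
  (.free 17 (.leaf 24 [(20, .up 19), (5, .pair 6 6), (10, .pair 6 23), (15, .pair 9 15), (9, .sum 11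
  6), (4, .pair 17 9), (10, .pair 17 12), (12, .tri 17 17), (15, .dir 5 1), (4, .dir 5 4), (9, .line
  8 1), (5, .row 4)]) (.free 18 (.free 15 (.leaf 10 [(3, .up 1), (3, .pair 6 6), (2, .pair 6 15),
  (1, .pair 9 15), (5, .pair 15 6), (6, .pair 15 9), (10, .pair 15 14), (5, .tri 18 18), (7, .line 8
  1), (3, .row 4)]) (.leaf 3 [(3, .up 18), (1, .edge 11 15), (1, .edge 15 16), (2, .pair 6 6), (1,
  .pair 6 23), (1, .sum 14 9), (2, .dir 5 1), (2, .dir 5 4), (1, .line 8 1), (1, .row 4)])) (.free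
  15 (.leaf 10 [(3, .up 1), (10, .edge 17 18), (3, .pair 6 6), (1, .pair 6 23), (3, .pair 9 15), (8,
  .pair 15 6), (1, .sum 14 6), (5, .pair 15 9), (9, .pair 15 14), (7, .line 8 1), (2, .row 4)])
  (.free 14 (.leaf 9 [(3, .edge 11 15), (3, .edge 15 16), (8, .edge 18 19), (5, .pair 6 6), (2,
  .pair 6 23), (1, .pair 14 9), (1, .pair 14 12), (2, .pair 14 14), (6, .dir 5 1), (7, .dir 5 4),
  (3, .line 8 1), (2, .row 4)]) (.leaf 4 [(1, .edge 11 15), (1, .edge 14 17), (1, .edge 15 16), (3,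
  .edge 17 18), (1, .edge 18 19), (2, .pair 6 6), (1, .pair 6 23), (3, .dir 5 1), (3, .dir 5 4), (2,
  .line 8 1), (1, .row 4), (1, .low 1)])))))))))))))))) (.level 3 0 (.leaf 1 [(1, .up 1), (1, .edge
  3 4), (4, .pair 3 6), (1, .row 2), (1, .row 3), (1, .row 4)]) (.level 18 1 (.level 13 0 (.level 12
  0 (.leaf 1 [(1, .edge 11 12), (1, .edge 14 17), (1, .edge 18 19), (1, .side 18 13), (1, .sum 6 6),
  (1, .sum 9 9), (1, .pair 13 16), (1, .row 4)]) (.leaf 2 [(2, .add 1 18), (2, .edge 14 17), (1,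
  .sum 9 9), (2, .pair 18 11), (2, .side 18 13), (2, .pair 18 16), (4, .side 18 18), (2, .row 4),
  (2, .low 18)])) (.free 12 (.leaf 1 [(1, .up 1), (1, .up 4), (1, .sub 1 18), (1, .top 6 12), (1,
  .side 18 18), (1, .pair 12 9), (1, .sum 14 9), (1, .row 4)]) (.free 19 (.leaf 0 [(1, .low 18)])
  (.level 22 0 (.leaf 2 [(1, .up 4), (2, .sub 1 18), (1, .add 1 18), (1, .edge 12 19), (1, .pair 18
  11), (2, .side 18 18), (2, .sum 16 6), (5, .pair 22 9), (1, .pair 22 14), (1, .row 2), (2, .row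
  4), (3, .low 1)]) (.level 14 0 (.leaf 3 [(2, .up 1), (3, .sub 1 18), (3, .edge 12 19), (1, .pair 6
  23), (1, .pair 18 6), (3, .top 9 14), (2, .pair 18 11), (2, .pair 18 16), (3, .side 18 18), (1,
  .line 5 1), (2, .row 4)]) (.leaf 3 [(2, .up 1), (3, .up 9), (3, .sub 1 18), (3, .edge 12 19), (1,
  .pair 6 23), (1, .pair 18 6), (2, .pair 18 11), (2, .pair 18 16), (3, .side 18 18), (1, .line 5
  1), (2, .row 4)])))))) (.level 22 0 (.level 23 0 (.leaf 7 [(2, .up 18), (7, .nf 21), (7, .edge 9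
  22), (7, .edge 23 24), (2, .pair 6 6), (2, .sum 16 6), (10, .pair 22 9), (2, .pair 22 14), (2,
  .pair 22 19), (7, .pair 23 6), (2, .sum 17 6), (2, .pair 23 13), (5, .row 2), (5, .row 3), (3,
  .low 1)]) (.free 12 (.leaf 2 [(2, .edge 9 22), (2, .pair 12 24), (2, .pair 22 4), (3, .pair 22 9),
  (1, .pair 22 14), (1, .tri 6 6), (1, .row 2), (2, .row 3), (1, .low 1)]) (.free 13 (.leaf 1 [(1,
  .edge 21 22), (1, .pair 9 13), (1, .pair 13 6), (1, .pair 13 11), (1, .pair 13 16), (1, .pair 22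
  9)]) (.level 17 0 (.leaf 9 [(4, .up 18), (6, .edge 9 22), (9, .edge 13 14), (3, .pair 6 6), (6,
  .sum 24 12), (3, .pair 17 4), (9, .sum 11 6), (4, .pair 17 19), (6, .pair 22 4), (1, .sum 16 6),
  (9, .pair 22 9), (2, .tri 17 17), (5, .row 3), (3, .row 4)]) (.level 13 0 (.leaf 5 [(5, .up 18),
  (4, .edge 9 22), (2, .edge 13 14), (2, .sum 24 12), (5, .pair 13 6), (2, .pair 13 11), (1, .pair
  13 16), (4, .pair 22 4), (4, .sum 16 6), (5, .pair 22 9), (3, .row 2), (1, .row 4)]) (.leaf 18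
  [(2, .up 4), (18, .up 18), (8, .edge 9 22), (12, .pair 6 6), (8, .pair 22 4), (18, .sum 16 6),
  (18, .pair 22 9), (1, .sum 11 11), (4, .pair 22 14), (10, .pair 22 19), (8, .line 5 4), (6, .row
  2), (10, .row 4)])))))) (.level 17 0 (.level 12 0 (.level 13 0 (.leaf 1 [(1, .edge 11 12), (1,
  .edge 13 14), (1, .edge 18 19), (1, .sum 6 6), (1, .pair 12 17), (1, .sum 9 9), (1, .sum 16 1),
  (1, .row 4)]) (.level 11 0 (.leaf 2 [(2, .edge 11 12), (2, .edge 18 19), (1, .pair 11 23), (1,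
  .sum 6 6), (1, .pair 12 24), (2, .pair 17 4), (1, .pair 17 9), (2, .pair 17 14), (1, .tri 17 17),
  (1, .row 4)]) (.leaf 8 [(8, .edge 18 19), (3, .pair 6 23), (6, .pair 12 9), (3, .pair 12 24), (2,
  .pair 17 4), (3, .pair 17 9), (3, .pair 17 12), (8, .pair 17 14), (5, .tri 6 6), (4, .tri 17 17),
  (5, .row 4)]))) (.free 14 (.leaf 0 [(1, .low 17)]) (.free 13 (.leaf 3 [(3, .up 1), (3, .pair 13
  6), (3, .pair 13 16), (3, .sum 11 6), (2, .tri 9 9), (1, .tri 9 13), (1, .tri 17 17), (3, .row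
  4)]) (.level 23 0 (.leaf 7 [(4, .up 18), (7, .edge 13 14), (4, .sum 16 1), (2, .sum 11 6), (4,
  .pair 17 9), (4, .pair 23 1), (7, .pair 23 6), (4, .sum 19 9), (5, .pair 23 11), (4, .tri 6 17),
  (3, .row 3), (3, .row 4), (1, .low 1)]) (.level 18 0 (.leaf 1 [(1, .up 1), (1, .edge 13 14), (1,
  .edge 16 17), (1, .edge 18 19), (1, .pair 17 9), (1, .pair 18 6), (1, .pair 18 11)]) (.leaf 4 [(4,
  .up 4), (4, .edge 13 14), (4, .sum 16 1), (2, .pair 17 9), (4, .pair 17 19), (1, .sum 21 21), (4,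
  .pair 17 24), (2, .tri 17 17)])))))) (.level 12 0 (.level 13 0 (.leaf 1 [(1, .up 18), (1, .edge 12
  19), (1, .edge 13 14), (1, .sum 11 1), (1, .sum 6 6), (1, .sum 9 9), (1, .pair 13 16), (1, .row
  4)]) (.level 11 0 (.leaf 4 [(2, .up 1), (4, .up 18), (2, .edge 11 12), (2, .edge 12 19), (2, .pair
  6 23), (2, .sum 11 1), (3, .sum 6 6), (4, .pair 12 9), (2, .pair 12 14), (2, .line 5 4), (2, .row
  4)]) (.leaf 7 [(3, .up 1), (1, .up 4), (2, .up 9), (7, .up 18), (3, .pair 6 23), (7, .pair 12 9),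
  (3, .pair 12 14), (4, .pair 12 19), (6, .tri 6 6), (3, .line 5 4), (1, .row 2), (4, .row 4)])))
  (.level 13 0 (.leaf 7 [(7, .up 18), (1, .pair 6 23), (4, .pair 13 1), (2, .sum 14 4), (7, .pair 13
  6), (3, .pair 13 11), (4, .pair 13 16), (2, .pair 13 23), (6, .tri 9 9), (3, .line 5 1), (1, .row
  2), (4, .row 4)]) (.level 23 0 (.leaf 2 [(2, .up 18), (1, .pair 23 1), (2, .pair 23 6), (2, .sum
  19 9), (1, .pair 23 11), (1, .sum 14 14), (1, .pair 23 23), (1, .line 5 1), (1, .row 4)]) (.leaf 1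
  [(1, .up 18), (1, .line 5 1), (1, .line 5 4)]))))))))

/-- Certificate for the case: a row of maximal weight is supported on three points, one
isolated; no weight above `4`. -/
def tripleTreeOfBound : Tree :=
  .free 5 (.free 10 (.leaf 2 [(2, .up 1), (2, .up 4), (1, .edge 3 3), (8, .edge 7 8), (4, .sum 5 5),
  (2, .row 2), (2, .row 3), (2, .row 4)]) (.free 23 (.leaf 0 [(1, .low 8)]) (.free 24 (.leaf 0 [(1,
  .low 7)]) (.level 10 0 (.leaf 2 [(2, .up 1), (2, .up 4), (1, .edge 3 3), (8, .edge 7 8), (4, .sum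
  5 5), (2, .row 2), (2, .row 3), (2, .row 4)]) (.level 3 1 (.leaf 0 [(1, .add 3 3), (1, .low 1)])
  (.level 5 1 (.level 5 2 (.level 12 2 (.leaf 1 [(1, .up 3), (3, .pair 7 1), (1, .sum 8 4), (4, .top
  5 7), (1, .row 2), (1, .row 3), (1, .row 4), (2, .low 1)]) (.level 13 2 (.leaf 1 [(1, .up 3), (3,
  .sum 7 1), (1, .pair 8 4), (4, .top 5 8), (1, .row 2), (1, .row 3), (1, .row 4), (2, .low 1)])
  (.level 15 2 (.leaf 0 [(1, .add 15 15), (1, .low 5)]) (.level 16 3 (.leaf 0 [(1, .add 16 16), (1,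
  .low 7)]) (.level 17 3 (.leaf 1 [(1, .up 3), (1, .sub 5 17), (1, .sub 17 1), (1, .add 8 17), (1,
  .add 5 17), (1, .edge 7 8), (1, .edge 7 24), (1, .pair 7 1), (1, .pair 8 5), (1, .line 6 4), (1,
  .row 3), (1, .low 17)]) (.level 19 3 (.leaf 0 [(1, .add 19 19), (1, .low 8)]) (.free 4 (.level 24
  1 (.leaf 2 [(5, .edge 7 8), (1, .edge 8 23), (1, .edge 20 24), (1, .pair 7 5), (1, .side 24 7),
  (1, .pair 8 5), (2, .side 24 5), (1, .pair 24 11), (1, .line 9 1), (1, .row 2), (2, .row 3), (1,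
  .row 4)]) (.level 18 3 (.leaf 1 [(1, .sub 5 18), (1, .add 7 18), (1, .add 5 18), (1, .up 24), (2,
  .edge 7 8), (1, .pair 7 5), (1, .pair 18 11), (1, .line 9 1), (1, .row 3), (1, .low 18)]) (.level
  22 3 (.leaf 2 [(2, .sub 22 8), (2, .sub 22 5), (2, .up 15), (2, .sub 5 22), (2, .add 22 22), (2,
  .edge 7 8), (2, .pair 7 1), (2, .pair 7 5), (1, .sum 16 16), (2, .side 22 7), (2, .line 9 1), (2,
  .row 4), (2, .low 1), (2, .low 22)]) (.level 15 1 (.free 20 (.leaf 1 [(2, .add 15 15), (2, .edge 7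
  8), (1, .edge 8 23), (1, .pair 7 22), (1, .sum 7 1), (1, .side 15 5), (1, .row 2), (1, .row 3)])
  (.leaf 1 [(3, .add 15 15), (2, .edge 7 8), (1, .edge 8 23), (1, .edge 20 24), (1, .pair 7 22), (1,
  .sum 7 1), (1, .row 2), (1, .row 3)])) (.level 5 3 (.level 17 2 (.leaf 1 [(1, .up 1), (1, .sub 5
  17), (1, .sub 17 1), (1, .add 5 17), (1, .up 24), (2, .edge 7 8), (1, .pair 8 5), (1, .pair 8 17),
  (1, .line 6 4), (1, .row 3), (2, .low 17)]) (.level 19 2 (.leaf 2 [(1, .add 19 19), (2, .sub 19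
  1), (2, .sub 5 19), (2, .add 1 19), (2, .sub 19 5), (2, .sub 1 19), (1, .add 5 19), (1, .edge 7
  8), (1, .pair 7 22), (2, .sum 7 1), (2, .pair 8 5), (1, .pair 8 11), (1, .pair 8 17), (1, .side 19
  19), (1, .line 6 4), (1, .row 4)]) (.free 15 (.dir 9 (.leaf 1 [(1, .up 15), (1, .up 17), (1, .add
  5 15), (1, .up 24), (1, .edge 8 23), (1, .pair 7 5), (1, .pair 8 4), (1, .pair 8 5), (1, .dir 9
  1), (2, .low 5)]) (.leaf 5 [(2, .up 1), (5, .up 15), (4, .up 18), (2, .up 24), (6, .edge 7 8), (2,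
  .edge 8 23), (5, .pair 7 5), (1, .pair 7 22), (2, .sum 7 1), (2, .pair 15 5), (4, .pair 15 14),
  (1, .line 9 1), (3, .row 4)])) (.level 24 0 (.dir 9 (.leaf 2 [(5, .edge 7 8), (1, .edge 7 24), (1,
  .edge 8 23), (1, .pair 7 5), (1, .pair 8 5), (1, .pair 24 1), (2, .pair 24 5), (1, .pair 24 11),
  (1, .dir 9 1), (1, .row 2), (2, .row 3), (1, .row 4)]) (.leaf 3 [(1, .up 15), (7, .edge 7 8), (1,
  .edge 8 23), (1, .side 5 24), (2, .pair 7 5), (1, .pair 7 14), (1, .sum 7 1), (1, .pair 24 1), (2,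
  .pair 24 5), (1, .sum 19 5), (2, .pair 24 11), (1, .line 9 1), (1, .row 2), (2, .row 3), (2, .row
  4)])) (.level 18 2 (.leaf 1 [(1, .sub 5 18), (1, .add 5 18), (2, .edge 7 8), (1, .pair 7 5), (1,
  .pair 7 18), (1, .pair 18 11), (1, .line 9 1), (1, .row 3), (2, .low 18)]) (.level 16 2 (.leaf 1
  [(1, .sub 5 16), (1, .sub 1 16), (1, .add 1 16), (1, .sub 16 5), (1, .edge 8 23), (1, .sum 20 12),
  (1, .pair 16 13), (1, .side 16 16), (1, .line 9 1)]) (.level 14 3 (.leaf 3 [(3, .up 4), (2, .sub 1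
  14), (3, .up 15), (3, .up 16), (3, .sub 14 1), (3, .add 5 14), (3, .add 14 14), (4, .edge 7 8),
  (1, .pair 7 5), (1, .sum 20 12), (2, .pair 14 11), (3, .line 9 1), (1, .row 2), (1, .low 14)])
  (.level 20 0 (.free 12 (.dir 9 (.leaf 11 [(11, .up 15), (8, .up 16), (9, .edge 8 23), (8, .side 5
  7), (4, .pair 8 4), (7, .pair 8 17), (4, .pair 12 17), (1, .pair 12 23), (11, .dir 9 1), (3, .dir
  9 4), (1, .row 4)]) (.leaf 1 [(1, .up 4), (1, .up 15), (1, .up 16), (1, .up 20), (1, .edge 8 23),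
  (1, .side 5 7), (1, .line 9 1)])) (.level 11 3 (.dir 6 (.leaf 2 [(2, .add 1 11), (2, .sub 11 20),
  (2, .sub 11 1), (2, .add 5 11), (2, .up 18), (2, .add 11 11), (1, .top 8 8), (2, .dir 6 1), (2,
  .dir 6 4)]) (.leaf 3 [(3, .up 1), (3, .sub 11 1), (3, .add 5 11), (3, .up 19), (3, .add 11 11),
  (4, .edge 7 8), (1, .pair 8 5), (1, .sum 20 13), (2, .pair 11 14), (3, .line 6 4), (1, .row 2),
  (1, .low 11)])) (.free 18 (.free 16 (.leaf 3 [(1, .up 14), (3, .up 16), (2, .edge 7 8), (2, .edge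
  8 23), (2, .pair 7 5), (1, .sum 20 12), (1, .sum 7 1), (3, .pair 18 11), (1, .tri 7 18), (2, .line
  9 1), (1, .row 4)]) (.leaf 3 [(1, .up 14), (2, .edge 7 8), (2, .edge 8 23), (3, .edge 15 16), (2,
  .pair 7 5), (1, .sum 20 12), (1, .sum 7 1), (3, .pair 18 11), (1, .tri 7 18), (2, .line 9 1), (1,
  .row 4)])) (.level 15 0 (.free 22 (.leaf 7 [(12, .edge 7 8), (1, .edge 11 12), (1, .edge 11 15),
  (1, .edge 12 19), (1, .edge 15 16), (6, .edge 18 19), (5, .side 5 15), (6, .pair 7 22), (2, .pair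
  8 5), (6, .pair 15 1), (2, .pair 15 5), (1, .pair 15 14), (7, .sum 17 5), (1, .line 9 1), (5, .row
  2)]) (.leaf 1 [(1, .up 17), (1, .edge 7 8), (1, .edge 11 12), (1, .edge 18 19), (1, .edge 22 23),
  (1, .side 5 15), (1, .pair 8 5), (1, .pair 15 1), (1, .pair 15 14)])) (.free 19 (.level 16 0
  (.leaf 1 [(2, .edge 7 8), (1, .top 16 19), (1, .pair 16 1), (1, .sum 11 5), (1, .pair 16 13), (1,
  .sum 14 5), (1, .row 4)]) (.level 13 0 (.leaf 2 [(1, .up 11), (2, .up 19), (3, .edge 7 8), (1,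
  .pair 7 22), (2, .pair 8 5), (1, .pair 8 17), (2, .pair 13 1), (1, .line 6 4), (1, .row 4)])
  (.leaf 2 [(2, .up 1), (1, .up 11), (2, .up 19), (3, .edge 7 8), (1, .pair 7 22), (1, .pair 8 17),
  (2, .sum 14 5), (1, .line 6 4), (1, .row 4)]))) (.free 17 (.leaf 2 [(2, .up 1), (1, .up 11), (3,
  .edge 7 8), (2, .edge 12 19), (1, .pair 7 22), (2, .pair 8 5), (1, .pair 8 17), (1, .line 6 4),
  (1, .row 4)]) (.level 17 0 (.level 16 0 (.leaf 6 [(3, .edge 7 8), (5, .edge 8 23), (5, .edge 12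
  19), (6, .edge 16 17), (1, .edge 18 19), (1, .sum 7 1), (4, .pair 8 4), (3, .sum 20 13), (3, .sum
  11 5), (2, .pair 16 13), (2, .pair 16 20), (5, .dir 9 1), (1, .row 2), (1, .row 4)]) (.dir 6
  (.leaf 4 [(5, .edge 7 8), (3, .edge 12 19), (1, .edge 17 18), (1, .sum 8 4), (2, .sum 20 13), (1,
  .dir 6 1), (3, .dir 6 4), (3, .dir 9 1), (1, .row 2), (1, .row 4)]) (.leaf 3 [(1, .up 1), (1, .up
  11), (3, .up 19), (4, .edge 7 8), (1, .edge 14 17), (1, .pair 7 22), (1, .pair 8 5), (2, .sum 20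
  13), (1, .pair 17 5), (2, .pair 17 14), (2, .line 6 4), (1, .row 4)]))) (.free 13 (.leaf 1 [(1,
  .up 11), (1, .up 19), (1, .edge 8 23), (1, .sum 7 1), (1, .sum 20 13), (1, .pair 13 16), (1, .pair
  13 22)]) (.level 4 1 (.level 12 1 (.leaf 2 [(1, .add 1 12), (2, .up 16), (1, .sub 12 1), (1, .edge
  8 23), (1, .edge 11 12), (1, .edge 18 19), (1, .pair 7 1), (2, .sum 8 4), (3, .top 5 7), (1, .side
  12 20), (1, .line 9 1), (1, .row 2), (1, .row 4)]) (.level 20 1 (.level 11 2 (.leaf 1 [(1, .up 4),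
  (1, .up 11), (1, .add 1 11), (1, .add 5 11), (1, .add 11 11), (1, .edge 8 23), (1, .edge 18 19),
  (1, .sum 7 1), (1, .pair 8 5), (1, .pair 11 14)]) (.free 11 (.leaf 3 [(1, .up 1), (1, .up 4), (2,
  .up 11), (3, .edge 7 8), (2, .edge 8 23), (3, .edge 18 19), (2, .pair 7 22), (2, .sum 7 1), (2,
  .pair 8 5), (3, .pair 11 5), (2, .pair 11 14), (1, .row 2), (1, .row 4)]) (.level 11 0 (.leaf 3
  [(1, .up 1), (1, .up 4), (3, .edge 7 8), (2, .edge 8 23), (2, .edge 11 12), (3, .edge 18 19), (2,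
  .pair 7 22), (2, .sum 7 1), (2, .pair 8 5), (3, .pair 11 5), (2, .pair 11 14), (1, .row 2), (1,
  .row 4)]) (.dir 9 (.leaf 1 [(1, .up 16), (1, .edge 8 23), (1, .edge 12 19), (1, .pair 8 4), (1,
  .sum 20 13), (1, .dir 9 1)]) (.leaf 1 [(1, .up 16), (1, .up 20), (1, .edge 8 23), (1, .edge 12
  19), (1, .pair 8 4), (1, .line 9 1)]))))) (.leaf 1 [(2, .up 5), (1, .up 16), (1, .up 20), (1,
  .edge 7 8), (1, .edge 8 23), (1, .edge 18 19), (1, .pair 7 22), (1, .sum 7 1), (1, .row 2)])))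
  (.leaf 1 [(1, .up 1), (1, .up 4), (3, .up 5), (1, .up 16), (3, .edge 7 8), (1, .edge 18 19), (1,
  .row 2), (1, .row 4)])))))))))) (.dir 6 (.leaf 2 [(1, .up 15), (1, .up 16), (1, .up 19), (3, .edge
  7 8), (1, .edge 8 23), (1, .pair 7 5), (1, .pair 7 22), (1, .sum 7 1), (1, .pair 8 5), (1, .dir 6
  4), (1, .line 9 1), (1, .row 2), (1, .row 3)]) (.dir 9 (.leaf 11 [(3, .up 15), (13, .edge 7 8),
  (8, .edge 8 23), (3, .pair 5 11), (2, .pair 7 22), (2, .sum 7 1), (6, .pair 8 4), (9, .pair 8 5),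
  (3, .pair 8 11), (3, .line 6 4), (9, .dir 9 1), (2, .row 2), (8, .row 3)]) (.leaf 1 [(1, .up 5),
  (1, .up 14), (1, .up 15), (1, .up 19), (1, .edge 8 23), (1, .pair 5 11), (1, .pair 7 22), (1, .sum
  7 1)]))))))))))) (.free 20 (.free 15 (.leaf 1 [(2, .up 5), (2, .edge 7 8), (1, .edge 8 23), (1,
  .pair 7 22), (1, .sum 7 1), (1, .pair 15 5), (1, .row 2), (1, .row 3)]) (.level 15 0 (.leaf 1 [(2,
  .up 5), (2, .edge 7 8), (1, .edge 8 23), (1, .pair 7 22), (1, .sum 7 1), (1, .pair 15 5), (1, .row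
  2), (1, .row 3)]) (.free 12 (.leaf 2 [(1, .up 1), (1, .up 4), (3, .up 5), (3, .edge 7 8), (1,
  .edge 8 23), (1, .side 5 7), (1, .sum 20 12), (1, .pair 7 14), (1, .pair 12 17), (1, .line 9 1),
  (1, .row 3), (1, .row 4)]) (.free 13 (.leaf 3 [(3, .up 1), (7, .up 5), (1, .up 13), (8, .edge 7
  8), (1, .pair 7 22), (1, .pair 8 11), (1, .sum 20 13), (1, .pair 13 16), (1, .line 6 4), (1, .row
  2), (2, .row 3), (2, .row 4)]) (.free 17 (.leaf 1 [(1, .up 5), (1, .edge 8 23), (1, .edge 12 13),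
  (1, .pair 7 22), (1, .sum 7 1), (1, .pair 8 11), (1, .pair 8 17)]) (.free 18 (.leaf 2 [(4, .up 5),
  (2, .edge 7 8), (2, .edge 8 23), (1, .sum 16 16), (2, .pair 7 18), (2, .pair 7 22), (2, .sum 7 1),
  (2, .row 2)]) (.level 16 0 (.free 19 (.leaf 1 [(1, .up 4), (3, .up 5), (3, .edge 7 8), (1, .top 16
  19), (1, .pair 16 1), (1, .row 2), (1, .row 4)]) (.free 16 (.leaf 2 [(2, .up 1), (2, .up 4), (6,
  .up 5), (6, .edge 7 8), (2, .edge 18 19), (1, .sum 16 16), (2, .row 2), (2, .row 4)]) (.leaf 1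
  [(1, .up 1), (1, .up 4), (3, .up 5), (3, .edge 7 8), (1, .edge 16 17), (1, .edge 18 19), (1, .row
  2), (1, .row 4)]))) (.leaf 2 [(2, .up 1), (2, .up 4), (6, .up 5), (6, .edge 7 8), (2, .edge 17
  18), (1, .sum 19 19), (2, .row 2), (2, .row 4)])))))))) (.leaf 1 [(3, .up 5), (2, .edge 7 8), (1,
  .edge 8 23), (1, .edge 20 24), (1, .pair 7 22), (1, .sum 7 1), (1, .row 2), (1, .row 3)])))))))
  (.free 12 (.leaf 2 [(1, .up 1), (2, .edge 3 4), (3, .edge 7 8), (1, .edge 7 24), (1, .edge 8 23),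
  (1, .pair 5 15), (2, .pair 7 5), (1, .pair 7 14), (1, .pair 12 5), (1, .line 9 1), (1, .row 3),
  (1, .row 4)]) (.free 15 (.leaf 21 [(13, .up 1), (21, .edge 3 4), (44, .edge 7 8), (8, .edge 7 24),
  (8, .edge 8 23), (8, .sum 17 14), (16, .pair 7 5), (16, .pair 8 5), (8, .pair 15 5), (4, .tri 15
  15), (8, .line 9 1), (5, .row 2), (13, .row 3), (13, .row 4)]) (.level 15 1 (.leaf 1 [(1, .up 1),
  (4, .add 15 15), (1, .edge 3 4), (4, .edge 7 8), (1, .row 2), (1, .row 3), (1, .row 4)]) (.level 5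
  3 (.level 16 2 (.leaf 6 [(4, .sub 5 16), (6, .sub 1 16), (6, .add 1 16), (6, .sub 16 5), (6, .edge
  3 4), (5, .edge 7 8), (3, .edge 7 24), (3, .edge 8 23), (3, .pair 7 1), (4, .pair 7 5), (1, .pair
  7 14), (1, .sum 16 16), (3, .pair 7 18), (4, .pair 8 5), (3, .side 16 16), (3, .line 9 1), (2,
  .row 2), (3, .row 4)]) (.level 17 2 (.leaf 1 [(1, .up 1), (1, .sub 5 17), (1, .sub 17 1), (1, .up
  15), (1, .sub 1 17), (1, .add 1 17), (1, .add 5 17), (1, .edge 3 4), (1, .edge 7 24), (1, .edge 8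
  23), (1, .pair 8 5), (1, .pair 8 11), (1, .pair 8 17)]) (.level 14 2 (.leaf 6 [(1, .up 1), (4,
  .sub 1 14), (6, .up 15), (6, .up 16), (6, .sub 14 1), (6, .add 5 14), (6, .edge 3 4), (4, .edge 7
  8), (5, .edge 7 24), (5, .edge 8 23), (4, .pair 7 5), (1, .pair 7 18), (4, .pair 14 11), (5, .line
  9 1), (2, .row 2), (1, .row 4), (1, .low 14)]) (.level 19 2 (.leaf 1 [(1, .up 5), (1, .sub 19 1),
  (1, .sub 5 19), (1, .add 1 19), (1, .sub 19 5), (1, .up 17), (1, .sub 1 19), (1, .edge 3 4), (1,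
  .edge 7 8), (1, .sum 7 1), (1, .pair 8 5), (1, .pair 8 11), (1, .side 19 19), (1, .row 4), (1,
  .low 19)]) (.level 18 3 (.leaf 1 [(1, .sub 7 18), (1, .sub 5 18), (1, .add 7 18), (1, .add 5 18),
  (1, .edge 3 4), (1, .edge 7 8), (1, .edge 7 24), (1, .pair 7 1), (1, .pair 7 5), (1, .line 9 1),
  (1, .row 3), (1, .low 1), (1, .low 18)]) (.level 22 3 (.leaf 1 [(1, .sub 22 8), (1, .sub 22 5),
  (1, .up 15), (1, .up 16), (1, .sub 5 22), (1, .add 22 22), (1, .edge 3 4), (2, .edge 7 8), (1,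
  .pair 7 5), (1, .line 9 1), (1, .row 4), (1, .low 22)]) (.free 17 (.dir 6 (.leaf 9 [(3, .up 3),
  (9, .up 15), (6, .up 17), (2, .up 19), (6, .edge 3 4), (11, .edge 7 8), (3, .edge 7 24), (6, .pair
  7 1), (7, .pair 7 5), (4, .pair 8 5), (4, .pair 8 11), (3, .pair 17 5), (3, .dir 6 1), (3, .dir 6
  4), (2, .row 2), (6, .row 4)]) (.leaf 2 [(1, .up 1), (2, .up 15), (1, .up 17), (2, .edge 3 4), (2,
  .edge 7 8), (1, .edge 8 23), (1, .sum 7 1), (2, .pair 8 5), (2, .pair 8 11), (1, .pair 8 17), (1,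
  .pair 17 5), (1, .row 4)])) (.level 11 0 (.free 16 (.leaf 13 [(5, .up 14), (13, .edge 3 4), (22,
  .edge 7 8), (5, .edge 7 24), (5, .edge 8 23), (10, .side 5 11), (2, .pair 7 5), (5, .pair 7 18),
  (10, .pair 8 5), (8, .pair 11 1), (10, .pair 16 19), (5, .line 9 1), (3, .row 2), (3, .row 3), (8,
  .row 4)]) (.free 13 (.leaf 1 [(1, .up 1), (1, .up 5), (1, .up 15), (1, .edge 3 4), (2, .edge 7 8),
  (1, .edge 16 17), (1, .pair 8 5), (1, .pair 8 11), (1, .row 4)]) (.free 19 (.leaf 1 [(1, .up 1),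
  (1, .edge 3 4), (2, .edge 7 8), (1, .edge 16 17), (1, .pair 8 5), (1, .pair 8 11), (1, .sum 14 5),
  (1, .row 4)]) (.free 18 (.leaf 3 [(2, .up 1), (5, .up 5), (3, .edge 3 4), (6, .edge 7 8), (1,
  .edge 7 24), (1, .edge 8 23), (3, .edge 15 16), (1, .pair 7 5), (1, .pair 7 11), (1, .pair 7 18),
  (1, .line 9 1), (2, .row 2), (2, .row 4)]) (.level 15 0 (.leaf 5 [(2, .up 14), (5, .edge 3 4), (4,
  .edge 7 8), (3, .edge 7 24), (3, .edge 8 23), (3, .edge 11 15), (2, .edge 12 13), (3, .edge 12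
  19), (2, .edge 13 18), (2, .edge 15 19), (5, .edge 16 17), (1, .pair 8 5), (3, .pair 15 5), (2,
  .pair 15 11), (3, .line 9 1), (2, .row 4)]) (.free 11 (.level 14 0 (.leaf 3 [(3, .edge 3 4), (3,
  .edge 7 8), (2, .edge 7 24), (2, .edge 8 23), (3, .edge 16 17), (1, .edge 18 19), (1, .pair 8 5),
  (1, .sum 13 1), (2, .pair 14 5), (2, .pair 14 11), (2, .line 9 1), (1, .row 2), (1, .row 4)])
  (.leaf 1 [(1, .up 1), (1, .up 5), (1, .up 11), (1, .edge 3 4), (2, .edge 7 8), (1, .edge 16 17),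
  (1, .edge 18 19), (1, .pair 8 5), (1, .row 4)])) (.leaf 1 [(1, .up 1), (1, .up 5), (1, .up 14),
  (1, .edge 3 4), (2, .edge 7 8), (1, .edge 11 12), (1, .edge 16 17), (1, .edge 18 19), (1, .pair 8
  5), (1, .row 4)]))))))) (.level 13 0 (.leaf 1 [(1, .up 5), (1, .edge 3 4), (3, .edge 7 8), (1,
  .pair 7 5), (1, .pair 8 5), (1, .pair 13 1), (1, .row 3), (1, .row 4)]) (.leaf 1 [(1, .up 1), (2,
  .up 5), (1, .up 14), (1, .edge 3 4), (3, .edge 7 8), (1, .pair 7 5), (1, .row 3), (1, .row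
  4)])))))))))) (.leaf 1 [(1, .up 1), (4, .up 5), (1, .edge 3 4), (4, .edge 7 8), (1, .row 2), (1,
  .row 3), (1, .row 4)])))))))))))) (.leaf 1 [(1, .up 1), (1, .up 3), (1, .up 4), (4, .up 5), (4,
  .edge 7 8), (1, .row 2), (1, .row 3), (1, .row 4)])) (.leaf 1 [(1, .up 1), (1, .up 3), (1, .up 4),
  (4, .up 5), (4, .edge 7 8), (1, .row 2), (1, .row 3), (1, .row 4)]))))))) (.leaf 2 [(2, .up 1),
  (2, .up 4), (8, .nf 5), (1, .edge 3 3), (8, .edge 7 8), (2, .row 2), (2, .row 3), (2, .row 4)])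

/-- Certificate for the case: a row of maximal weight is supported on two non-adjacent
points; weight above `4` at `(1, 0)`. -/
def doubleTree : Tree :=
  .dir 5 (.level 18 0 (.level 10 0 (.free 4 (.level 11 0 (.leaf 1 [(1, .edge 10 16), (1, .edge 12
  13), (1, .edge 14 17), (1, .edge 15 19), (1, .pair 10 1), (2, .sum 9 6), (1, .pair 11 18), (1,
  .row 4)]) (.free 12 (.level 14 0 (.leaf 9 [(7, .edge 10 16), (9, .edge 14 17), (2, .pair 6 20),
  (1, .pair 6 23), (2, .pair 9 22), (4, .sum 9 6), (2, .pair 10 16), (2, .pair 10 24), (2, .pair 14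
  1), (9, .pair 14 9), (2, .pair 14 12), (8, .pair 14 15), (6, .tri 6 6), (1, .line 8 1), (7, .row
  4)]) (.leaf 2 [(2, .sum 9 6), (1, .pair 10 16), (2, .pair 12 17), (2, .tri 6 9), (1, .tri 6 12),
  (1, .line 8 1), (1, .row 3), (2, .row 4)])) (.leaf 19 [(17, .edge 12 13), (2, .edge 12 19), (3,
  .pair 6 15), (3, .pair 6 23), (1, .pair 9 15), (3, .pair 9 20), (3, .pair 9 22), (6, .sum 14 1),
  (11, .pair 10 4), (29, .sum 9 6), (4, .pair 10 16), (4, .sum 17 1), (2, .pair 18 13), (19, .tri 6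
  9), (2, .tri 18 18), (2, .dir 5 4), (15, .row 3), (16, .row 4)]))) (.leaf 17 [(17, .edge 3 4), (1,
  .pair 6 6), (3, .pair 10 1), (3, .sum 14 1), (58, .sum 9 6), (2, .pair 10 16), (2, .pair 18 1),
  (2, .sum 17 1), (3, .pair 18 13), (3, .tri 6 9), (1, .tri 18 18), (2, .line 8 1), (14, .row 2),
  (15, .row 3), (17, .row 4)])) (.level 20 0 (.leaf 6 [(2, .nf 17), (2, .nf 19), (6, .nf 24), (3,
  .edge 3 3), (6, .edge 6 20), (6, .edge 21 22), (2, .pair 9 9), (2, .sum 23 11), (2, .sum 14 9),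
  (2, .pair 18 16), (8, .pair 20 6), (6, .pair 20 9), (2, .pair 20 23), (2, .line 8 1), (4, .row 2),
  (4, .row 3), (4, .low 1)]) (.level 22 0 (.leaf 6 [(6, .nf 21), (4, .nf 23), (3, .edge 3 3), (6,
  .edge 9 22), (4, .pair 6 6), (2, .pair 6 23), (6, .pair 18 6), (4, .pair 18 11), (4, .pair 18 13),
  (8, .pair 22 9), (4, .pair 22 14), (2, .row 2), (6, .row 3), (6, .low 1)]) (.level 3 0 (.leaf 2
  [(1, .edge 3 3), (2, .pair 3 1), (8, .pair 3 6), (2, .row 2), (2, .row 3), (2, .row 4)]) (.level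
  13 0 (.leaf 2 [(2, .edge 12 19), (2, .edge 13 18), (2, .edge 14 17), (2, .pair 6 23), (2, .pair 9
  15), (1, .sum 9 9), (2, .dir 5 1)]) (.level 17 0 (.leaf 6 [(4, .edge 14 17), (2, .edge 17 18), (4,
  .edge 18 19), (2, .pair 6 23), (2, .pair 9 15), (2, .pair 17 12), (1, .sum 24 24), (6, .dir 5 1),
  (2, .dir 5 4), (4, .line 8 1), (4, .low 1)]) (.leaf 15 [(3, .pair 6 6), (1, .pair 6 14), (3, .pair
  6 23), (1, .pair 9 15), (6, .tri 18 18), (13, .dir 5 1), (12, .dir 5 4), (10, .line 8 1), (2, .row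
  2), (3, .row 3), (2, .row 4), (8, .low 1)]))))))) (.level 20 0 (.leaf 6 [(6, .nf 24), (3, .edge 3
  3), (6, .edge 6 20), (6, .edge 21 22), (2, .pair 6 9), (1, .pair 6 17), (2, .pair 9 9), (2, .sum
  23 11), (1, .pair 9 19), (9, .pair 20 6), (6, .pair 20 9), (1, .sum 16 9), (2, .pair 20 14), (2,
  .line 8 1), (4, .row 2), (5, .row 3), (5, .low 1)]) (.level 3 0 (.leaf 2 [(1, .edge 3 4), (1,
  .pair 3 1), (1, .pair 3 3), (8, .pair 3 6), (2, .row 2), (2, .row 3), (2, .row 4)]) (.level 22 0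
  (.dir 7 (.leaf 17 [(7, .nf 21), (17, .nf 23), (8, .edge 9 22), (10, .pair 6 6), (1, .pair 6 13),
  (1, .pair 9 6), (16, .pair 22 9), (2, .pair 22 14), (10, .dir 5 1), (8, .dir 5 4), (9, .dir 7 1),
  (9, .dir 7 4), (7, .row 2), (8, .row 3), (18, .low 1)]) (.free 13 (.leaf 12 [(10, .edge 9 22), (9,
  .pair 9 6), (7, .pair 9 13), (5, .pair 9 15), (7, .pair 13 6), (7, .pair 13 11), (10, .pair 22 4),
  (10, .pair 22 9), (2, .dir 5 1), (2, .line 7 4), (3, .row 2), (5, .row 3)]) (.leaf 8 [(1, .up 4),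
  (5, .nf 13), (8, .edge 9 22), (5, .pair 6 6), (5, .pair 9 6), (4, .pair 9 15), (2, .sum 17 17),
  (3, .pair 22 4), (3, .pair 22 9), (5, .dir 5 1), (4, .dir 5 4), (3, .row 2), (4, .row 3)])))
  (.level 13 0 (.level 23 0 (.dir 8 (.leaf 7 [(3, .nf 14), (3, .pair 9 6), (3, .pair 13 6), (5, .sum
  9 9), (3, .pair 23 1), (7, .pair 23 6), (3, .sum 17 6), (3, .tri 9 9), (3, .dir 5 1), (3, .dir 8
  1), (4, .row 2), (4, .row 3), (4, .row 4), (2, .low 1)]) (.leaf 7 [(2, .nf 24), (1, .pair 6 15),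
  (7, .pair 9 6), (7, .pair 13 1), (7, .sum 12 1), (4, .sum 9 9), (7, .pair 23 6), (1, .sum 17 6),
  (5, .tri 9 9), (2, .tri 13 23), (1, .dir 5 1), (6, .row 3), (5, .row 4), (8, .low 1)])) (.level 12
  0 (.leaf 1 [(1, .edge 12 19), (1, .edge 13 14), (1, .pair 6 9), (1, .pair 9 15), (1, .pair 12 17),
  (1, .dir 5 1)]) (.level 10 0 (.dir 7 (.leaf 9 [(3, .nf 14), (1, .pair 10 4), (4, .tri 6 9), (4,
  .tri 9 9), (8, .dir 5 1), (4, .dir 5 4), (4, .dir 7 1), (4, .dir 7 4), (1, .row 2), (5, .row 3),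
  (1, .row 4), (3, .low 1)]) (.leaf 16 [(6, .pair 9 13), (8, .pair 9 15), (3, .sum 17 17), (16,
  .pair 10 1), (12, .pair 10 19), (8, .pair 10 21), (16, .tri 6 9), (6, .tri 9 9), (4, .line 7 4),
  (4, .row 3), (8, .row 4)])) (.leaf 6 [(2, .pair 9 13), (2, .pair 9 15), (1, .sum 17 17), (2, .pair
  13 1), (2, .tri 9 9), (6, .dir 5 1), (4, .dir 5 4), (2, .line 7 4), (2, .row 3), (2, .low 1)]))))
  (.level 10 1 (.leaf 1 [(1, .up 1), (1, .up 4), (4, .top 6 9), (1, .row 2), (1, .row 3), (1, .row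
  4)]) (.level 17 0 (.level 23 0 (.leaf 18 [(11, .up 10), (18, .nf 24), (2, .pair 6 23), (7, .pair
  17 9), (11, .pair 17 14), (16, .pair 23 6), (11, .sum 19 9), (5, .tri 6 17), (3, .tri 17 17), (11,
  .dir 5 1), (11, .line 8 1), (7, .row 2), (7, .row 3), (15, .low 1)]) (.leaf 3 [(3, .up 10), (1,
  .pair 6 6), (1, .pair 9 15), (1, .pair 17 12), (1, .pair 17 14), (1, .tri 17 17), (3, .dir 5 1),
  (2, .dir 5 4), (1, .line 8 1), (1, .row 3), (2, .low 1)])) (.leaf 43 [(39, .up 10), (7, .pair 1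
  19), (5, .pair 1 23), (16, .pair 6 6), (7, .pair 6 14), (11, .pair 6 23), (2, .pair 9 15), (39,
  .dir 5 1), (32, .dir 5 4), (23, .line 8 1), (4, .row 2), (4, .row 3), (4, .row 4), (19, .low
  1)])))))))) (.level 18 0 (.level 13 0 (.free 4 (.leaf 4 [(4, .edge 12 19), (4, .edge 13 18), (4,
  .edge 14 17), (2, .sum 23 6), (2, .pair 9 22), (3, .sum 9 9), (2, .pair 13 16), (2, .pair 18 6),
  (2, .pair 18 11), (2, .line 5 1), (2, .row 4)]) (.leaf 10 [(10, .edge 3 4), (10, .edge 12 19),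
  (10, .edge 13 18), (10, .edge 14 17), (6, .pair 9 22), (5, .sum 9 9), (4, .pair 13 11), (6, .pair
  13 23), (2, .pair 18 6), (4, .pair 18 16), (6, .line 5 1), (4, .row 4), (2, .low 1)])) (.level 12
  0 (.level 11 0 (.leaf 2 [(1, .edge 3 3), (2, .edge 12 19), (2, .pair 11 18), (2, .sum 11 1), (2,
  .sum 6 6), (2, .pair 12 9), (2, .sum 17 1), (2, .sum 14 9), (2, .row 4), (2, .low 1)]) (.free 18
  (.free 9 (.free 21 (.free 23 (.leaf 2 [(2, .up 1), (1, .edge 3 3), (2, .pair 6 23), (2, .pair 12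
  9), (2, .pair 12 14), (2, .tri 6 12)]) (.free 4 (.free 14 (.leaf 1 [(1, .up 1), (1, .up 4), (1,
  .pair 12 9), (1, .tri 6 6), (1, .tri 9 14), (1, .row 4)]) (.dir 8 (.leaf 10 [(6, .up 1), (10, .nf
  14), (4, .pair 6 23), (10, .pair 12 9), (3, .sum 24 24), (6, .tri 6 6), (2, .tri 18 18), (4, .dir
  8 1), (6, .dir 8 4), (4, .row 4)]) (.free 16 (.leaf 1 [(1, .up 1), (1, .nf 14), (1, .pair 6 23),
  (1, .pair 12 24), (1, .pair 16 21), (1, .tri 16 18)]) (.free 24 (.level 14 0 (.leaf 1 [(1, .up 1),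
  (1, .up 4), (1, .nf 14), (1, .nf 16), (1, .pair 12 24), (1, .pair 14 9), (1, .pair 14 12)])
  (.level 16 0 (.leaf 1 [(1, .up 1), (1, .up 4), (1, .nf 16), (1, .pair 12 24), (1, .pair 16 18),
  (1, .pair 16 21)]) (.level 9 1 (.level 4 1 (.level 6 1 (.level 12 1 (.level 18 1 (.level 21 1
  (.level 24 1 (.level 6 2 (.leaf 0 [(1, .sub 6 12), (1, .low 6)]) (.level 12 2 (.leaf 0 [(1, .sub
  12 24), (1, .low 12)]) (.level 18 2 (.leaf 0 [(1, .add 18 18), (1, .low 6)]) (.level 21 2 (.level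
  4 2 (.level 24 2 (.leaf 0 [(1, .add 24 24), (1, .low 18)]) (.level 9 2 (.level 4 3 (.level 9 3
  (.level 21 3 (.level 4 4 (.level 9 4 (.level 21 4 (.goal) (.leaf 1 [(1, .up 1), (1, .up 4), (1,
  .up 6), (1, .up 9), (1, .up 12), (1, .up 18), (1, .up 21), (1, .up 24)])) (.leaf 1 [(1, .up 1),
  (1, .up 4), (2, .up 6), (2, .up 9), (1, .up 12), (1, .up 18), (1, .row 4)])) (.leaf 1 [(1, .up 1),
  (1, .up 4), (1, .up 6), (1, .up 9), (1, .up 12), (1, .up 18), (1, .up 21), (1, .up 24)])) (.leaf 1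
  [(1, .up 1), (1, .up 4), (1, .up 6), (1, .up 9), (1, .up 12), (1, .up 18), (1, .up 21), (1, .up
  24)])) (.leaf 1 [(1, .up 1), (1, .up 4), (2, .up 6), (2, .up 9), (1, .up 12), (1, .up 18), (1,
  .row 4)])) (.leaf 1 [(1, .up 1), (1, .up 4), (1, .up 6), (1, .up 9), (1, .up 12), (1, .up 18), (1,
  .up 21), (1, .up 24)])) (.leaf 1 [(1, .up 1), (1, .up 4), (1, .up 6), (1, .up 9), (1, .up 12), (1,
  .up 18), (1, .up 21), (1, .up 24)]))) (.leaf 1 [(1, .up 1), (1, .up 4), (1, .up 6), (1, .up 9),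
  (1, .up 18), (1, .up 21), (1, .side 12 12)])) (.leaf 1 [(1, .up 1), (1, .up 4), (1, .up 6), (1,
  .up 9), (1, .up 18), (1, .up 21), (1, .side 12 12)]))))) (.leaf 2 [(2, .up 1), (2, .up 4), (2, .up
  9), (2, .up 21), (2, .up 24), (2, .side 6 12), (1, .top 6 6)])) (.leaf 2 [(2, .up 1), (2, .up 4),
  (2, .up 9), (2, .up 21), (1, .side 6 12), (1, .side 12 12), (1, .side 6 18), (1, .top 6 6)]))
  (.leaf 2 [(2, .up 1), (2, .up 4), (2, .up 9), (2, .up 18), (2, .up 21), (2, .side 12 12), (1, .top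
  6 6)])) (.leaf 1 [(1, .up 1), (1, .up 4), (1, .up 9), (1, .up 12), (1, .up 21), (1, .tri 6 18)]))
  (.leaf 1 [(1, .up 1), (1, .up 4), (1, .up 6), (1, .up 9), (1, .up 21), (1, .tri 18 24)])) (.leaf 3
  [(3, .up 1), (3, .up 4), (3, .up 9), (3, .up 21), (1, .tri 6 12), (2, .tri 6 18), (1, .tri 12
  12)])) (.leaf 3 [(3, .up 1), (3, .up 4), (6, .up 9), (2, .tri 6 6), (1, .tri 6 12), (1, .tri 18
  18), (3, .row 4)])))) (.leaf 1 [(1, .up 1), (1, .nf 24), (1, .pair 6 23), (1, .pair 12 9), (1,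
  .pair 12 14), (1, .tri 6 12)]))))) (.leaf 3 [(3, .up 1), (3, .edge 3 4), (3, .pair 12 9), (3, .sum
  14 9), (2, .tri 6 6), (1, .tri 6 12), (1, .tri 18 18), (3, .row 4)]))) (.leaf 2 [(2, .up 1), (2,
  .nf 21), (1, .edge 3 3), (2, .pair 6 23), (1, .pair 12 9), (2, .sum 14 9), (1, .sum 24 24), (1,
  .tri 6 6), (1, .tri 6 12), (1, .row 3)])) (.leaf 1 [(1, .up 1), (4, .nf 9), (1, .pair 1 3), (2,
  .sum 6 6), (1, .row 2), (1, .row 3), (1, .row 4)])) (.leaf 1 [(1, .edge 18 19), (1, .pair 1 3),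
  (1, .pair 12 9), (1, .sum 17 1), (1, .sum 14 9), (1, .tri 6 6), (1, .row 4)]))) (.level 17 0
  (.leaf 6 [(3, .edge 3 3), (6, .edge 14 17), (6, .edge 18 19), (4, .sum 22 9), (4, .pair 6 23), (6,
  .sum 16 1), (4, .sum 11 6), (4, .pair 17 9), (4, .pair 18 6), (2, .pair 18 11), (2, .row 4)])
  (.free 4 (.leaf 2 [(1, .pair 6 23), (1, .pair 9 22), (2, .pair 18 1), (1, .pair 18 6), (2, .sum 14
  9), (1, .pair 18 11), (1, .pair 18 16), (1, .tri 18 18), (1, .line 5 1), (1, .row 4), (2, .low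
  1)]) (.leaf 2 [(2, .edge 3 4), (1, .sum 23 11), (1, .pair 9 22), (2, .pair 18 1), (1, .pair 18 6),
  (2, .sum 14 9), (1, .pair 18 16), (1, .tri 18 18), (1, .line 5 1), (1, .row 4), (2, .low 1)])))))
  (.level 17 0 (.level 12 0 (.dir 8 (.leaf 6 [(6, .nf 16), (6, .nf 19), (4, .nf 22), (3, .edge 3 3),
  (6, .edge 13 14), (3, .pair 6 23), (6, .sum 11 1), (4, .pair 12 24), (4, .pair 17 9), (3, .pair 17
  12), (2, .tri 6 6), (3, .tri 17 17), (1, .dir 8 1), (2, .row 4), (1, .low 1)]) (.leaf 12 [(6,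
  .edge 3 3), (12, .edge 13 14), (4, .pair 1 23), (5, .pair 6 23), (5, .pair 12 24), (12, .sum 16
  1), (9, .pair 17 9), (7, .pair 17 12), (5, .tri 6 6), (6, .tri 17 17), (3, .row 4)])) (.level 13 0
  (.free 17 (.free 9 (.free 11 (.leaf 1 [(1, .up 1), (1, .pair 1 3), (1, .pair 13 6), (1, .tri 6
  11), (1, .tri 9 9), (1, .row 4)]) (.free 19 (.leaf 1 [(1, .up 1), (1, .nf 11), (1, .pair 1 3), (1,
  .pair 13 6), (1, .pair 19 17), (1, .tri 9 9), (1, .row 4)]) (.free 21 (.dir 7 (.leaf 2 [(2, .nf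
  11), (1, .edge 3 3), (2, .pair 6 23), (2, .pair 13 6), (2, .tri 13 21), (2, .dir 7 1)]) (.free 24
  (.free 4 (.level 11 0 (.leaf 2 [(2, .up 1), (2, .up 4), (1, .nf 11), (2, .nf 19), (1, .pair 11 6),
  (1, .pair 11 13), (1, .sum 24 17), (1, .sum 11 6), (1, .sum 21 21), (1, .tri 9 9)]) (.level 19 0
  (.leaf 1 [(1, .up 1), (1, .up 4), (1, .sum 24 19), (1, .sum 13 6), (1, .tri 9 17)]) (.level 21 1
  (.level 4 1 (.level 6 1 (.level 9 1 (.level 13 1 (.level 17 1 (.level 24 1 (.level 6 2 (.level 9 2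
  (.leaf 0 [(1, .sub 9 13), (1, .low 9)]) (.level 13 2 (.leaf 0 [(1, .sub 13 21), (1, .low 13)])
  (.level 17 2 (.leaf 0 [(1, .add 17 17), (1, .low 9)]) (.level 21 2 (.leaf 0 [(1, .add 21 21), (1,
  .low 17)]) (.level 4 2 (.level 24 2 (.level 4 3 (.level 6 3 (.level 24 3 (.level 4 4 (.level 24 4
  (.level 6 4 (.goal) (.leaf 1 [(1, .up 1), (1, .up 4), (1, .up 6), (1, .up 9), (1, .up 13), (1, .up
  17), (1, .up 21), (1, .up 24)])) (.leaf 1 [(1, .up 1), (1, .up 4), (1, .up 6), (1, .up 9), (1, .up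
  13), (1, .up 17), (1, .up 21), (1, .up 24)])) (.leaf 1 [(1, .up 1), (1, .up 4), (1, .up 6), (1,
  .up 9), (1, .up 13), (1, .up 17), (1, .up 21), (1, .up 24)])) (.leaf 1 [(1, .up 1), (1, .up 4),
  (1, .up 6), (1, .up 9), (1, .up 13), (1, .up 17), (1, .up 21), (1, .up 24)])) (.leaf 1 [(1, .up
  1), (1, .up 4), (2, .up 6), (2, .up 9), (1, .up 13), (1, .up 17), (1, .row 4)])) (.leaf 1 [(1, .up
  1), (1, .up 4), (1, .up 6), (1, .up 9), (1, .up 13), (1, .up 17), (1, .up 21), (1, .up 24)]))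
  (.leaf 1 [(1, .up 1), (1, .up 4), (1, .up 6), (1, .up 9), (1, .up 13), (1, .up 17), (1, .up 21),
  (1, .up 24)])) (.leaf 1 [(1, .up 1), (1, .up 4), (1, .up 6), (1, .up 9), (1, .up 13), (1, .up 17),
  (1, .up 21), (1, .up 24)])))))) (.leaf 1 [(1, .up 1), (1, .up 4), (2, .up 6), (1, .side 9 13), (1,
  .top 9 9), (1, .row 4)])) (.leaf 2 [(2, .up 1), (2, .up 4), (2, .up 6), (2, .up 24), (1, .side 9
  13), (1, .side 13 13), (1, .side 9 17), (1, .top 9 9)])) (.leaf 2 [(2, .up 1), (2, .up 4), (2, .up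
  6), (2, .up 17), (2, .up 24), (2, .side 13 13), (1, .top 9 9)])) (.leaf 1 [(1, .up 1), (1, .up 4),
  (1, .up 6), (1, .up 13), (1, .up 24), (1, .tri 9 17)])) (.leaf 1 [(1, .up 1), (1, .up 4), (2, .up
  6), (2, .up 9), (1, .side 21 17), (1, .row 4)])) (.leaf 1 [(1, .up 1), (1, .up 4), (1, .up 6), (1,
  .up 24), (1, .side 21 13), (1, .side 21 21)])) (.leaf 1 [(1, .up 1), (1, .up 4), (1, .up 6), (1,
  .up 24), (1, .side 21 13), (1, .side 21 21)])) (.leaf 1 [(1, .up 1), (1, .up 4), (1, .up 6), (1,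
  .up 21), (1, .up 24), (1, .tri 9 13)])))) (.leaf 3 [(3, .up 1), (3, .edge 3 4), (3, .pair 13 6),
  (3, .pair 13 11), (1, .tri 9 13), (2, .tri 9 17), (1, .tri 13 13)])) (.leaf 3 [(3, .up 1), (3, .nf
  11), (3, .nf 24), (3, .pair 1 3), (3, .pair 13 6), (1, .tri 9 13), (2, .tri 9 17), (1, .tri 13
  13)]))) (.leaf 2 [(2, .up 1), (2, .nf 21), (1, .edge 3 3), (2, .pair 6 23), (2, .pair 13 6), (2,
  .pair 13 11), (2, .tri 9 13)])))) (.leaf 1 [(1, .up 1), (2, .edge 9 22), (1, .pair 1 3), (1, .pair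
  9 13), (1, .pair 13 6), (1, .sum 11 6), (1, .row 4)])) (.leaf 1 [(1, .edge 14 17), (1, .pair 1 3),
  (1, .pair 13 6), (1, .sum 16 1), (1, .sum 11 6), (1, .tri 9 9), (1, .row 4)])) (.free 4 (.leaf 2
  [(1, .pair 6 23), (1, .pair 9 22), (2, .sum 16 1), (2, .sum 11 6), (1, .pair 17 9), (1, .pair 17
  14), (1, .pair 17 19), (1, .tri 17 17), (1, .line 5 4), (1, .row 4), (2, .low 1)]) (.leaf 6 [(6,
  .edge 3 4), (2, .sum 22 9), (1, .pair 1 23), (1, .sum 23 11), (6, .sum 16 1), (4, .sum 11 6), (2,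
  .pair 17 9), (6, .pair 17 14), (6, .pair 17 17), (6, .pair 17 19), (1, .pair 17 24), (4, .row 4),
  (6, .low 1)])))) (.level 12 0 (.free 14 (.leaf 10 [(5, .edge 3 3), (1, .sum 22 9), (5, .pair 6
  23), (4, .pair 9 22), (9, .sum 11 1), (10, .pair 12 9), (4, .pair 12 14), (5, .pair 12 19), (1,
  .pair 14 12), (8, .tri 6 6), (5, .line 5 4), (1, .row 2), (5, .row 4), (8, .low 1)]) (.leaf 1 [(1,
  .edge 13 14), (1, .pair 6 3), (1, .pair 12 4), (1, .pair 12 9), (1, .pair 12 19), (1, .tri 6 6),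
  (1, .row 4)])) (.level 13 0 (.leaf 14 [(7, .edge 3 3), (2, .pair 6 23), (6, .pair 9 22), (8, .pair
  13 1), (4, .sum 14 4), (14, .pair 13 6), (6, .pair 13 11), (8, .pair 13 16), (4, .pair 13 23),
  (12, .tri 9 9), (6, .line 5 1), (2, .row 2), (8, .row 4), (6, .low 1)]) (.free 23 (.leaf 2 [(1,
  .edge 3 3), (2, .pair 6 23), (2, .sum 19 9), (1, .sum 14 14), (2, .line 5 1)]) (.leaf 2 [(1, .edge
  3 3), (2, .edge 22 23), (2, .line 5 1), (2, .line 5 4)]))))))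

/-- The facts valid when the weight at `(1, 0)` exceeds `m`. -/
def start (m : ℕ) : List Fact := [.gt 1 m, .le 0 0, .le 2 0, .nf 3]

/-- Row `1` is supported on `(1, 1)` and `(-1, 1)`. -/
def doubleRow : List Fact := [.gt 6 0, .gt 9 0, .le 5 0, .le 7 0, .le 8 0]

/-- Row `1` is supported on `(0, 1)`, `(2, 1)` and `(3, 1)`. -/
def tripleRow : List Fact := [.gt 5 0, .gt 7 0, .gt 8 0, .le 6 0, .le 9 0]

/-- Row `1` is supported on `(0, 1)`. -/
def singleRow : List Fact := [.gt 5 0, .le 6 0, .le 7 0, .le 8 0, .le 9 0]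

/-- Whether `S` says that the support is contained in `M ∪ N` and contains `N`. -/
def supports (M N : List ℕ) (S : List Fact) : Bool :=
  ((List.range 25).all fun g => M.any (Nat.beq g) || N.any (Nat.beq g) ||
    Nat.beq (upper 5 S g) 0) && N.all (nonempty S)

/-- The two support patterns that survive. -/
def exceptional (S : List Fact) : Bool :=
  supports [1, 4, 9, 21] [6, 12, 18, 24] S || supports [1, 4, 6, 24] [9, 13, 17, 21] S

/-- The parameters `1 5 9` belong to weight above `4` at `(1, 0)`: one unit is left for a pair of
neighbours, fibres have at most five units, and the rows off the origin share at least `28 - 10 =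
18` units, so twice the heaviest is at least `9`. -/
theorem tripleTree_check :
    tripleTree.check 1 5 9 (fun _ => false) (tripleRow ++ start 4) = true := by
  decide +kernel

theorem singleTree_check :
    singleTree.check 1 5 9 (fun _ => false) (singleRow ++ start 4) = true := by
  decide +kernel

/-- The parameters `2 4 10` belong to the case where the weight at `(1, 0)` exceeds `3` and no
weight exceeds `4`. The row of the origin then has at most eight units, and the other four share at
least twenty. -/
theorem tripleTreeOfBound_check :
    tripleTreeOfBound.check 2 4 10 (fun _ => false) (tripleRow ++ start 3) = true := by
  decide +kernel

theorem doubleTreeOfBound_check :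
    doubleTreeOfBound.check 2 4 10 (fun _ => false) (doubleRow ++ start 3) = true := by
  decide +kernel

/-- Unlike the other four trees, this one has surviving branches. They end in two patterns that are
mirror images under `(i, j) ↦ (-i, j)`. -/
theorem doubleTree_check :
    doubleTree.check 1 5 9 exceptional (doubleRow ++ start 4) = true := by
  decide +kernel

end Certificate

/-! ### Density profiles on `𝔽₅²` -/

open Certificate

/-- The inequalities satisfied by the numbers `x g` of elements of a large non-normal sum-free set
in the fibres of a linear map onto `𝔽₅²`, the fibres having `5 * q` elements. -/
structure Profile (x : ZMod 5 × ZMod 5 → ℕ) (q : ℕ) : Prop where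
  pos : 0 < q
  bound : ∀ g, x g ≤ 5 * q
  pair : ∀ g h, 0 < x g → x h + x (g + h) ≤ 5 * q
  pairSum : ∀ g h, 0 < x (g + h) → x g + x h ≤ 5 * q
  triple : ∀ g h m, 0 < x g → 0 < x h → 0 < x (g + h) → m * q < x g →
    x h + x (g + h) + m * q ≤ 5 * q
  tripleSum : ∀ g h m, 0 < x g → 0 < x h → 0 < x (g + h) → m * q < x (g + h) →
    x g + x h + m * q ≤ 5 * q
  line : ∀ d g, d ≠ 0 → 2 * ∑ k : ZMod 5, x (g + k • d) ≤ 25 * q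
  dir : ∀ d g, d ≠ 0 → 0 < x d → ∑ k : ZMod 5, x (g + k • d) ≤ 10 * q
  total : 28 * q ≤ ∑ g, x g

theorem sum_zmod_five (f : ZMod 5 → ℕ) : ∑ k, f k = f 0 + f 1 + f 2 + f 3 + f 4 :=
  Fin.sum_univ_five f

/-- The linear automorphism `(i, j) ↦ (a * i + c * j, d * j)`. -/
def triangular (a c d : ZMod 5) (ha : a ≠ 0) (hd : d ≠ 0) :
    (ZMod 5 × ZMod 5) ≃ₗ[ZMod 5] (ZMod 5 × ZMod 5) where
  toFun p := (a * p.1 + c * p.2, d * p.2)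
  invFun p := (a⁻¹ * (p.1 - c * (d⁻¹ * p.2)), d⁻¹ * p.2)
  map_add' p r := by ext <;> simp <;> ring
  map_smul' k p := by ext <;> simp <;> ring
  left_inv p := by
    have : Fact (Nat.Prime 5) := ⟨by norm_num⟩
    ext <;> simp [ha, hd]
  right_inv p := by
    have : Fact (Nat.Prime 5) := ⟨by norm_num⟩
    ext <;> simp [ha, hd]

theorem triangular_apply (a c d : ZMod 5) (ha : a ≠ 0) (hd : d ≠ 0) (p : ZMod 5 × ZMod 5) :
    triangular a c d ha hd p = (a * p.1 + c * p.2, d * p.2) := rfl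

/-- The sum of a profile over a row. -/
def rowSum (x : ZMod 5 × ZMod 5 → ℕ) (j : ZMod 5) : ℕ := ∑ i, x (i, j)

/-- The support of the exceptional profiles. -/
def ExceptionalSupport (x : ZMod 5 × ZMod 5 → ℕ) : Prop :=
  (∀ g, x g ≠ 0 → g = (1, 0) ∨ g = (4, 0) ∨ g = (0, 1) ∨ g = (0, 4) ∨
    g = (2, 1) ∨ g = (4, 2) ∨ g = (1, 3) ∨ g = (3, 4)) ∧
  0 < x (2, 1) ∧ 0 < x (4, 2) ∧ 0 < x (1, 3) ∧ 0 < x (3, 4)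

namespace Profile

variable {x : ZMod 5 × ZMod 5 → ℕ} {q : ℕ}

theorem comp (P : Profile x q) (ψ : (ZMod 5 × ZMod 5) ≃ₗ[ZMod 5] (ZMod 5 × ZMod 5)) :
    Profile (x ∘ ψ) q where
  pos := P.pos
  bound g := P.bound _
  pair g h := by simpa using P.pair (ψ g) (ψ h)
  pairSum g h := by simpa using P.pairSum (ψ g) (ψ h)
  triple g h := by simpa using P.triple (ψ g) (ψ h)
  tripleSum g h := by simpa using P.tripleSum (ψ g) (ψ h)
  line d g hd := by simpa using P.line (ψ d) (ψ g) (by simpa using hd)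
  dir d g hd := by simpa using P.dir (ψ d) (ψ g) (by simpa using hd)
  total := by
    rw [show ∑ g, (x ∘ ψ) g = ∑ g, x g from Equiv.sum_comp ψ.toEquiv x]
    exact P.total

/-- A line in direction `d` is also a line in direction `k • d`, with its points permuted. -/
theorem dir_smul (P : Profile x q) {d : ZMod 5 × ZMod 5} (g : ZMod 5 × ZMod 5) (hd : d ≠ 0)
    {k : ZMod 5} (hk : k ≠ 0) (hpos : 0 < x (k • d)) :
    ∑ i : ZMod 5, x (g + i • d) ≤ 10 * q := by
  have : Fact (Nat.Prime 5) := ⟨by norm_num⟩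
  have h := P.dir (k • d) g (smul_ne_zero hk hd) hpos
  simp only [smul_smul] at h
  rwa [show ∑ i : ZMod 5, x (g + (i * k) • d) = ∑ i : ZMod 5, x (g + i • d) from
    Equiv.sum_comp (Equiv.mulRight₀ k hk) fun i => x (g + i • d)] at h

/-- The condition `m + E = 5` is the triple inequality at the heavy point: weight above `m` there
leaves at most `E` units for the other two members of a sum relation. -/
theorem system (P : Profile x q) {E H r m : ℕ} (hb : ∀ g, x g ≤ H * q) (hE : m + E = 5)
    (he : m * q < x (1, 0)) (hrow : ∀ j, j ≠ 0 → rowSum x j ≤ rowSum x 1)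
    (hr : r * q ≤ 2 * rowSum x 1) : System (x ∘ pt) q E H r := by
  have hm : ∀ {a b : ℕ}, a + b + m * q ≤ 5 * q → a + b ≤ E * q := by
    intro a b h
    have : 5 * q = m * q + E * q := by rw [← hE]; ring
    omega
  have h1 : pt 1 = (1, 0) := by decide
  have hline : ∀ d g, wt (x ∘ pt) (Certificate.line d g) = ∑ k : ZMod 5, x (pt g + k • pt d) := by
    intro d g
    have e2 : (2 : ZMod 5) • pt d = pt d + pt d := two_smul _ _
    have e3 : (3 : ZMod 5) • pt d = pt d + (pt d + pt d) := by
      rw [show (3 : ZMod 5) = 1 + 2 by decide, add_smul, e2, one_smul]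
    have e4 : (4 : ZMod 5) • pt d = pt d + pt d + (pt d + pt d) := by
      rw [show (4 : ZMod 5) = 2 + 2 by decide, add_smul, e2]
    rw [sum_zmod_five]
    simp [wt, Certificate.line, multiples, pt_addN, e2, e3, e4, add_assoc]
  have hpos : 0 < x (1, 0) := lt_of_le_of_lt (Nat.zero_le _) he
  have hrows : ∀ j : ℕ, wt (x ∘ pt) (row j) = rowSum x (j : ZMod 5) := by
    intro j
    have h5 : (5 : ZMod 5) = 0 := by decide
    have e1 : (5 * j + 1) / 5 = j := by omega
    have e2 : (5 * j + 2) / 5 = j := by omega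
    have e3 : (5 * j + 3) / 5 = j := by omega
    have e4 : (5 * j + 4) / 5 = j := by omega
    rw [rowSum, sum_zmod_five]
    simp [wt, row, pt, h5, e1, e2, e3, e4, add_assoc]
  refine ⟨P.pos, fun g => hb _, ?_, ?_, ?_, ?_, ?_, ?_, ?_, ?_, ?_, ?_, ?_⟩
  -- Codes beyond 24 are not reduced, so adding back a difference returns the same point of `𝔽₅²`
  -- but possibly another code. The field is therefore stated for weights.
  · intro g h; simp [pt_addN, pt_subN]
  · intro g h; simpa [pt_addN] using P.pair (pt g) (pt h)
  · intro g h; simpa [pt_addN] using P.pairSum (pt g) (pt h)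
  · intro g h; simpa [pt_addN] using P.triple (pt g) (pt h)
  · intro g h; simpa [pt_addN] using P.tripleSum (pt g) (pt h)
  · intro g h hh hg hpos'
    simp only [Function.comp_apply, nbrs, List.mem_cons, List.not_mem_nil, or_false] at *
    rcases hh with rfl | rfl | rfl
    · rw [pt_addN, h1] at *
      rw [add_comm (pt g)] at *
      exact hm (P.triple (1, 0) (pt g) m hpos hg hpos' he)
    · rw [pt_subN, h1] at *
      have := P.triple (1, 0) (pt g - (1, 0)) m hpos hpos' (by simpa using hg) he
      rw [add_sub_cancel] at this
      have := hm this
      omega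
    · rw [pt_subN, h1] at *
      have := P.tripleSum (pt g) ((1, 0) - pt g) m hg hpos' (by simpa using hpos)
        (by simpa using he)
      exact hm this
  · intro d g hd
    rw [hline]; exact P.line _ _ hd
  · rintro d g hd ⟨h, hh, hpos'⟩
    rw [hline]
    have e4 : pt d + pt d + (pt d + pt d) = (4 : ZMod 5) • pt d := by
      rw [show (4 : ZMod 5) = (1 + 1) + (1 + 1) by decide]
      simp only [add_smul, one_smul]
    have e3 : pt d + (pt d + pt d) = (3 : ZMod 5) • pt d := by
      rw [show (3 : ZMod 5) = 1 + (1 + 1) by decide]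
      simp only [add_smul, one_smul]
    simp only [multiples, List.mem_cons, List.not_mem_nil, or_false] at hh
    have e2 : pt d + pt d = (2 : ZMod 5) • pt d := (two_smul _ _).symm
    rw [Function.comp_apply] at hpos'
    rcases hh with hh | hh | hh | hh <;> rw [hh] at hpos' <;> try simp only [pt_addN] at hpos'
    · exact P.dir _ _ hd hpos'
    · exact P.dir_smul _ hd (by decide) (e2 ▸ hpos')
    · exact P.dir_smul _ hd (by decide) (e3 ▸ hpos')
    · exact P.dir_smul _ hd (by decide) (e4 ▸ hpos')
  · intro j hj
    rw [hrows, hrows, Nat.cast_one]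
    refine hrow _ ?_
    rcases hj with rfl | rfl | rfl <;> decide
  · rw [hrows, Nat.cast_one]; exact hr
  · refine P.total.trans (le_of_eq ?_)
    have h0 := hrows 0
    have h1 := hrows 1
    have h2 := hrows 2
    have h3 := hrows 3
    have h4 := hrows 4
    rw [Fintype.sum_prod_type_right, sum_zmod_five]
    simp only [rowSum, Nat.cast_zero, Nat.cast_one, Nat.cast_ofNat] at h0 h1 h2 h3 h4
    rw [← h0, ← h1, ← h2, ← h3, ← h4]
    simp [wt, row, List.range, List.range.loop, add_assoc]

end Profile

/-- A function on a `5`-cycle in which adjacent nonempty points have total weight at most `B` has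
one of three exceptional supports or small weight. -/
theorem cycle_cases (y : ZMod 5 → ℕ) (B : ℕ)
    (h : ∀ i, 0 < y i → 0 < y (i + 1) → y i + y (i + 1) ≤ B) :
    (∃ i, 0 < y i ∧ y (1 + i) = 0 ∧ y (2 + i) = 0 ∧ y (3 + i) = 0 ∧ y (4 + i) = 0) ∨
    (∃ i, 0 < y (1 + i) ∧ 0 < y (4 + i) ∧ y i = 0 ∧ y (2 + i) = 0 ∧ y (3 + i) = 0) ∨
    (∃ i, 0 < y i ∧ 0 < y (2 + i) ∧ 0 < y (3 + i) ∧ y (1 + i) = 0 ∧ y (4 + i) = 0) ∨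
    ∑ i, y i ≤ 2 * B ∨ ∀ i, y i + y (i + 1) ≤ B := by
  have e : ∀ p : ZMod 5 → Prop, (∀ i, p i) → p 0 ∧ p 1 ∧ p 2 ∧ p 3 ∧ p 4 :=
    fun p hp => ⟨hp 0, hp 1, hp 2, hp 3, hp 4⟩
  by_contra hc
  simp only [not_or, not_exists] at hc
  obtain ⟨h1, h2, h3, h4, h5⟩ := hc
  have h := e _ h
  have h1 := e _ h1
  have h2 := e _ h2
  have h3 := e _ h3
  rw [sum_zmod_five] at h4
  have f1 : (1 : ZMod 5) + 1 = 2 := by decide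
  have f2 : (1 : ZMod 5) + 2 = 3 := by decide
  have f3 : (1 : ZMod 5) + 3 = 4 := by decide
  have f4 : (1 : ZMod 5) + 4 = 0 := by decide
  have f5 : (2 : ZMod 5) + 1 = 3 := by decide
  have f6 : (2 : ZMod 5) + 2 = 4 := by decide
  have f7 : (2 : ZMod 5) + 3 = 0 := by decide
  have f8 : (2 : ZMod 5) + 4 = 1 := by decide
  have f9 : (3 : ZMod 5) + 1 = 4 := by decide
  have f10 : (3 : ZMod 5) + 2 = 0 := by decide
  have f11 : (3 : ZMod 5) + 3 = 1 := by decide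
  have f12 : (3 : ZMod 5) + 4 = 2 := by decide
  have f13 : (4 : ZMod 5) + 1 = 0 := by decide
  have f14 : (4 : ZMod 5) + 2 = 1 := by decide
  have f15 : (4 : ZMod 5) + 3 = 2 := by decide
  have f16 : (4 : ZMod 5) + 4 = 3 := by decide
  simp only [zero_add, add_zero, f1, f2, f3, f4, f5, f6, f7, f8, f9, f10, f11, f12, f13, f14, f15,
    f16] at h h1 h2 h3
  have h5' : ¬ (y 0 + y 1 ≤ B ∧ y 1 + y 2 ≤ B ∧ y 2 + y 3 ≤ B ∧ y 3 + y 4 ≤ B ∧ y 4 + y 0 ≤ B) := by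
    rintro ⟨g0, g1, g2, g3, g4⟩
    refine h5 fun i => ?_
    fin_cases i
    exacts [g0, g1, g2, g3, g4]
  clear h5
  -- All 32 supports are tried. Outside the three patterns, a support with an empty vertex is
  -- covered by two edges carrying at most `B` each, and on full support every edge bound is active.
  rcases Nat.eq_zero_or_pos (y 0) with k0 | k0 <;> rcases Nat.eq_zero_or_pos (y 1) with k1 | k1 <;>
  rcases Nat.eq_zero_or_pos (y 2) with k2 | k2 <;> rcases Nat.eq_zero_or_pos (y 3) with k3 | k3 <;>
  rcases Nat.eq_zero_or_pos (y 4) with k4 | k4 <;> simp [*] at h h1 h2 h3 <;> omega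

theorem cycle_sums {y : ZMod 5 → ℕ} {B : ℕ} (h : ∀ i, y i + y (i + 1) ≤ B) :
    y 0 + y 1 ≤ B ∧ y 1 + y 2 ≤ B ∧ y 2 + y 3 ≤ B ∧ y 3 + y 4 ≤ B ∧ y 4 + y 0 ≤ B :=
  ⟨h 0, h 1, h 2, h 3, h 4⟩

theorem two_mul_sum_le_of_cycle {y : ZMod 5 → ℕ} {B : ℕ} (h : ∀ i, y i + y (i + 1) ≤ B) :
    2 * ∑ i, y i ≤ 5 * B := by
  have := cycle_sums h
  rw [sum_zmod_five]
  omega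

/-- The total attains the bound obtained by summing over edges, so every edge is tight. On a cycle
of odd length this forces all values to agree. -/
theorem eq_of_cycle {y : ZMod 5 → ℕ} {q : ℕ} (h : ∀ i, y i + y (i + 1) ≤ 2 * q)
    (hs : ∑ i, y i = 5 * q) (i : ZMod 5) : y i = q := by
  have := cycle_sums h
  rw [sum_zmod_five] at hs
  fin_cases i
  · change y 0 = q; omega
  · change y 1 = q; omega
  · change y 2 = q; omega
  · change y 3 = q; omega
  · change y 4 = q; omega

/-! ### Profiles with a dense fibre. -/

namespace Profile

variable {x : ZMod 5 × ZMod 5 → ℕ} {q : ℕ}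

/-- The relations `0 + (1, 0) = (1, 0)` and `(1, 0) + (1, 0) = (2, 0)` would each give `2 * x (1, 0)
≤ 5 * q`. -/
theorem zero_of_lt (P : Profile x q) (he : 3 * q < x (1, 0)) : x 0 = 0 ∧ x (2, 0) = 0 := by
  constructor
  · by_contra h
    have := P.pair 0 (1, 0) (Nat.pos_of_ne_zero h)
    rw [zero_add] at this
    omega
  · by_contra h
    have := P.pairSum (1, 0) (1, 0) (Nat.pos_of_ne_zero h)
    omega

/-- The state `start m` holds for a profile with weight above `m ≥ 3` at `(1, 0)`. -/
theorem start_holds (P : Profile x q) {m : ℕ} (hm : 3 ≤ m) (he : m * q < x (1, 0)) :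
    ∀ f ∈ start m, f.Holds (x ∘ pt) q := by
  have h0 := P.zero_of_lt (lt_of_le_of_lt (Nat.mul_le_mul_right q hm) he)
  simp only [start, List.mem_cons, List.not_mem_nil, or_false]
  rintro f (rfl | rfl | rfl | rfl)
  · exact he
  · exact h0.1.le.trans (Nat.zero_le _)
  · exact h0.2.le.trans (Nat.zero_le _)
  -- Code `3` is its own neighbour, because `(3, 0) + (3, 0) = (1, 0)`.
  · simp only [Fact.Holds, NonFree]
    rcases Nat.eq_zero_or_pos ((x ∘ pt) 3) with h | h
    · exact Or.inl h
    · exact Or.inr ⟨3, by decide, h⟩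

theorem false_of_tree (P : Profile x q) {E H r m : ℕ} (hm : 3 ≤ m) (hb : ∀ g, x g ≤ H * q)
    (hE : m + E = 5) (he : m * q < x (1, 0)) (hrow : ∀ j, j ≠ 0 → rowSum x j ≤ rowSum x 1)
    (hr : r * q ≤ 2 * rowSum x 1) {S : List Fact} (hS : ∀ f ∈ S, f.Holds (x ∘ pt) q) {T : Tree}
    (hT : T.check E H r (fun _ => false) (S ++ start m) = true) : False := by
  refine Tree.sound (P.system hb hE he hrow hr) (fun S _ h => by simp at h) T _ ?_ hT
  intro f hf
  rcases List.mem_append.1 hf with h | h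
  exacts [hS f h, P.start_holds hm he f h]

theorem rowSum_comp (x : ZMod 5 × ZMod 5 → ℕ) (c d : ZMod 5) (hd : d ≠ 0) (j : ZMod 5) :
    rowSum (x ∘ triangular 1 c d (by decide) hd) j = rowSum x (d * j) := by
  simp only [rowSum, Function.comp_apply, triangular_apply, one_mul]
  exact Equiv.sum_comp (Equiv.addRight (c * j)) fun i => x (i, d * j)

/-- Only `(1, 0)`, `(3, 0)` and `(4, 0)` can be nonempty. If `(3, 0)` is empty, two fibres of at
most `4 * q` remain. Otherwise the relations `3 + 3 = 1` and `1 + 3 = 4` push the row below `8 * q`,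
so equality needs a fibre of size exactly `4 * q` at `(1, 0)`. -/
theorem rowSum_zero_le (P : Profile x q) (he : 3 * q < x (1, 0)) (hb : ∀ g, x g ≤ 4 * q) :
    rowSum x 0 ≤ 8 * q ∧ (rowSum x 0 = 8 * q → x (1, 0) = 4 * q) := by
  obtain ⟨h0, h2⟩ := P.zero_of_lt he
  rw [rowSum, sum_zmod_five]
  rw [Prod.zero_eq_mk] at h0
  rw [h0, h2]
  have h1 := hb (1, 0)
  have h4 := hb (4, 0)
  rcases Nat.eq_zero_or_pos (x (3, 0)) with h3 | h3
  · omega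
  · rcases Nat.eq_zero_or_pos (x (4, 0)) with h | h
    · have := hb (3, 0)
      have := P.pairSum (3, 0) (3, 0) (show 0 < x (1, 0) by omega)
      have := P.pos
      omega
    · have := P.triple (1, 0) (3, 0) 3 (by omega) h3 h he
      rw [show ((1, 0) + (3, 0) : ZMod 5 × ZMod 5) = (4, 0) by decide] at this
      have := P.pos
      omega

/-- Two neighbouring nonempty points of a row have small total weight. -/
theorem row_edge (P : Profile x q) {E m : ℕ} (hE : m + E = 5) (he : m * q < x (1, 0)) (i j : ZMod 5)
    (h1 : 0 < x (i, j)) (h2 : 0 < x (i + 1, j)) : x (i, j) + x (i + 1, j) ≤ E * q := by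
  have e : ((1, 0) + (i, j) : ZMod 5 × ZMod 5) = (i + 1, j) := by ext <;> simp [add_comm]
  have := P.triple (1, 0) (i, j) m (by omega) h1 (by rwa [e]) he
  rw [e] at this
  have h5 : 5 * q = m * q + E * q := by rw [← hE]; ring
  omega

theorem sum_eq_rowSum (x : ZMod 5 × ZMod 5 → ℕ) :
    ∑ g, x g = rowSum x 0 + rowSum x 1 + rowSum x 2 + rowSum x 3 + rowSum x 4 := by
  rw [Fintype.sum_prod_type_right, sum_zmod_five]; rfl

theorem triangular_pt (c d : ZMod 5) (hd : d ≠ 0) :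
    triangular 1 c d (by decide) hd (pt 5) = (c, d) ∧
    triangular 1 c d (by decide) hd (pt 6) = (1 + c, d) ∧
    triangular 1 c d (by decide) hd (pt 7) = (2 + c, d) ∧
    triangular 1 c d (by decide) hd (pt 8) = (3 + c, d) ∧
    triangular 1 c d (by decide) hd (pt 9) = (4 + c, d) := by
  have e : ∀ k : ℕ, k < 5 →
      triangular 1 c d (by decide) hd (pt (5 + k)) = ((k : ZMod 5) + c, d) := by
    intro k hk
    have h5 : (5 : ZMod 5) = 0 := by decide
    have : (5 + k) / 5 = 1 := by omega
    rw [triangular_apply]; simp [pt, this, h5]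
  exact ⟨by simpa using e 0 (by norm_num), by simpa using e 1 (by norm_num), e 2 (by norm_num),
    e 3 (by norm_num), e 4 (by norm_num)⟩

theorem singleRow_holds {c d : ZMod 5} (hd : d ≠ 0)
    (h : 0 < x (c, d) ∧ x (1 + c, d) = 0 ∧ x (2 + c, d) = 0 ∧ x (3 + c, d) = 0 ∧
      x (4 + c, d) = 0) :
    ∀ f ∈ singleRow, f.Holds ((x ∘ triangular 1 c d (by decide) hd) ∘ pt) q := by
  obtain ⟨e0, e1, e2, e3, e4⟩ := triangular_pt c d hd
  simp only [singleRow, List.mem_cons, List.not_mem_nil, or_false]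
  rintro f (rfl | rfl | rfl | rfl | rfl) <;> simp [Fact.Holds, e0, e1, e2, e3, e4, h]

theorem doubleRow_holds {c d : ZMod 5} (hd : d ≠ 0)
    (h : 0 < x (1 + c, d) ∧ 0 < x (4 + c, d) ∧ x (c, d) = 0 ∧ x (2 + c, d) = 0 ∧
      x (3 + c, d) = 0) :
    ∀ f ∈ doubleRow, f.Holds ((x ∘ triangular 1 c d (by decide) hd) ∘ pt) q := by
  obtain ⟨e0, e1, e2, e3, e4⟩ := triangular_pt c d hd
  simp only [doubleRow, List.mem_cons, List.not_mem_nil, or_false]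
  rintro f (rfl | rfl | rfl | rfl | rfl) <;> simp [Fact.Holds, e0, e1, e2, e3, e4, h]

theorem tripleRow_holds {c d : ZMod 5} (hd : d ≠ 0)
    (h : 0 < x (c, d) ∧ 0 < x (2 + c, d) ∧ 0 < x (3 + c, d) ∧ x (1 + c, d) = 0 ∧
      x (4 + c, d) = 0) :
    ∀ f ∈ tripleRow, f.Holds ((x ∘ triangular 1 c d (by decide) hd) ∘ pt) q := by
  obtain ⟨e0, e1, e2, e3, e4⟩ := triangular_pt c d hd
  simp only [tripleRow, List.mem_cons, List.not_mem_nil, or_false]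
  rintro f (rfl | rfl | rfl | rfl | rfl) <;> simp [Fact.Holds, e0, e1, e2, e3, e4, h]

/-- The hypotheses of the certificates after moving row `d` to row `1`. -/
theorem max_row_comp {c d : ZMod 5} (hd : d ≠ 0) (hmax : ∀ j, j ≠ 0 → rowSum x j ≤ rowSum x d) :
    let z := x ∘ triangular 1 c d (by decide) hd
    z (1, 0) = x (1, 0) ∧ rowSum z 1 = rowSum x d ∧ ∀ j, j ≠ 0 → rowSum z j ≤ rowSum z 1 := by
  have : Fact (Nat.Prime 5) := ⟨by norm_num⟩
  refine ⟨by simp [triangular_apply], by rw [rowSum_comp, mul_one], fun j hj => ?_⟩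
  rw [rowSum_comp, rowSum_comp, mul_one]
  exact hmax _ (mul_ne_zero hd hj)

theorem exists_max_row (x : ZMod 5 × ZMod 5 → ℕ) :
    ∃ d : ZMod 5, d ≠ 0 ∧ ∀ j, j ≠ 0 → rowSum x j ≤ rowSum x d := by
  obtain ⟨d, hd, hmax⟩ := Finset.exists_max_image (Finset.univ.filter fun j : ZMod 5 => j ≠ 0)
    (rowSum x) ⟨1, by decide⟩
  exact ⟨d, by simpa using hd, fun j hj => hmax j (by simpa using hj)⟩

theorem supports_spec {y : ℕ → ℕ} {S : List Fact} (hb : ∀ g, y g ≤ 5 * q)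
    (hS : ∀ f ∈ S, f.Holds y q) {M N : List ℕ} (h : supports M N S = true) :
    (∀ g < 25, y g ≠ 0 → g ∈ M ∨ g ∈ N) ∧ ∀ g ∈ N, 0 < y g := by
  simp only [supports, Bool.and_eq_true, List.all_eq_true, Bool.or_eq_true, List.any_eq_true,
    List.mem_range] at h
  refine ⟨fun g hg h0 => ?_, fun g hg => pos_of_nonempty hS (h.2 g hg)⟩
  rcases h.1 g hg with (⟨k, hk, hgk⟩ | ⟨k, hk, hgk⟩) | hu
  · rw [Nat.eq_of_beq_eq_true hgk]; exact Or.inl hk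
  · rw [Nat.eq_of_beq_eq_true hgk]; exact Or.inr hk
  · have := le_upper hb hS g
    rw [Nat.eq_of_beq_eq_true hu] at this
    omega

theorem exists_code (g : ZMod 5 × ZMod 5) : ∃ c < 25, pt c = g := by
  revert g; decide

/-- A profile with a fibre of density above `4 / 5` has exceptional support. -/
theorem exceptional_of_dense (P : Profile x q) (he : 4 * q < x (1, 0)) :
    ∃ ψ : (ZMod 5 × ZMod 5) ≃ₗ[ZMod 5] (ZMod 5 × ZMod 5), ExceptionalSupport (x ∘ ψ) := by
  obtain ⟨d, hd, hmax⟩ := exists_max_row x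
  -- As `(1, 0)` is nonempty, its own row has at most `10 * q` points, which leaves `18 * q` for the
  -- other four.
  have hfirst : 9 * q ≤ 2 * rowSum x d := by
    have h0 : rowSum x 0 ≤ 10 * q := by
      have := P.dir (1, 0) 0 (by decide) (by omega)
      simpa [rowSum] using this
    have ht := P.total
    rw [sum_eq_rowSum] at ht
    have h1 := hmax 1 (by decide)
    have h2 := hmax 2 (by decide)
    have h3 := hmax 3 (by decide)
    have h4 := hmax 4 (by decide)
    omega
  have hq := P.pos
  have key : ∀ c : ZMod 5, ∃ hz : ∀ j, j ≠ 0 →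
      rowSum (x ∘ triangular 1 c d (by decide) hd) j ≤
        rowSum (x ∘ triangular 1 c d (by decide) hd) 1,
      4 * q < (x ∘ triangular 1 c d (by decide) hd) (1, 0) ∧
      9 * q ≤ 2 * rowSum (x ∘ triangular 1 c d (by decide) hd) 1 := by
    intro c
    obtain ⟨h1, h2, h3⟩ := max_row_comp (c := c) hd hmax
    exact ⟨h3, by rw [h1]; exact he, by rw [h2]; exact hfirst⟩
  rcases cycle_cases (fun i => x (i, d)) (1 * q)
    (fun i => P.row_edge (m := 4) rfl he i d) with ⟨c, h⟩ | ⟨c, h⟩ | ⟨c, h⟩ | h | h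
  · obtain ⟨hz, h1, h2⟩ := key c
    exact ((P.comp _).false_of_tree (by norm_num) (P.comp _).bound rfl h1 hz h2
      (singleRow_holds hd h) singleTree_check).elim
  · obtain ⟨hz, h1, h2⟩ := key c
    set z := x ∘ triangular 1 c d (by decide) hd with hzdef
    have Pz : Profile z q := P.comp _
    have hsys := Pz.system (E := 1) Pz.bound rfl h1 hz h2
    refine Tree.sound hsys ?_ doubleTree _ ?_ doubleTree_check
    · intro S hS hgood
      simp only [exceptional, Bool.or_eq_true] at hgood
      rcases hgood with hgood | hgood
      · obtain ⟨g1, g2⟩ := supports_spec hsys.bound hS hgood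
        -- The shear `(i, j) ↦ (i - j, j)` carries the eight points of the exceptional support to
        -- the pattern in the tree; the mirrored pattern below needs the negated first coordinate.
        refine ⟨(triangular 1 4 1 (by decide) (by decide)).trans
          (triangular 1 c d (by decide) hd), ?_⟩
        change ExceptionalSupport (z ∘ triangular 1 4 1 (by decide) (by decide))
        refine ⟨fun g hg => ?_, g2 6 (by decide), g2 12 (by decide), g2 18 (by decide),
          g2 24 (by decide)⟩
        obtain ⟨k, hk, hkg⟩ := exists_code (triangular 1 4 1 (by decide) (by decide) g)
        have := g1 k hk (by rw [Function.comp_apply, hkg]; exact hg)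
        have hdec : ∀ k ∈ [1, 4, 9, 21] ++ [6, 12, 18, 24], ∀ g : ZMod 5 × ZMod 5,
            pt k = (1 * g.1 + 4 * g.2, 1 * g.2) → g = (1, 0) ∨ g = (4, 0) ∨ g = (0, 1) ∨
              g = (0, 4) ∨ g = (2, 1) ∨ g = (4, 2) ∨ g = (1, 3) ∨ g = (3, 4) := by decide
        exact hdec k (List.mem_append.2 this) g hkg
      · obtain ⟨g1, g2⟩ := supports_spec hsys.bound hS hgood
        refine ⟨(triangular 4 1 1 (by decide) (by decide)).trans
          (triangular 1 c d (by decide) hd), ?_⟩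
        change ExceptionalSupport (z ∘ triangular 4 1 1 (by decide) (by decide))
        refine ⟨fun g hg => ?_, g2 9 (by decide), g2 13 (by decide), g2 17 (by decide),
          g2 21 (by decide)⟩
        obtain ⟨k, hk, hkg⟩ := exists_code (triangular 4 1 1 (by decide) (by decide) g)
        have := g1 k hk (by rw [Function.comp_apply, hkg]; exact hg)
        have hdec : ∀ k ∈ [1, 4, 6, 24] ++ [9, 13, 17, 21], ∀ g : ZMod 5 × ZMod 5,
            pt k = (4 * g.1 + 1 * g.2, 1 * g.2) → g = (1, 0) ∨ g = (4, 0) ∨ g = (0, 1) ∨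
              g = (0, 4) ∨ g = (2, 1) ∨ g = (4, 2) ∨ g = (1, 3) ∨ g = (3, 4) := by decide
        exact hdec k (List.mem_append.2 this) g hkg
    · intro f hf
      rcases List.mem_append.1 hf with h' | h'
      exacts [doubleRow_holds hd h f h', Pz.start_holds (by norm_num) h1 f h']
  · obtain ⟨hz, h1, h2⟩ := key c
    exact ((P.comp _).false_of_tree (by norm_num) (P.comp _).bound rfl h1 hz h2
      (tripleRow_holds hd h) tripleTree_check).elim
  -- The last two cases bound the row by `2 * q` and `5 / 2 * q`, both below `9 / 2 * q`.
  · have : rowSum x d ≤ 2 * (1 * q) := h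
    omega
  · have := two_mul_sum_le_of_cycle h
    have e : rowSum x d = ∑ i, x (i, d) := rfl
    omega

/-- In a profile without fibres of density above `4 / 5`, all rows but one are constant. -/
theorem constant_of_sparse (P : Profile x q) (hb : ∀ g, x g ≤ 4 * q) (he : 3 * q < x (1, 0)) :
    x (1, 0) = 4 * q ∧ ∀ i j, j ≠ 0 → x (i, j) = q := by
  have hq := P.pos
  obtain ⟨hs0, hs0'⟩ := P.rowSum_zero_le he hb
  have ht := P.total
  rw [sum_eq_rowSum] at ht
  have key : ∀ d, d ≠ 0 → (∀ j, j ≠ 0 → rowSum x j ≤ rowSum x d) →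
      rowSum x d ≤ 5 * q ∧ (rowSum x d = 5 * q → ∀ i, x (i, d) = q) := by
    intro d hd hmax
    have hfirst : 10 * q ≤ 2 * rowSum x d := by
      have h1 := hmax 1 (by decide)
      have h2 := hmax 2 (by decide)
      have h3 := hmax 3 (by decide)
      have h4 := hmax 4 (by decide)
      omega
    have key : ∀ c : ZMod 5, ∃ hz : ∀ j, j ≠ 0 →
        rowSum (x ∘ triangular 1 c d (by decide) hd) j ≤
          rowSum (x ∘ triangular 1 c d (by decide) hd) 1,
        3 * q < (x ∘ triangular 1 c d (by decide) hd) (1, 0) ∧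
        10 * q ≤ 2 * rowSum (x ∘ triangular 1 c d (by decide) hd) 1 := by
      intro c
      obtain ⟨h1, h2, h3⟩ := max_row_comp (c := c) hd hmax
      exact ⟨h3, by rw [h1]; exact he, by rw [h2]; exact hfirst⟩
    have e : rowSum x d = ∑ i, x (i, d) := rfl
    rcases cycle_cases (fun i => x (i, d)) (2 * q)
      (fun i => P.row_edge (m := 3) rfl he i d) with ⟨c, h⟩ | ⟨c, h⟩ | ⟨c, h⟩ | h | h
    -- A single fibre has at most `4 * q` points, less than the required `5 * q`, so no certificate
    -- is needed for this pattern.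
    · have h' : rowSum x d = x (c, d) := by
        rw [e, ← Equiv.sum_comp (Equiv.addRight c), sum_zmod_five]
        simp [h]
      have := hb (c, d)
      omega
    · obtain ⟨hz, h1, h2⟩ := key c
      exact ((P.comp _).false_of_tree (by norm_num) (fun g => hb _) rfl h1 hz h2
        (doubleRow_holds hd h) doubleTreeOfBound_check).elim
    · obtain ⟨hz, h1, h2⟩ := key c
      exact ((P.comp _).false_of_tree (by norm_num) (fun g => hb _) rfl h1 hz h2
        (tripleRow_holds hd h) tripleTreeOfBound_check).elim
    · omega
    · have := two_mul_sum_le_of_cycle h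
      exact ⟨by omega, fun h5 => eq_of_cycle h (by omega)⟩
  obtain ⟨d, hd, hmax⟩ := exists_max_row x
  have hd5 := (key d hd hmax).1
  have h1 := hmax 1 (by decide)
  have h2 := hmax 2 (by decide)
  have h3 := hmax 3 (by decide)
  have h4 := hmax 4 (by decide)
  -- The row of the origin has at most `8 * q` points and each other row at most `5 * q`. The total
  -- `28 * q` forces equality, so every row off the origin is maximal and `key` applies to each.
  have hall : ∀ j, j ≠ 0 → rowSum x j = 5 * q := by
    intro j hj
    fin_cases j
    · exact absurd rfl hj
    · change rowSum x 1 = _; omega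
    · change rowSum x 2 = _; omega
    · change rowSum x 3 = _; omega
    · change rowSum x 4 = _; omega
  refine ⟨hs0' (by omega), fun i j hj => (key j hj fun k hk => ?_).2 (hall j hj) i⟩
  rw [hall j hj, hall k hk]

end Profile

/-! ### Sumsets in vector spaces over `𝔽₅` -/

section Sumset

open Finset Pointwise

theorem fact_prime_five : Fact (Nat.Prime 5) := ⟨by norm_num⟩

attribute [local instance] fact_prime_five

/-- Iterated Dyson transforms end in a pair `(X', Y')` such that `X'` is stable under differences
of elements of `Y'`. -/
theorem exists_dyson_stable {G : Type*} [AddCommGroup G] [DecidableEq G] (X Y : Finset G)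
    (hX : X.Nonempty) (hY : Y.Nonempty) :
    ∃ X' Y' : Finset G, X ⊆ X' ∧ Y' ⊆ Y ∧ Y'.Nonempty ∧ #X' + #Y' = #X + #Y ∧
      X' + Y' ⊆ X + Y ∧ ∀ x ∈ X', ∀ y ∈ Y', ∀ y' ∈ Y', x + (y - y') ∈ X' := by
  induction hn : #Y using Nat.strong_induction_on generalizing X Y with
  | _ n ih =>
    by_cases h : ∀ x ∈ X, ∀ y ∈ Y, ∀ y' ∈ Y, x + (y - y') ∈ X
    · exact ⟨X, Y, Subset.rfl, Subset.rfl, hY, by rw [hn], Subset.rfl, h⟩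
    · push Not at h
      -- The Dyson transform with shift `x - y'` removes `y` from the second set, since `x + (y -
      -- y')` is missing from `X`, but keeps `y'`. It preserves the sum of the two cardinalities and
      -- does not enlarge the sumset.
      obtain ⟨x, hx, y, hy, y', hy', hxy⟩ := h
      have hsub : Y ∩ (-(x - y') +ᵥ X) ⊆ Y := inter_subset_left
      have hlt : #(Y ∩ (-(x - y') +ᵥ X)) < n := by
        rw [← hn]
        refine card_lt_card ⟨hsub, fun hc => ?_⟩
        have := (mem_inter.1 (hc hy)).2
        rw [mem_vadd_finset] at this
        obtain ⟨z, hz, hzy⟩ := this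
        refine hxy ?_
        rw [← hzy, vadd_eq_add]
        convert hz using 1
        abel
      have hne : (Y ∩ (-(x - y') +ᵥ X)).Nonempty := by
        refine ⟨y', mem_inter.2 ⟨hy', ?_⟩⟩
        rw [mem_vadd_finset]
        exact ⟨x, hx, by rw [vadd_eq_add]; abel⟩
      obtain ⟨X', Y', h1, h2, h3, h4, h5, h6⟩ :=
        ih _ hlt (X ∪ ((x - y') +ᵥ Y)) (Y ∩ (-(x - y') +ᵥ X)) (hX.mono subset_union_left) hne rfl
      refine ⟨X', Y', subset_union_left.trans h1, h2.trans hsub, h3, ?_, ?_, h6⟩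
      · rw [← hn] at *
        have := addDysonETransform.card (x - y') (X, Y)
        simp only [addDysonETransform] at this
        omega
      · exact h5.trans (addDysonETransform.subset (x - y') (X, Y))

variable {G : Type*} [AddCommGroup G] [Module (ZMod 5) G]

/-- A finite set stable under adding a set of vectors is stable under adding its span. -/
theorem add_mem_of_mem_span {X : Finset G} {s : Set G} (h : ∀ x ∈ X, ∀ v ∈ s, x + v ∈ X) {v : G}
    (hv : v ∈ Submodule.span (ZMod 5) s) : ∀ x ∈ X, x + v ∈ X := by
  induction hv using Submodule.span_induction with
  | mem v hv => exact fun x hx => h x hx v hv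
  | zero => simp
  | add v w _ _ hv hw =>
    intro x hx
    rw [← add_assoc]
    exact hw _ (hv _ hx)
  | smul k v _ hv =>
    intro x hx
    have : ∀ n : ℕ, x + n • v ∈ X := by
      intro n
      induction n with
      | zero => simpa using hx
      | succ n ih =>
        rw [succ_nsmul, ← add_assoc]
        exact hv _ ih
    have h2 := this k.val
    rwa [← Nat.cast_smul_eq_nsmul (ZMod 5), ZMod.natCast_zmod_val] at h2

variable [Fintype G]

theorem exists_card_eq_pow (K : Submodule (ZMod 5) G) : ∃ k, Nat.card K = 5 ^ k :=
  ⟨Module.finrank (ZMod 5) K, by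
    rw [Module.natCard_eq_pow_finrank (K := ZMod 5) (V := K)]; simp⟩

theorem card_fiber {M : Type*} [AddCommGroup M] [Module (ZMod 5) M] [DecidableEq M]
    (φ : G →ₗ[ZMod 5] M) (x : G) : #{y | φ y = φ x} = Nat.card (LinearMap.ker φ) := by
  classical
  rw [Nat.card_eq_fintype_card, Fintype.card_subtype]
  refine card_nbij' (fun y => y - x) (fun k => k + x) ?_ ?_ ?_ ?_ <;>
    simp +contextual [Set.MapsTo, Set.LeftInvOn, Set.RightInvOn]

/-- A set that is stable under adding elements of the kernel of `φ` is a union of fibres. -/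
theorem card_eq_card_image_mul {M : Type*} [AddCommGroup M] [Module (ZMod 5) M] [DecidableEq M]
    (φ : G →ₗ[ZMod 5] M) {X : Finset G} (h : ∀ x ∈ X, ∀ k ∈ LinearMap.ker φ, x + k ∈ X) :
    #X = #(X.image φ) * Nat.card (LinearMap.ker φ) := by
  rw [card_eq_sum_card_image φ X, sum_const_nat]
  intro m hm
  obtain ⟨x, hx, rfl⟩ := mem_image.1 hm
  rw [← card_fiber φ x]
  congr 1
  ext y
  simp only [mem_filter, mem_univ, true_and, and_iff_right_iff_imp]
  intro hy
  have := h x hx (y - x) (by simp [hy])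
  simpa using this

variable [DecidableEq G]

/-- The outcome of the Dyson transforms, with the subspace under which the first set is stable. -/
theorem exists_stable_subspace (X Y : Finset G) (hX : X.Nonempty) (hY : Y.Nonempty) :
    ∃ (X' Y' : Finset G) (K : Submodule (ZMod 5) G), X ⊆ X' ∧ Y' ⊆ Y ∧ Y'.Nonempty ∧
      #X' + #Y' = #X + #Y ∧ X' + Y' ⊆ X + Y ∧ (∀ x ∈ X', ∀ k ∈ K, x + k ∈ X') ∧
      (∀ y ∈ Y', ∀ y' ∈ Y', y - y' ∈ K) ∧
      (∀ W : Submodule (ZMod 5) G, (∀ y ∈ Y, ∀ y' ∈ Y, y - y' ∈ W) → K ≤ W) ∧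
      Nat.card K ∣ #X' ∧ #Y' ≤ Nat.card K := by
  obtain ⟨X', Y', h1, h2, h3, h4, h5, h6⟩ := exists_dyson_stable X Y hX hY
  -- The subspace is the span of the differences of `Y'`. Thus `X'` is a union of its cosets and
  -- `Y'` lies in a single coset.
  have hstab : ∀ x ∈ X', ∀ k ∈ Submodule.span (ZMod 5) {v | ∃ y ∈ Y', ∃ y' ∈ Y', y - y' = v},
      x + k ∈ X' := fun x hx k hk =>
    add_mem_of_mem_span (fun x hx v hv => by
      obtain ⟨y, hy, y', hy', rfl⟩ := hv
      exact h6 x hx y hy y' hy') hk x hx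
  have hmem : ∀ y ∈ Y', ∀ y' ∈ Y', y - y' ∈
      Submodule.span (ZMod 5) {v | ∃ y ∈ Y', ∃ y' ∈ Y', y - y' = v} := fun y hy y' hy' =>
    Submodule.subset_span ⟨y, hy, y', hy', rfl⟩
  refine ⟨X', Y', _, h1, h2, h3, h4, h5, hstab, hmem, ?_, ?_, ?_⟩
  · intro W hW
    rw [Submodule.span_le]
    rintro v ⟨y, hy, y', hy', rfl⟩
    exact hW y (h2 hy) y' (h2 hy')
  · classical
    have := card_eq_card_image_mul (Submodule.mkQ _) (X := X')
      (fun x hx k hk => hstab x hx k (by simpa using hk))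
    rw [Submodule.ker_mkQ] at this
    exact ⟨_, by rw [this, mul_comm]⟩
  · obtain ⟨y, hy⟩ := h3
    classical
    rw [Nat.card_eq_fintype_card, Fintype.card_subtype]
    refine card_le_card_of_injOn (fun z => z - y) ?_ ?_
    · intro z hz
      simpa using hmem z hz y hy
    · intro a _ b _ hab
      simpa using hab

/-- Two large sets have a large sumset; `Y` is contained in a coset of `W`. -/
theorem le_card_add {W : Submodule (ZMod 5) G} {d t : ℕ} (hW : Nat.card W = 5 * 5 ^ d)
    (ht : t ≤ 5) {X Y : Finset G} (hX : X.Nonempty) (hY : Y.Nonempty)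
    (hYW : ∀ y ∈ Y, ∀ y' ∈ Y, y - y' ∈ W) (hXY : t * 5 ^ d < #X + #Y) :
    t * 5 ^ d ≤ #(X + Y) := by
  obtain ⟨X', Y', K, h1, h2, h3, h4, h5, h6, h7, h8, h9, h10⟩ := exists_stable_subspace X Y hX hY
  have hle : #X' ≤ #(X + Y) := (card_le_card_add_right h3).trans (card_le_card h5)
  refine le_trans ?_ hle
  have hKW : K ≤ W := h8 W hYW
  obtain ⟨k, hk⟩ := exists_card_eq_pow K
  have hcard : Nat.card K ≤ Nat.card W := Nat.card_mono (Set.toFinite _) hKW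
  rw [hk] at h9 h10 hcard
  rw [hW, ← pow_succ'] at hcard
  have hkd : k ≤ d + 1 := (Nat.pow_le_pow_iff_right (by norm_num)).1 hcard
  -- If `K` has at most `5 ^ d` elements, its order divides both `#X'` and `t * 5 ^ d`. As `#X'`
  -- exceeds `t * 5 ^ d` minus that order, it is at least `t * 5 ^ d`. Otherwise `X'` contains a
  -- coset of `5 * 5 ^ d` points, and `t ≤ 5` suffices.
  rcases hkd.lt_or_eq with hlt | rfl
  · obtain ⟨c, hc⟩ := h9
    have hd : 5 ^ d = 5 ^ k * 5 ^ (d - k) := by rw [← pow_add]; congr 1; omega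
    have h11 : 5 ^ k * (t * 5 ^ (d - k)) < 5 ^ k * (c + 1) := by
      calc 5 ^ k * (t * 5 ^ (d - k)) = t * 5 ^ d := by rw [hd]; ring
        _ < #X' + #Y' := by omega
        _ ≤ 5 ^ k * c + 5 ^ k := by omega
        _ = 5 ^ k * (c + 1) := by ring
    have h12 : t * 5 ^ (d - k) ≤ c := Nat.lt_succ_iff.1 (lt_of_mul_lt_mul_left h11 (Nat.zero_le _))
    calc t * 5 ^ d = 5 ^ k * (t * 5 ^ (d - k)) := by rw [hd]; ring
      _ ≤ 5 ^ k * c := Nat.mul_le_mul_left _ h12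
      _ = #X' := hc.symm
  · have := Nat.le_of_dvd (card_pos.2 (hX.mono h1)) h9
    refine le_trans ?_ this
    rw [pow_succ']
    exact Nat.mul_le_mul_right _ ht

end Sumset

/-! ### Fibres of sum-free sets -/

section Fibre

open Finset Pointwise

attribute [local instance] fact_prime_five

variable {G : Type*} [AddCommGroup G] [Module (ZMod 5) G]
  {M : Type*} [AddCommGroup M] [Module (ZMod 5) M] [DecidableEq M]

/-- The part of `A` on which `φ` takes the value `g`. -/
def fibre (A : Finset G) (φ : G →ₗ[ZMod 5] M) (g : M) : Finset G := {a ∈ A | φ a = g}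

theorem mem_fibre {A : Finset G} {φ : G →ₗ[ZMod 5] M} {g : M} {a : G} :
    a ∈ fibre A φ g ↔ a ∈ A ∧ φ a = g := by simp [fibre]

/-- A sum-free set containing `x` has density at most `2 / 5` in a set stable under adding `x`. -/
theorem card_inter_le_of_stable [DecidableEq G] {A : Finset G}
    (hA : ∀ x ∈ A, ∀ y ∈ A, x + y ∉ A) {x : G} (hx : x ∈ A) {U : Finset G}
    (hU : ∀ z ∈ U, z + x ∈ U) :
    5 * #(A ∩ U) ≤ 2 * #U := by
  have hU' : ∀ k : ZMod 5, ∀ z ∈ U, z + k • x ∈ U := fun k z hz =>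
    add_mem_of_mem_span (s := {x})
      (fun z hz v hv => by rw [Set.mem_singleton_iff.1 hv]; exact hU z hz)
      (Submodule.mem_span_singleton.2 ⟨k, rfl⟩) z hz
  have h1 : ∀ k : ZMod 5, #{z ∈ U | z + k • x ∈ A} = #(A ∩ U) := by
    intro k
    refine card_nbij' (fun z => z + k • x) (fun z => z + (-k) • x) ?_ ?_ ?_ ?_
    · intro z hz
      have hz := mem_filter.1 hz
      exact mem_inter.2 ⟨hz.2, hU' k z hz.1⟩
    · intro z hz
      have hz := mem_inter.1 hz
      exact mem_filter.2 ⟨hU' _ z hz.2, by simpa using hz.1⟩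
    · intro z _; simp
    · intro z _; simp
  have h2 : ∀ z : G, #{k : ZMod 5 | z + k • x ∈ A} ≤ 2 := by
    intro z
    -- Along `z + k • x` the set `A` contains no two cyclically consecutive terms, hence at most two
    -- of the five. Double counting pairs `(z, k)` then gives the density.
    have hcyc : ∀ s : Finset (ZMod 5), (∀ k ∈ s, k + 1 ∉ s) → #s ≤ 2 := by decide
    refine hcyc _ fun k hk hk' => ?_
    simp only [mem_filter, mem_univ, true_and] at hk hk'
    refine hA _ hk x hx ?_
    rwa [add_smul, one_smul, ← add_assoc] at hk'
  calc 5 * #(A ∩ U) = ∑ k : ZMod 5, #{z ∈ U | z + k • x ∈ A} := by simp [h1]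
    _ = ∑ z ∈ U, #{k : ZMod 5 | z + k • x ∈ A} := by
      simp only [card_filter]; rw [sum_comm]
    _ ≤ ∑ z ∈ U, 2 := sum_le_sum fun z _ => h2 z
    _ = 2 * #U := by rw [sum_const, smul_eq_mul, mul_comm]

variable [Fintype G] [DecidableEq G]

theorem card_add_card_le {φ : G →ₗ[ZMod 5] M} {S T : Finset G} {m : M} (hS : ∀ s ∈ S, φ s = m)
    (hT : ∀ t ∈ T, φ t = m) (h : Disjoint S T) : #S + #T ≤ Nat.card (LinearMap.ker φ) := by
  rw [← card_union_of_disjoint h]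
  rcases (S ∪ T).eq_empty_or_nonempty with h0 | ⟨x, hx⟩
  · simp [h0]
  · have key : ∀ y ∈ S ∪ T, φ y = m := fun y hy => (mem_union.1 hy).elim (hS y) (hT y)
    rw [← card_fiber φ x, key x hx]
    exact card_le_card fun y hy => by simpa using key y hy

variable {A : Finset G}

theorem card_fibre_le (A : Finset G) (φ : G →ₗ[ZMod 5] M) (g : M) :
    #(fibre A φ g) ≤ Nat.card (LinearMap.ker φ) := by
  simpa using card_add_card_le (φ := φ) (S := fibre A φ g) (T := ∅) (m := g)
    (fun s hs => (mem_fibre.1 hs).2) (by simp) (by simp)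

/-- The sumset of two fibres and the fibre over the sum are disjoint subsets of one coset of the
kernel. -/
theorem card_fibre_add (hA : ∀ x ∈ A, ∀ y ∈ A, x + y ∉ A)
    (φ : G →ₗ[ZMod 5] M) (g h : M) :
    #(fibre A φ g + fibre A φ h) + #(fibre A φ (g + h)) ≤ Nat.card (LinearMap.ker φ) := by
  refine card_add_card_le (m := g + h) ?_ (fun t ht => (mem_fibre.1 ht).2) ?_
  · intro s hs
    obtain ⟨a, ha, b, hb, rfl⟩ := mem_add.1 hs
    rw [map_add, (mem_fibre.1 ha).2, (mem_fibre.1 hb).2]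
  · rw [disjoint_left]
    intro s hs hs'
    obtain ⟨a, ha, b, hb, rfl⟩ := mem_add.1 hs
    exact hA a (mem_fibre.1 ha).1 b (mem_fibre.1 hb).1 (mem_fibre.1 hs').1

/-- An element `a - b` of the difference set lying in `A` would give the forbidden relation `(a - b)
+ b = a`. -/
theorem card_fibre_sub (hA : ∀ x ∈ A, ∀ y ∈ A, x + y ∉ A)
    (φ : G →ₗ[ZMod 5] M) (g h : M) :
    #(fibre A φ (g + h) - fibre A φ h) + #(fibre A φ g) ≤ Nat.card (LinearMap.ker φ) := by
  refine card_add_card_le (m := g) ?_ (fun t ht => (mem_fibre.1 ht).2) ?_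
  · intro s hs
    obtain ⟨a, ha, b, hb, rfl⟩ := mem_sub.1 hs
    rw [map_sub, (mem_fibre.1 ha).2, (mem_fibre.1 hb).2, add_sub_cancel_right]
  · rw [disjoint_left]
    intro s hs hs'
    obtain ⟨a, ha, b, hb, rfl⟩ := mem_sub.1 hs
    exact hA _ (mem_fibre.1 hs').1 b (mem_fibre.1 hb).1 (by
      rw [sub_add_cancel]; exact (mem_fibre.1 ha).1)

theorem card_fibre_pair (hA : ∀ x ∈ A, ∀ y ∈ A, x + y ∉ A)
    (φ : G →ₗ[ZMod 5] M) (g h : M) (hg : (fibre A φ g).Nonempty) :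
    #(fibre A φ h) + #(fibre A φ (g + h)) ≤ Nat.card (LinearMap.ker φ) := by
  have h1 := card_fibre_add hA φ g h
  have h2 : #(fibre A φ h) ≤ #(fibre A φ g + fibre A φ h) := card_le_card_add_left hg
  omega

theorem card_fibre_pairSum (hA : ∀ x ∈ A, ∀ y ∈ A, x + y ∉ A)
    (φ : G →ₗ[ZMod 5] M) (g h : M) (hg : (fibre A φ (g + h)).Nonempty) :
    #(fibre A φ g) + #(fibre A φ h) ≤ Nat.card (LinearMap.ker φ) := by
  have h1 := card_fibre_sub hA φ g h
  have h2 : #(fibre A φ h) ≤ #(fibre A φ (g + h) - fibre A φ h) := card_le_card_sub_left hg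
  omega

/-- If the fibres over `g` and `h` had more than `(5 - m) * 5 ^ d` points together, `le_card_add`
would give their sumset at least `(5 - m) * 5 ^ d` points, leaving at most `m * 5 ^ d` for the fibre
over `g + h`. -/
theorem card_fibre_tripleSum (hA : ∀ x ∈ A, ∀ y ∈ A, x + y ∉ A)
    (φ : G →ₗ[ZMod 5] M) {d : ℕ} (hd : Nat.card (LinearMap.ker φ) = 5 * 5 ^ d) (g h : M) (m : ℕ)
    (hg : (fibre A φ g).Nonempty)
    (hh : (fibre A φ h).Nonempty) (hm : m * 5 ^ d < #(fibre A φ (g + h))) :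
    #(fibre A φ g) + #(fibre A φ h) + m * 5 ^ d ≤ 5 * 5 ^ d := by
  have h1 := card_fibre_add hA φ g h
  have h2 := card_fibre_le A φ (g + h)
  rw [hd] at h1 h2
  have h5 : m < 5 := lt_of_mul_lt_mul_right (hm.trans_le h2) (Nat.zero_le _)
  have e : 5 * 5 ^ d = (5 - m) * 5 ^ d + m * 5 ^ d := by rw [← add_mul]; congr 1; omega
  by_contra hc
  have h3 := le_card_add (t := 5 - m) hd (by omega) hg hh (fun y hy y' hy' => by
    rw [LinearMap.mem_ker, map_sub, (mem_fibre.1 hy).2, (mem_fibre.1 hy').2, sub_self]) (by omega)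
  omega

/-- The same argument with the difference set in place of the sumset. -/
theorem card_fibre_triple (hA : ∀ x ∈ A, ∀ y ∈ A, x + y ∉ A)
    (φ : G →ₗ[ZMod 5] M) {d : ℕ} (hd : Nat.card (LinearMap.ker φ) = 5 * 5 ^ d) (g h : M) (m : ℕ)
    (hh : (fibre A φ h).Nonempty)
    (hgh : (fibre A φ (g + h)).Nonempty) (hm : m * 5 ^ d < #(fibre A φ g)) :
    #(fibre A φ h) + #(fibre A φ (g + h)) + m * 5 ^ d ≤ 5 * 5 ^ d := by
  have h1 := card_fibre_sub hA φ g h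
  have h2 := card_fibre_le A φ g
  rw [hd] at h1 h2
  have h5 : m < 5 := lt_of_mul_lt_mul_right (hm.trans_le h2) (Nat.zero_le _)
  have e : 5 * 5 ^ d = (5 - m) * 5 ^ d + m * 5 ^ d := by rw [← add_mul]; congr 1; omega
  by_contra hc
  have h3 := le_card_add (t := 5 - m) (X := fibre A φ (g + h)) (Y := -fibre A φ h) hd (by omega) hgh
    hh.neg (fun y hy y' hy' => by
      rw [mem_neg] at hy hy'
      obtain ⟨a, ha, rfl⟩ := hy
      obtain ⟨b, hb, rfl⟩ := hy'
      rw [LinearMap.mem_ker, map_sub, map_neg, map_neg, (mem_fibre.1 ha).2, (mem_fibre.1 hb).2,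
        sub_self]) (by rw [card_neg]; omega)
  rw [← sub_eq_add_neg] at h3
  omega

/-- The union of the five full fibres of `φ` along the line is stable under adding an element of `A`
over `e`, so `A` has density at most `2 / 5` in it. -/
theorem card_fibre_line (hA : ∀ x ∈ A, ∀ y ∈ A, x + y ∉ A)
    (φ : G →ₗ[ZMod 5] M) {e : M} (g : M) (he : e ≠ 0) (hpos : (fibre A φ e).Nonempty) :
    ∑ k : ZMod 5, #(fibre A φ (g + k • e)) ≤ 2 * Nat.card (LinearMap.ker φ) := by
  obtain ⟨x, hx⟩ := hpos
  obtain ⟨hxA, hxe⟩ := mem_fibre.1 hx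
  have hinj : Function.Injective fun k : ZMod 5 => g + k • e := fun a b hab => by
    simpa [he] using hab
  let U : Finset G := univ.filter fun z => ∃ k : ZMod 5, φ z = g + k • e
  have hU : ∀ z ∈ U, z + x ∈ U := by
    intro z hz
    simp only [U, mem_filter, mem_univ, true_and] at hz ⊢
    obtain ⟨k, hk⟩ := hz
    exact ⟨k + 1, by rw [map_add, hk, hxe, add_smul, one_smul, add_assoc]⟩
  have h1 := card_inter_le_of_stable hA hxA hU
  have hsum : ∀ B : Finset G, #(B ∩ U) = ∑ k : ZMod 5, #(fibre B φ (g + k • e)) := by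
    intro B
    rw [card_eq_sum_card_fiberwise (f := φ) (t := univ.image fun k : ZMod 5 => g + k • e),
      sum_image fun a _ b _ h => hinj h]
    · refine sum_congr rfl fun k _ => ?_
      congr 1
      ext z
      simp only [U, fibre, mem_filter, mem_inter, mem_univ, true_and]
      exact ⟨fun h => ⟨h.1.1, h.2⟩, fun h => ⟨⟨h.1, k, h.2⟩, h.2⟩⟩
    · intro z hz
      have hz := (mem_inter.1 hz).2
      simp only [U, mem_filter, mem_univ, true_and] at hz
      obtain ⟨k, hk⟩ := hz
      simp [hk]
  have h2 := hsum univ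
  rw [univ_inter] at h2
  have h3 : ∑ k : ZMod 5, #(fibre (univ : Finset G) φ (g + k • e)) ≤
      ∑ k : ZMod 5, Nat.card (LinearMap.ker φ) := sum_le_sum fun k _ => card_fibre_le _ _ _
  simp only [sum_const, card_univ, ZMod.card, smul_eq_mul] at h3
  rw [← hsum]
  omega

end Fibre

/-! ### Dense hyperplanes -/

section Hyperplane

open Finset Pointwise

attribute [local instance] fact_prime_five

/-- There is no distribution of weights on three parallel lines of the kind that a dense hyperplane
would produce. -/
theorem no_split {x₁ x₃ x₄ : ZMod 5 → ℕ} {q : ℕ} (hq : 0 < q) (hb : ∀ b, x₃ b ≤ 5 * q)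
    {P : Finset (ZMod 5)} (hP : ∀ b, x₁ b ≠ 0 → b ∈ P) (hPne : P.Nonempty) {c₀ : ZMod 5}
    (hc₀ : ∀ b ∈ P, x₄ (b + c₀) = 0) (h₁ : ∀ c b, 0 < x₃ c → x₁ b + x₄ (b + c) ≤ 5 * q)
    (h₃ : ∀ c, 0 < x₁ (c + c) → x₃ c + x₃ c ≤ 5 * q)
    (h₄ : ∀ b, 0 < x₃ (b + b) → x₄ b + x₄ b ≤ 5 * q) (hY : ∃ c, 0 < x₃ c) (hZ : ∃ z, 0 < x₄ z)
    (hs : 2 * ∑ c, x₃ c ≤ 15 * q) (ht : 28 * q ≤ ∑ b, x₁ b + ∑ c, x₃ c + ∑ z, x₄ z) : False := by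
  have hshift : ∀ c : ZMod 5, ∑ b, (x₁ b + x₄ (b + c)) = ∑ b, x₁ b + ∑ z, x₄ z := by
    intro c
    rw [sum_add_distrib, show ∑ b, x₄ (b + c) = ∑ z, x₄ z from Equiv.sum_comp (Equiv.addRight c) x₄]
  have hrest : ∀ c, 0 < x₃ c → ∀ b, ∑ b, x₁ b + ∑ z, x₄ z ≤ x₁ b + x₄ (b + c) + 20 * q := by
    intro c hc b
    rw [← hshift c, ← add_sum_erase _ _ (mem_univ b)]
    have : ∑ b' ∈ univ.erase b, (x₁ b' + x₄ (b' + c)) ≤ ∑ b' ∈ univ.erase b, 5 * q :=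
      sum_le_sum fun b' _ => h₁ c b' hc
    rw [sum_const, card_erase_of_mem (mem_univ b), card_univ, ZMod.card, smul_eq_mul] at this
    omega
  let Z : Finset (ZMod 5) := univ.filter fun z => 0 < x₄ z
  have hZmem : ∀ z, z ∈ Z ↔ 0 < x₄ z := fun z => by simp [Z]
  -- If both `x₁ b` and `x₄ (b + c)` vanished, the outer lines would have at most `20 * q` together.
  -- With at most `15 / 2 * q` on the middle line, the total would fall short of `28 * q`.
  have hcov : ∀ c, 0 < x₃ c → ∀ b, b ∈ Pᶜ → b + c ∈ Z := by
    intro c hc b hbP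
    rw [hZmem]
    by_contra h0
    have h1 : x₁ b = 0 := by
      by_contra h; exact (mem_compl.1 hbP) (hP b h)
    have := hrest c hc b
    omega
  -- The translate of `P` by `c₀` avoids `Z`. With `hcov` this makes `Z` equal to the translate of
  -- `Pᶜ` by every `c` in the support of `x₃`.
  have hcard : #Z ≤ #Pᶜ := by
    rw [card_compl, ZMod.card]
    have hdisj : Disjoint Z (P.map (Equiv.addRight c₀).toEmbedding) := by
      rw [disjoint_left]
      intro z hz hz'
      obtain ⟨b, hb', rfl⟩ := mem_map.1 hz'
      have h0 := hc₀ b hb'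
      have h1 := (hZmem _).1 hz
      simp only [Equiv.coe_toEmbedding, Equiv.coe_addRight] at h1
      omega
    have := card_le_univ (Z ∪ P.map (Equiv.addRight c₀).toEmbedding)
    rw [card_union_of_disjoint hdisj, card_map, ZMod.card] at this
    omega
  have heq : ∀ c, 0 < x₃ c → Pᶜ.map (Equiv.addRight c).toEmbedding = Z := by
    intro c hc
    refine eq_of_subset_of_card_le ?_ (by rwa [card_map])
    intro z hz
    obtain ⟨b, hb', rfl⟩ := mem_map.1 hz
    exact hcov c hc b hb'
  obtain ⟨c, hc⟩ := hY
  obtain ⟨z₀, hz₀⟩ := hZ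
  have hmem : ∀ c, 0 < x₃ c → ∀ b, b + c ∈ Z ↔ b ∈ Pᶜ := by
    intro c hc b
    rw [← heq c hc]
    simp
  -- Two different such translations would make the nonempty set `Pᶜ` periodic, hence everything,
  -- although `P` is nonempty.
  have huniq : ∀ c', 0 < x₃ c' → c' = c := by
    intro c' hc'
    by_contra hne
    have hdec : ∀ s : Finset (ZMod 5), ∀ δ : ZMod 5, δ ≠ 0 → s.Nonempty → (∀ b ∈ s, b + δ ∈ s) →
      s = univ := by decide
    have := hdec Pᶜ (c' - c) (sub_ne_zero.2 hne) ?_ ?_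
    · obtain ⟨p, hp⟩ := hPne
      exact (mem_compl.1 (this ▸ mem_univ p)) hp
    · exact ⟨z₀ - c, (hmem c hc _).1 (by rw [sub_add_cancel, hZmem]; exact hz₀)⟩
    · intro b hb'
      refine (hmem c hc _).1 ?_
      rw [add_assoc, sub_add_cancel]
      exact hcov c' hc' b hb'
  have hsum : ∑ c, x₃ c = x₃ c := by
    refine sum_eq_single c (fun c' _ hne => ?_) (by simp)
    by_contra h
    exact hne (huniq c' (Nat.pos_of_ne_zero h))
  have hle : ∑ b, x₁ b + ∑ z, x₄ z ≤ 25 * q := by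
    have h1 := hrest c hc 0
    have h2 := h₁ c 0 hc
    omega
  -- Five units at `c` and twenty in the other four pairs leave at least three for this pair. By
  -- `hle` the fibre at `c` also has at least three.
  have hbig : ∀ b, 3 * q ≤ x₁ b + x₄ (b + c) := by
    intro b
    have h1 := hrest c hc b
    have h2 := hb c
    omega
  have h2c : x₁ (c + c) = 0 := by
    by_contra h
    have := h₃ c (Nat.pos_of_ne_zero h)
    omega
  have h3c := hbig (c + c)
  -- The pair at `b = c + c` has its weight in `x₄ (3c)` alone. Doubling `3c` returns `c`, where
  -- `x₃` is nonempty, so that weight is at most `5 / 2 * q`, less than `3 * q`.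
  have e : ∀ c : ZMod 5, c + c + c + (c + c + c) = c := by decide
  have := h₄ (c + c + c) (by rwa [e])
  omega

variable {G : Type*} [AddCommGroup G] [Module (ZMod 5) G]

theorem card_eq_sum_fibre {M : Type*} [AddCommGroup M] [Module (ZMod 5) M] [DecidableEq M]
    [Fintype M] (A : Finset G) (φ : G →ₗ[ZMod 5] M) : #A = ∑ g, #(fibre A φ g) :=
  card_eq_sum_card_fiberwise fun _ _ => mem_univ _

theorem card_fibre_eq_sum_prod (A : Finset G) (f g : G →ₗ[ZMod 5] ZMod 5) (c : ZMod 5) :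
    #(fibre A f c) = ∑ b, #(fibre A (f.prod g) (c, b)) := by
  rw [card_eq_sum_fibre (fibre A f c) g]
  refine sum_congr rfl fun b _ => ?_
  congr 1
  ext a
  simp [mem_fibre, and_assoc]

variable [Fintype G]

theorem card_eq_card_mul_card_ker {M : Type*} [AddCommGroup M] [Module (ZMod 5) M]
    (φ : G →ₗ[ZMod 5] M) (hφ : Function.Surjective φ) :
    Nat.card G = Nat.card M * Nat.card (LinearMap.ker φ) := by
  classical
  have h := card_eq_card_image_mul φ (X := univ) (fun x _ k _ => mem_univ _)
  have : Fintype M := Fintype.ofSurjective φ hφ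
  rwa [image_univ_of_surjective hφ, card_univ, card_univ, ← Nat.card_eq_fintype_card,
    ← Nat.card_eq_fintype_card] at h

/-- A subspace of index `5` in the kernel of `φ` is cut out by one more linear functional. -/
theorem exists_ker_prod_eq {M : Type*} [AddCommGroup M] [Module (ZMod 5) M]
    (φ : G →ₗ[ZMod 5] M) {K : Submodule (ZMod 5) G} (hK : K ≤ LinearMap.ker φ)
    (hcard : Nat.card (LinearMap.ker φ) = 5 * Nat.card K) :
    ∃ g : G →ₗ[ZMod 5] ZMod 5, LinearMap.ker (φ.prod g) = K := by
  have hKpos : 0 < Nat.card K := Nat.card_pos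
  obtain ⟨v, hv, hvK⟩ : ∃ v ∈ LinearMap.ker φ, v ∉ K := by
    by_contra h
    push Not at h
    have : LinearMap.ker φ = K := le_antisymm h hK
    rw [this] at hcard
    omega
  obtain ⟨g, hgv, hg⟩ := Submodule.exists_le_ker_of_notMem hvK
  refine ⟨g, ?_⟩
  have hle : K ≤ LinearMap.ker (φ.prod g) := by
    rw [LinearMap.ker_prod]; exact le_inf hK hg
  obtain ⟨k, hk⟩ := exists_card_eq_pow K
  obtain ⟨l, hl⟩ := exists_card_eq_pow (LinearMap.ker (φ.prod g))
  have hlt : Nat.card (LinearMap.ker (φ.prod g)) < Nat.card (LinearMap.ker φ) := by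
    refine Set.ncard_lt_ncard (s := (LinearMap.ker (φ.prod g) : Set G)) (t := LinearMap.ker φ) ?_
    rw [LinearMap.ker_prod]
    exact ⟨inf_le_left, fun h => hgv (h hv).2⟩
  rw [hcard, hk, hl, ← pow_succ'] at hlt
  have h1 : l < k + 1 := (Nat.pow_lt_pow_iff_right (by norm_num)).1 hlt
  symm
  refine SetLike.coe_injective (Set.eq_of_subset_of_ncard_le hle ?_)
  change Nat.card (LinearMap.ker (φ.prod g)) ≤ Nat.card K
  rw [hk, hl]
  exact Nat.pow_le_pow_right (by norm_num) (by omega)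

variable [DecidableEq G]

/-- A level set of a functional is not too dense in a sum-free set that is not normal. -/
theorem two_mul_card_level_one_le {A : Finset G} (hA : ∀ x ∈ A, ∀ y ∈ A, x + y ∉ A)
    (f : G →ₗ[ZMod 5] ZMod 5) {d : ℕ} (hker : Nat.card (LinearMap.ker f) = 25 * 5 ^ d)
    (hcard : 28 * 5 ^ d ≤ #A) (hN : ∃ a ∈ A, f a ≠ 1 ∧ f a ≠ 4) :
    2 * #(fibre A f 1) ≤ 25 * 5 ^ d := by
  by_contra hc
  have hq : 0 < 5 ^ d := by positivity
  have hker' : Nat.card (LinearMap.ker f) = 5 * 5 ^ (d + 1) := by rw [hker, pow_succ']; ring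
  have h0 : fibre A f 0 = ∅ := by
    by_contra h
    have := card_fibre_pair hA f 0 1 (nonempty_iff_ne_empty.2 h)
    rw [zero_add] at this
    omega
  have h2 : fibre A f 2 = ∅ := by
    by_contra h
    have := card_fibre_pairSum hA f 1 1 (nonempty_iff_ne_empty.2 h)
    omega
  have hsum : #A = #(fibre A f 1) + #(fibre A f 3) + #(fibre A f 4) := by
    rw [card_eq_sum_fibre A f, sum_zmod_five, h0, h2]
    simp
  have h3ne : (fibre A f 3).Nonempty := by
    obtain ⟨a, ha, h1, h4⟩ := hN
    have hdec : ∀ c : ZMod 5, c ≠ 1 → c ≠ 4 → c = 0 ∨ c = 2 ∨ c = 3 := by decide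
    rcases hdec (f a) h1 h4 with h | h | h
    · exact absurd (mem_fibre.2 ⟨ha, h⟩) (by simp [h0])
    · exact absurd (mem_fibre.2 ⟨ha, h⟩) (by simp [h2])
    · exact ⟨a, mem_fibre.2 ⟨ha, h⟩⟩
  have h1ne : (fibre A f 1).Nonempty := card_pos.1 (by omega)
  have h33 : (3 : ZMod 5) + 3 = 1 := by decide
  have hpow : 5 ^ (d + 1) = 5 * 5 ^ d := pow_succ' _ _
  -- The level set at `1` exceeds two units of `5 ^ (d + 1)`, so the relation `3 + 3 = 1` applies
  -- with `m = 2`.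
  have h3 : 2 * #(fibre A f 3) ≤ 15 * 5 ^ d := by
    have := card_fibre_tripleSum hA f hker' 3 3 2 h3ne h3ne (by rw [h33]; omega)
    omega
  have h1le := card_fibre_le A f 1
  rcases (fibre A f 4).eq_empty_or_nonempty with h4 | h4ne
  · rw [h4, card_empty] at hsum
    have h1' : #(fibre A f 1) ≤ 20 * 5 ^ d := by
      by_contra h
      have := card_fibre_tripleSum hA f hker' 3 3 4 h3ne h3ne (by rw [h33]; omega)
      omega
    omega
  obtain ⟨X', Y', K, e1, e2, ⟨y, hy⟩, e4, e5, e6, e7, e8, e9, e10⟩ :=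
    exists_stable_subspace _ _ h1ne h3ne
  have hadd := card_fibre_add hA f 1 3
  have h13 : (1 : ZMod 5) + 3 = 4 := by decide
  rw [h13] at hadd
  have hX'le : #X' ≤ #(fibre A f 1 + fibre A f 3) :=
    (card_le_card_add_right ⟨y, hy⟩).trans (card_le_card e5)
  have h4pos := card_pos.2 h4ne
  have hKle : K ≤ LinearMap.ker f := e8 _ fun a ha b hb => by
    rw [LinearMap.mem_ker, map_sub, (mem_fibre.1 ha).2, (mem_fibre.1 hb).2, sub_self]
  -- Since `X' + Y'` avoids the level set at `4`, `#X' ≤ 25 * 5 ^ d - #(fibre A f 4)`; hence `#Y' ≥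
  -- 3 * 5 ^ d`. So the order of `K` is above `5 ^ d`, and it is below `25 * 5 ^ d` because `K` has
  -- a coset inside `X'`; only one power of five remains.
  have hKcard : Nat.card K = 5 * 5 ^ d := by
    obtain ⟨k, hk⟩ := exists_card_eq_pow K
    rw [hk] at e9 e10 ⊢
    have hX'pos : 0 < #X' := card_pos.2 (h1ne.mono e1)
    have hdvd := Nat.le_of_dvd hX'pos e9
    have hlow : 5 ^ d < 5 ^ k := by omega
    have hhigh : 5 ^ k < 5 ^ (d + 2) := by
      rw [pow_succ', hpow]; omega
    have := (Nat.pow_lt_pow_iff_right (a := 5) (by norm_num)).1 hlow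
    have := (Nat.pow_lt_pow_iff_right (a := 5) (by norm_num)).1 hhigh
    rw [← hpow]
    congr 1
    omega
  obtain ⟨g, hg⟩ := exists_ker_prod_eq f hKle (by rw [hker, hKcard]; ring)
  have hπ : Nat.card (LinearMap.ker (f.prod g)) = 5 * 5 ^ d := by rw [hg, hKcard]
  have hfX' : ∀ x ∈ X', f x = 1 := by
    intro x hx
    obtain ⟨a, ha, b, hb, hab⟩ := mem_add.1 (e5 (add_mem_add hx hy))
    have h5 := congrArg f hab
    rw [map_add, map_add, (mem_fibre.1 ha).2, (mem_fibre.1 hb).2, (mem_fibre.1 (e2 hy)).2] at h5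
    exact (add_right_cancel h5).symm
  have hpos : ∀ {p}, 0 < #(fibre A (f.prod g) p) → (fibre A (f.prod g) p).Nonempty := card_pos.1
  refine no_split (x₁ := fun b => #(fibre A (f.prod g) (1, b)))
    (x₃ := fun b => #(fibre A (f.prod g) (3, b))) (x₄ := fun b => #(fibre A (f.prod g) (4, b)))
    (P := X'.image g) (c₀ := g y) hq (fun b => hπ ▸ card_fibre_le A _ _) ?_
    ((h1ne.mono e1).image g) ?_ ?_ ?_ ?_ ?_ ?_ ?_ ?_
  · intro b hb
    obtain ⟨a, ha⟩ := hpos (Nat.pos_of_ne_zero hb)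
    obtain ⟨haA, hp⟩ := mem_fibre.1 ha
    exact mem_image.2 ⟨a, e1 (mem_fibre.2 ⟨haA, congrArg Prod.fst hp⟩), congrArg Prod.snd hp⟩
  · intro b hb
    obtain ⟨x, hx, rfl⟩ := mem_image.1 hb
    rw [card_eq_zero, eq_empty_iff_forall_notMem]
    intro z hz
    obtain ⟨hzA, hp⟩ := mem_fibre.1 hz
    have hz1 : f z = 4 := congrArg Prod.fst hp
    have hz2 : g z = g x + g y := congrArg Prod.snd hp
    have hk : z - y - x ∈ K := by
      rw [← hg, LinearMap.ker_prod, Submodule.mem_inf, LinearMap.mem_ker, LinearMap.mem_ker,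
        map_sub, map_sub, map_sub, map_sub, hz1, hz2, (mem_fibre.1 (e2 hy)).2, hfX' x hx]
      exact ⟨by decide, by ring⟩
    have hmem := e5 (add_mem_add (e6 x hx _ hk) hy)
    rw [show x + (z - y - x) + y = z by abel] at hmem
    obtain ⟨a, ha, b, hb, hab⟩ := mem_add.1 hmem
    exact hA a (mem_fibre.1 ha).1 b (mem_fibre.1 hb).1 (hab ▸ hzA)
  · intro c b hc
    have := card_fibre_pair hA (f.prod g) (3, c) (1, b) (hpos hc)
    rwa [hπ, Prod.mk_add_mk, add_comm c b, show (3 : ZMod 5) + 1 = 4 by decide] at this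
  · intro c hc
    have := card_fibre_pairSum hA (f.prod g) (3, c) (3, c)
      (by rw [Prod.mk_add_mk, h33]; exact hpos hc)
    rwa [hπ] at this
  · intro b hb
    have := card_fibre_pairSum hA (f.prod g) (4, b) (4, b)
      (by rw [Prod.mk_add_mk, show (4 : ZMod 5) + 4 = 3 by decide]; exact hpos hb)
    rwa [hπ] at this
  · obtain ⟨a, ha⟩ := h3ne
    exact ⟨g a, card_pos.2 ⟨a, by simpa [mem_fibre] using ha⟩⟩
  · obtain ⟨a, ha⟩ := h4ne
    exact ⟨g a, card_pos.2 ⟨a, by simpa [mem_fibre] using ha⟩⟩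
  · rw [← card_fibre_eq_sum_prod]; exact h3
  · rw [← card_fibre_eq_sum_prod, ← card_fibre_eq_sum_prod, ← card_fibre_eq_sum_prod, ← hsum]
    exact hcard

/-- All level sets of a nonzero functional have density at most `1 / 2` in their hyperplane. -/
theorem two_mul_card_level_le {A : Finset G} (hA : ∀ x ∈ A, ∀ y ∈ A, x + y ∉ A)
    (hN : ∀ f : G →ₗ[ZMod 5] ZMod 5, ∃ a ∈ A, f a ≠ 1 ∧ f a ≠ 4)
    (f : G →ₗ[ZMod 5] ZMod 5) {d : ℕ} (hker : Nat.card (LinearMap.ker f) = 25 * 5 ^ d)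
    (hcard : 28 * 5 ^ d ≤ #A) (c : ZMod 5) :
    2 * #(fibre A f c) ≤ 25 * 5 ^ d := by
  rcases eq_or_ne c 0 with rfl | hc
  · rcases (fibre A f 0).eq_empty_or_nonempty with h | h
    · simp [h]
    · have := card_fibre_pair hA f 0 0 h
      rw [add_zero] at this
      omega
  -- Rescaling moves level `c` to level `1`; non-normality is assumed for every functional, so it
  -- covers the rescaled one.
  · have hk : LinearMap.ker (c⁻¹ • f) = LinearMap.ker f := LinearMap.ker_smul f _ (inv_ne_zero hc)
    have := two_mul_card_level_one_le hA (c⁻¹ • f) (by rw [hk]; exact hker) hcard (hN _)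
    rwa [show fibre A (c⁻¹ • f) 1 = fibre A f c by
      ext a
      simp [mem_fibre, inv_mul_eq_one₀ hc, eq_comm]] at this

/-- The fibres of a linear map onto `𝔽₅²` of a large non-normal sum-free set form a profile. -/
theorem profile_fibre {A : Finset G} (hA : ∀ x ∈ A, ∀ y ∈ A, x + y ∉ A)
    (hN : ∀ f : G →ₗ[ZMod 5] ZMod 5, ∃ a ∈ A, f a ≠ 1 ∧ f a ≠ 4)
    (φ : G →ₗ[ZMod 5] ZMod 5 × ZMod 5) (hφ : Function.Surjective φ) {d : ℕ}
    (hker : Nat.card (LinearMap.ker φ) = 5 * 5 ^ d) (hcard : 28 * 5 ^ d ≤ #A) :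
    Profile (fun g => #(fibre A φ g)) (5 ^ d) where
  pos := by positivity
  bound g := hker ▸ card_fibre_le A φ g
  pair g h hg := hker ▸ card_fibre_pair hA φ g h (card_pos.1 hg)
  pairSum g h hg := hker ▸ card_fibre_pairSum hA φ g h (card_pos.1 hg)
  triple g h m _ hh hgh hm :=
    card_fibre_triple hA φ hker g h m (card_pos.1 hh) (card_pos.1 hgh) hm
  tripleSum g h m hg hh _ hm :=
    card_fibre_tripleSum hA φ hker g h m (card_pos.1 hg) (card_pos.1 hh) hm
  dir e g he hpos := by
    have := card_fibre_line hA φ g he (card_pos.1 hpos)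
    omega
  total := by rw [← card_eq_sum_fibre]; exact hcard
  line e g he := by
    -- This is the determinant with `e`, whose level sets are the lines in direction `e`. The row
    -- sum therefore becomes the size of a level set of a functional on `G`.
    let l : (ZMod 5 × ZMod 5) →ₗ[ZMod 5] ZMod 5 :=
      e.2 • LinearMap.fst _ _ _ - e.1 • LinearMap.snd _ _ _
    have hl : ∀ p, l p = l g ↔ ∃ k : ZMod 5, g + k • e = p := by
      have : ∀ e p : ZMod 5 × ZMod 5, e ≠ 0 → e.2 * p.1 - e.1 * p.2 = 0 →
          ∃ k : ZMod 5, k • e = p := by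
        decide
      intro p
      constructor
      · intro h
        obtain ⟨k, hk⟩ := this e (p - g) he (by
          have h' : l (p - g) = 0 := by rw [map_sub, h, sub_self]
          exact h')
        exact ⟨k, by rw [hk]; abel⟩
      · rintro ⟨k, rfl⟩
        simp [l]
        ring
    have hinj : Function.Injective fun k : ZMod 5 => g + k • e := fun a b hab => by
      simpa [he] using hab
    have hfib : #(fibre A (l ∘ₗ φ) (l g)) = ∑ k : ZMod 5, #(fibre A φ (g + k • e)) := by
      rw [card_eq_sum_card_fiberwise (f := φ) (t := univ.image fun k : ZMod 5 => g + k • e),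
        sum_image fun a _ b _ h => hinj h]
      · refine sum_congr rfl fun k _ => ?_
        congr 1
        ext z
        simp only [fibre, mem_filter, LinearMap.comp_apply]
        exact ⟨fun h => ⟨h.1.1, h.2⟩, fun h => ⟨⟨h.1, (hl _).2 ⟨k, h.2.symm⟩⟩, h.2⟩⟩
      · intro z hz
        obtain ⟨k, hk⟩ := (hl (φ z)).1 (mem_fibre.1 hz).2
        simp [← hk]
    rw [← hfib]
    refine two_mul_card_level_le hA hN (l ∘ₗ φ) ?_ hcard _
    have hsurj : Function.Surjective l := by
      have : ∀ e : ZMod 5 × ZMod 5, e ≠ 0 → ∀ c, ∃ p : ZMod 5 × ZMod 5,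
        e.2 * p.1 - e.1 * p.2 = c := by decide
      exact this e he
    have h1 := card_eq_card_mul_card_ker φ hφ
    have h2 := card_eq_card_mul_card_ker (l ∘ₗ φ) (hsurj.comp hφ)
    rw [hker, Nat.card_prod, Nat.card_zmod] at h1
    rw [Nat.card_zmod] at h2
    omega

end Hyperplane

/-! ### The structure of dense sum-free sets -/

section Structure

open Finset Pointwise

attribute [local instance] fact_prime_five

open scoped Classical

variable {G : Type*} [AddCommGroup G] [Module (ZMod 5) G]

theorem filter_eq_fibre {A : Finset G} {V : Submodule (ZMod 5) G}
    {φ : G →ₗ[ZMod 5] ZMod 5 × ZMod 5} {t : G} (hφ : LinearMap.ker φ = V) :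
    ({a ∈ A | a - t ∈ V} : Finset G) = fibre A φ (φ t) := by
  ext a
  simp [mem_fibre, ← hφ, sub_eq_zero]

variable [Fintype G]

theorem surjective_of_card {M : Type*} [AddCommGroup M] [Module (ZMod 5) M] [Fintype M]
    (φ : G →ₗ[ZMod 5] M) (h : Nat.card G = Nat.card M * Nat.card (LinearMap.ker φ)) :
    Function.Surjective φ := by
  have h2 := card_eq_card_image_mul φ (X := univ) (fun x _ k _ => mem_univ _)
  rw [card_univ, ← Nat.card_eq_fintype_card, h] at h2
  have h3 : #(univ.image φ) = Fintype.card M := by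
    rw [← Nat.card_eq_fintype_card]
    exact (Nat.eq_of_mul_eq_mul_right Nat.card_pos h2).symm
  have h4 := (card_eq_iff_eq_univ _).1 h3
  intro p
  have := mem_univ p
  rw [← h4] at this
  obtain ⟨z, -, hz⟩ := mem_image.1 this
  exact ⟨z, hz⟩

/-- A subspace of codimension `2` is the kernel of a map onto `𝔽₅²` that takes the value `(1, 0)` at
a given vector outside the subspace. -/
theorem exists_coordinates {V : Submodule (ZMod 5) G} (hV : Nat.card G = 25 * Nat.card V) {t : G}
    (ht : t ∉ V) : ∃ φ : G →ₗ[ZMod 5] ZMod 5 × ZMod 5, Function.Surjective φ ∧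
      LinearMap.ker φ = V ∧ φ t = (1, 0) := by
  obtain ⟨f, hft, hf⟩ := Submodule.exists_le_ker_of_notMem ht
  have hsurj : Function.Surjective f := fun c => ⟨(c * (f t)⁻¹) • t, by simp [hft]⟩
  have h1 := card_eq_card_mul_card_ker f hsurj
  rw [Nat.card_zmod] at h1
  obtain ⟨g, hg⟩ := exists_ker_prod_eq f hf (by omega)
  -- Normalising `f` to the value `1` at `t` and subtracting a multiple of it from `g` keeps the
  -- common kernel and sends `t` to `(1, 0)`.
  let f' := (f t)⁻¹ • f
  let g' := g - (g t) • f'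
  have hker : LinearMap.ker (f'.prod g') = V := by
    rw [← hg]
    ext z
    simp only [LinearMap.ker_prod, Submodule.mem_inf, LinearMap.mem_ker]
    constructor
    · rintro ⟨h, h'⟩
      have hz : f z = 0 := by simpa [f', hft] using h
      exact ⟨hz, by simpa [g', f', hz] using h'⟩
    · rintro ⟨h, h'⟩
      exact ⟨by simp [f', h], by simp [g', f', h, h']⟩
  refine ⟨f'.prod g', ?_, hker, ?_⟩
  · exact surjective_of_card _ (by rw [hker, hV, Nat.card_prod, Nat.card_zmod])
  · have : f' t = 1 := by simp [f', hft]
    have h' : g' t = 0 := by simp [g', this]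
    exact Prod.ext this h'

theorem mem_of_card_fibre_eq {M : Type*} [AddCommGroup M] [Module (ZMod 5) M] [DecidableEq M]
    {φ : G →ₗ[ZMod 5] M} {g : M} {B : Finset G}
    (hB : ∀ b ∈ B, φ b = g) (h : Nat.card (LinearMap.ker φ) ≤ #B) {z : G} (hz : φ z = g) :
    z ∈ B := by
  rw [← card_fiber φ z] at h
  have hsub : B ⊆ ({y | φ y = φ z} : Finset G) := fun b hb => by simp [hB b hb, hz]
  rw [eq_of_subset_of_card_le hsub h]
  simp

variable {A : Finset G} {d : ℕ}

/-- If `t` lay in `V`, more than `3 / 5` of the subspace itself would belong to `A`, against the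
relation `0 + 0 = 0` in the quotient. -/
theorem notMem_of_dense (hA : ∀ x ∈ A, ∀ y ∈ A, x + y ∉ A)
    {V : Submodule (ZMod 5) G} (hV : Nat.card V = 5 * 5 ^ d) {t : G}
    (h : 3 * 5 ^ d < #{a ∈ A | a - t ∈ V}) : t ∉ V := by
  intro ht
  have e : ({a ∈ A | a - t ∈ V} : Finset G) = fibre A V.mkQ 0 := by
    ext a
    simp [mem_fibre, Submodule.sub_mem_iff_left V ht]
  rw [e] at h
  have h1 := card_fibre_pair hA V.mkQ 0 0 (card_pos.1 (by omega))
  rw [add_zero, Submodule.ker_mkQ, hV] at h1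
  omega

/-- If some flat of codimension `2` has density above `3 / 5`, some has density above `4 / 5`. -/
theorem exists_denser (hA : ∀ x ∈ A, ∀ y ∈ A, x + y ∉ A)
    (hN : ∀ f : G →ₗ[ZMod 5] ZMod 5, ∃ a ∈ A, f a ≠ 1 ∧ f a ≠ 4) (hcard : 28 * 5 ^ d ≤ #A)
    (hG : Nat.card G = 125 * 5 ^ d)
    {V : Submodule (ZMod 5) G} (hV : Nat.card V = 5 * 5 ^ d) {t : G}
    (h : 3 * 5 ^ d < #{a ∈ A | a - t ∈ V}) :
    ∃ (U : Submodule (ZMod 5) G) (b : G), Nat.card U = 5 * 5 ^ d ∧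
      4 * 5 ^ d < #{a ∈ A | a - b ∈ U} := by
  by_contra hcon
  push Not at hcon
  obtain ⟨φ, hsurj, hker, hφt⟩ := exists_coordinates (by rw [hG, hV]; ring)
    (notMem_of_dense hA hV h)
  have hkc : Nat.card (LinearMap.ker φ) = 5 * 5 ^ d := by rw [hker, hV]
  have P := profile_fibre hA hN φ hsurj hkc hcard
  have hb : ∀ g, #(fibre A φ g) ≤ 4 * 5 ^ d := by
    intro g
    obtain ⟨b, rfl⟩ := hsurj g
    rw [← filter_eq_fibre hker]
    exact hcon V b hV
  rw [filter_eq_fibre hker, hφt] at h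
  obtain ⟨h4, h1⟩ := P.constant_of_sparse hb h
  let D : Finset G := {z | φ z = (1, 0) ∧ z ∉ A}
  have hD : #D + #(fibre A φ (1, 0)) = 5 * 5 ^ d := by
    obtain ⟨z, hz⟩ := hsurj (1, 0)
    rw [← hkc, ← card_fiber φ z, hz,
      ← card_filter_add_card_filter_not (s := {y | φ y = (1, 0)}) (· ∈ A), filter_filter,
      filter_filter, add_comm]
    congr 1
    exact congrArg card (by ext a; simp [mem_fibre, and_comm])
  let X : Finset G := {a ∈ A | (φ a).2 = 1}
  -- For `x` in row one, subtracting `x` from the next fibre lands over `(1, 0)` and outside `A`,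
  -- hence in `D`. Both sets have `5 ^ d` elements, so they agree and `x + D` is a full fibre of
  -- `A`.
  have hstab : ∀ x ∈ X, ∀ v ∈ (D : Set G), x + v ∈ X := by
    intro x hx v hv
    simp only [X, mem_filter] at hx
    have hv' : φ v = (1, 0) ∧ v ∉ A := by simpa [D] using hv
    have hsub : (fibre A φ ((φ x).1 + 1, 1)).image (fun z => z - x) ⊆ D := by
      intro w hw
      obtain ⟨z, hz, rfl⟩ := mem_image.1 hw
      obtain ⟨hzA, hzφ⟩ := mem_fibre.1 hz
      simp only [D, mem_filter, mem_univ, true_and]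
      refine ⟨?_, fun hc => hA _ hc x hx.1 (by rwa [sub_add_cancel])⟩
      rw [map_sub, hzφ]
      ext <;> simp [hx.2]
    have heq := eq_of_subset_of_card_le hsub (by
      rw [card_image_of_injective _ (sub_left_injective)]
      have := h1 ((φ x).1 + 1) 1 (by decide)
      have h4 : #(fibre A φ (1, 0)) = 4 * 5 ^ d := h4
      omega)
    have hvmem : v ∈ (fibre A φ ((φ x).1 + 1, 1)).image (fun z => z - x) := by
      rw [heq]; exact hv
    obtain ⟨z, hz, rfl⟩ := mem_image.1 hvmem
    obtain ⟨hzA, hzφ⟩ := mem_fibre.1 hz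
    simp only [X, mem_filter, add_sub_cancel]
    exact ⟨hzA, by rw [hzφ]⟩
  have hq : 0 < 5 ^ d := by positivity
  obtain ⟨b, hb1⟩ : (fibre A φ (0, 1)).Nonempty := card_pos.1 (by
    have : #(fibre A φ (0, 1)) = 5 ^ d := h1 0 1 (by decide)
    omega)
  have hbX : b ∈ X := by
    obtain ⟨hbA, hbφ⟩ := mem_fibre.1 hb1
    simp [X, hbA, hbφ]
  let U := Submodule.span (ZMod 5) (D : Set G)
  have hUX : ∀ u ∈ U, b + u ∈ X := fun u hu => add_mem_of_mem_span hstab hu b hbX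
  have hXcard : #X = 5 * 5 ^ d := by
    rw [card_eq_sum_fibre X (LinearMap.fst (ZMod 5) (ZMod 5) (ZMod 5) ∘ₗ φ)]
    have : ∀ i, #(fibre X (LinearMap.fst (ZMod 5) (ZMod 5) (ZMod 5) ∘ₗ φ) i) = 5 ^ d := by
      intro i
      rw [← h1 i 1 (by decide)]
      congr 1
      ext a
      simp only [X, mem_fibre, mem_filter, LinearMap.comp_apply, LinearMap.fst_apply, Prod.ext_iff]
      tauto
    simp [this]
  obtain ⟨k, hk⟩ := exists_card_eq_pow U
  have hUcard : Nat.card U = #({a ∈ A | a - b ∈ U} : Finset G) := by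
    rw [Nat.card_eq_fintype_card, Fintype.card_subtype]
    refine card_nbij' (fun u => b + u) (fun a => a - b) ?_ ?_ ?_ ?_
    · intro u hu
      have hu : u ∈ U := by simpa using hu
      have := hUX u hu
      simp only [X, mem_filter] at this
      simp [this.1, hu]
    · intro a ha
      have := (mem_filter.1 ha).2
      simpa using this
    · intro u _; simp
    · intro a _; simp
  have hUle : Nat.card U ≤ 5 * 5 ^ d := by
    rw [hUcard, ← hXcard]
    refine card_le_card fun a ha => ?_
    have := hUX _ (mem_filter.1 ha).2
    simpa using this
  -- The span contains `0`, which is not in `D`. Being larger than `D` and no larger than `X`, it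
  -- has order `5 * 5 ^ d`, so the coset `b + U` is a flat of codimension 2 lying entirely in `A`.
  have hUlt : 5 ^ d < Nat.card U := by
    have h4 : #(fibre A φ (1, 0)) = 4 * 5 ^ d := h4
    have hDq : #D = 5 ^ d := by omega
    rw [← hDq, Nat.card_eq_fintype_card, Fintype.card_subtype]
    refine card_lt_card ⟨fun v hv => ?_, fun hc => ?_⟩
    · simpa using Submodule.subset_span (R := ZMod 5) (mem_coe.2 hv)
    · have h0 : (0 : G) ∈ D := hc (by simp)
      simp only [D, mem_filter, map_zero] at h0
      exact absurd h0.2.1 (by decide)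
  have hU5 : Nat.card U = 5 * 5 ^ d := by
    rw [hk, ← pow_succ'] at *
    have h2 := (Nat.pow_lt_pow_iff_right (a := 5) (by norm_num)).1 hUlt
    have h3 := (Nat.pow_le_pow_iff_right (a := 5) (by norm_num)).1 hUle
    congr 1
    omega
  have := hcon U b hU5
  omega

/-- A flat of codimension `2` and density above `4 / 5` yields coordinates in which the profile has
exceptional support. -/
theorem exists_exceptional (hA : ∀ x ∈ A, ∀ y ∈ A, x + y ∉ A)
    (hN : ∀ f : G →ₗ[ZMod 5] ZMod 5, ∃ a ∈ A, f a ≠ 1 ∧ f a ≠ 4) (hcard : 28 * 5 ^ d ≤ #A)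
    (hG : Nat.card G = 125 * 5 ^ d)
    {V : Submodule (ZMod 5) G} (hV : Nat.card V = 5 * 5 ^ d) {t : G}
    (h : 4 * 5 ^ d < #{a ∈ A | a - t ∈ V}) :
    ∃ φ : G →ₗ[ZMod 5] ZMod 5 × ZMod 5, Function.Surjective φ ∧
      Nat.card (LinearMap.ker φ) = 5 * 5 ^ d ∧
      Profile (fun g => #(fibre A φ g)) (5 ^ d) ∧
      ExceptionalSupport fun g => #(fibre A φ g) := by
  have hq : 0 < 5 ^ d := by positivity
  obtain ⟨φ, hsurj, hker, hφt⟩ := exists_coordinates (by rw [hG, hV]; ring)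
    (notMem_of_dense hA hV (t := t) (by omega))
  have hkc : Nat.card (LinearMap.ker φ) = 5 * 5 ^ d := by rw [hker, hV]
  rw [filter_eq_fibre hker, hφt] at h
  obtain ⟨ψ, hψ⟩ := (profile_fibre hA hN φ hsurj hkc hcard).exceptional_of_dense h
  have hsurj' : Function.Surjective (ψ.symm.toLinearMap ∘ₗ φ) := ψ.symm.surjective.comp hsurj
  have hkc' : Nat.card (LinearMap.ker (ψ.symm.toLinearMap ∘ₗ φ)) = 5 * 5 ^ d := by
    rw [LinearEquiv.ker_comp, hkc]
  refine ⟨ψ.symm.toLinearMap ∘ₗ φ, hsurj', hkc', profile_fibre hA hN _ hsurj' hkc' hcard, ?_⟩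
  convert hψ using 2 with g
  simp only [Function.comp_apply]
  congr 1
  ext a
  simp [mem_fibre, LinearEquiv.symm_apply_eq]

/-- If a fibre and its double both have density `2 / 5` and the first is a union of cosets, then so
is the second. -/
theorem mem_double_iff (hA : ∀ x ∈ A, ∀ y ∈ A, x + y ∉ A)
    {φ : G →ₗ[ZMod 5] ZMod 5 × ZMod 5} {h : G →ₗ[ZMod 5] ZMod 5}
    (hsurj : Function.Surjective (φ.prod h)) (hker : Nat.card (LinearMap.ker (φ.prod h)) = 5 ^ d)
    {g g' : ZMod 5 × ZMod 5} (hg : g + g = g') (hg' : #(fibre A φ g') = 2 * 5 ^ d)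
    {S T : Finset (ZMod 5)} (hT : #T = 2) (hST : ∀ c, c ∉ T → ∃ s ∈ S, ∃ s' ∈ S, s + s' = c)
    (hS : ∀ z, φ z = g → h z ∈ S → z ∈ A) (z : G) (hz : φ z = g') : z ∈ A ↔ h z ∈ T := by
  let B : Finset G := {w | φ w = g' ∧ h w ∈ T}
  have hsub : fibre A φ g' ⊆ B := by
    intro w hw
    obtain ⟨hwA, hwφ⟩ := mem_fibre.1 hw
    simp only [B, mem_filter, mem_univ, true_and]
    refine ⟨hwφ, ?_⟩
    by_contra hc
    -- A value outside `T` is a sum of two values in `S`, which would write `w` as a sum of two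
    -- elements of `A`.
    obtain ⟨s, hs, s', hs', hss⟩ := hST _ hc
    obtain ⟨x, hx⟩ := hsurj (g, s)
    have hx1 : φ x = g := congrArg Prod.fst hx
    have hx2 : h x = s := congrArg Prod.snd hx
    refine hA x (hS x hx1 (hx2 ▸ hs)) (w - x) (hS _ ?_ ?_) (by rwa [add_sub_cancel])
    · rw [map_sub, hwφ, hx1, ← hg, add_sub_cancel_right]
    · rw [map_sub, hx2, ← hss, add_sub_cancel_left]
      exact hs'
  have hB : #B = 2 * 5 ^ d := by
    have hst : ∀ x ∈ B, ∀ k ∈ LinearMap.ker (φ.prod h), x + k ∈ B := by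
      intro x hx k hk
      rw [LinearMap.ker_prod, Submodule.mem_inf, LinearMap.mem_ker, LinearMap.mem_ker] at hk
      simpa [B, hk.1, hk.2] using hx
    rw [card_eq_card_image_mul (φ.prod h) hst, hker]
    congr 1
    rw [← hT, ← one_mul #T, ← card_singleton g', ← card_product]
    congr 1
    ext ⟨p, c⟩
    simp only [mem_image, mem_product, mem_singleton, B, mem_filter, mem_univ, true_and]
    constructor
    · rintro ⟨w, ⟨hw1, hw2⟩, hw⟩
      have e1 : φ w = p := congrArg Prod.fst hw
      have e2 : h w = c := congrArg Prod.snd hw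
      exact ⟨by rw [← e1, hw1], e2 ▸ hw2⟩
    · rintro ⟨rfl, hc⟩
      obtain ⟨w, hw⟩ := hsurj (p, c)
      have e1 : φ w = p := congrArg Prod.fst hw
      have e2 : h w = c := congrArg Prod.snd hw
      exact ⟨w, ⟨e1, e2 ▸ hc⟩, hw⟩
  have heq := eq_of_subset_of_card_le hsub (by rw [hB, hg'])
  have := congrArg (z ∈ ·) heq
  simpa [mem_fibre, B, hz] using this

/-- A fibre of density `2 / 5` whose double also has density `2 / 5` determines a subspace under
which the double is stable. -/
theorem exists_stable_double (hA : ∀ x ∈ A, ∀ y ∈ A, x + y ∉ A)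
    {φ : G →ₗ[ZMod 5] ZMod 5 × ZMod 5}
    (hker : Nat.card (LinearMap.ker φ) = 5 * 5 ^ d) {g : ZMod 5 × ZMod 5}
    (h1 : #(fibre A φ g) = 2 * 5 ^ d) (h2 : #(fibre A φ (g + g)) = 2 * 5 ^ d) :
    ∃ K : Submodule (ZMod 5) G, K ≤ LinearMap.ker φ ∧ Nat.card K = 5 ^ d ∧
      ∀ z ∈ fibre A φ (g + g), ∀ k ∈ K, z + k ∈ fibre A φ (g + g) := by
  have hq : 0 < 5 ^ d := by positivity
  have hne : (fibre A φ g).Nonempty := card_pos.1 (by omega)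
  obtain ⟨X', Y', K, e1, e2, e3, e4, e5, e6, e7, e8, e9, e10⟩ :=
    exists_stable_subspace _ _ hne hne
  have hadd := card_fibre_add hA φ g g
  have hle1 : #X' ≤ #(X' + Y') := card_le_card_add_right e3
  have hle2 := card_le_card e5
  have hKle : K ≤ LinearMap.ker φ := e8 _ fun a ha b hb => by
    rw [LinearMap.mem_ker, map_sub, (mem_fibre.1 ha).2, (mem_fibre.1 hb).2, sub_self]
  -- The two transformed sets have `4 * 5 ^ d` elements together and `#X' ≤ 3 * 5 ^ d`, so the order
  -- of `K` is at least `5 ^ d`. It is less than `5 * 5 ^ d` since it is at most `#X'`.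
  have hKcard : Nat.card K = 5 ^ d := by
    obtain ⟨k, hk⟩ := exists_card_eq_pow K
    rw [hk] at e9 e10 ⊢
    have hdvd := Nat.le_of_dvd (card_pos.2 (hne.mono e1)) e9
    have hlow : 5 ^ d ≤ 5 ^ k := by omega
    have hhigh : 5 ^ k < 5 ^ (d + 1) := by rw [pow_succ']; omega
    have := (Nat.pow_le_pow_iff_right (a := 5) (by norm_num)).1 hlow
    have := (Nat.pow_lt_pow_iff_right (a := 5) (by norm_num)).1 hhigh
    congr 1
    omega
  rw [hKcard] at e10
  -- Now `#Y' ≤ 5 ^ d`, which forces `#X' = 3 * 5 ^ d`, the largest size available to the sumset. So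
  -- the sumset is stable under `K`, and so is the fibre over `g + g`, its complement in the coset.
  have hXY : X' + Y' = fibre A φ g + fibre A φ g := eq_of_subset_of_card_le e5 (by omega)
  have hstab : ∀ z ∈ fibre A φ g + fibre A φ g, ∀ k ∈ K, z + k ∈ fibre A φ g + fibre A φ g := by
    rw [← hXY]
    intro z hz k hk
    obtain ⟨x, hx, y, hy, rfl⟩ := mem_add.1 hz
    rw [add_right_comm]
    exact add_mem_add (e6 x hx k hk) hy
  refine ⟨K, hKle, hKcard, fun z hz k hk => ?_⟩
  have hφ : φ (z + k) = g + g := by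
    rw [map_add, (mem_fibre.1 hz).2, LinearMap.mem_ker.1 (hKle hk), add_zero]
  have hmem := mem_of_card_fibre_eq (φ := φ) (g := g + g)
    (B := (fibre A φ g + fibre A φ g) ∪ fibre A φ (g + g)) ?_ ?_ hφ
  · rcases mem_union.1 hmem with h | h
    · have := hstab _ h (-k) (K.neg_mem hk)
      rw [add_neg_cancel_right] at this
      obtain ⟨a, ha, b, hb, rfl⟩ := mem_add.1 this
      exact absurd (mem_fibre.1 hz).1 (hA a (mem_fibre.1 ha).1 b (mem_fibre.1 hb).1)
    · exact h
  · intro b hb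
    rcases mem_union.1 hb with h | h
    · obtain ⟨a, ha, c, hc, rfl⟩ := mem_add.1 h
      rw [map_add, (mem_fibre.1 ha).2, (mem_fibre.1 hc).2]
    · exact (mem_fibre.1 h).2
  · rw [card_union_of_disjoint, hker]
    · omega
    · rw [disjoint_left]
      intro s hs hs'
      obtain ⟨a, ha, b, hb, rfl⟩ := mem_add.1 hs
      exact hA a (mem_fibre.1 ha).1 b (mem_fibre.1 hb).1 (mem_fibre.1 hs').1

end Structure

/-! ### Recovering `Λ` from an exceptional profile. -/

section Exceptional

open Finset Pointwise

attribute [local instance] fact_prime_five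

/-- The weights of a profile with exceptional support. -/
theorem ExceptionalSupport.values {x : ZMod 5 × ZMod 5 → ℕ} {q : ℕ} (P : Profile x q)
    (h : ExceptionalSupport x) :
    (x (1, 0) = 5 * q ∧ x (4, 0) = 5 * q ∧ x (0, 1) = 5 * q ∧ x (0, 4) = 5 * q) ∧
    x (2, 1) = 2 * q ∧ x (4, 2) = 2 * q ∧ x (1, 3) = 2 * q ∧ x (3, 4) = 2 * q := by
  obtain ⟨hs, h1, h2, h3, h4⟩ := h
  have hz : ∀ g, ¬ (g = (1, 0) ∨ g = (4, 0) ∨ g = (0, 1) ∨ g = (0, 4) ∨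
      g = (2, 1) ∨ g = (4, 2) ∨ g = (1, 3) ∨ g = (3, 4)) → x g = 0 := fun g hg => by
    by_contra h
    exact hg (hs g h)
  have ht := P.total
  rw [Profile.sum_eq_rowSum] at ht
  simp only [rowSum, sum_zmod_five] at ht
  rw [hz (0, 0) (by decide), hz (2, 0) (by decide), hz (3, 0) (by decide), hz (1, 1) (by decide),
    hz (3, 1) (by decide), hz (4, 1) (by decide), hz (0, 2) (by decide), hz (1, 2) (by decide),
    hz (2, 2) (by decide), hz (3, 2) (by decide), hz (0, 3) (by decide), hz (2, 3) (by decide),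
    hz (3, 3) (by decide), hz (4, 3) (by decide), hz (1, 4) (by decide), hz (2, 4) (by decide),
    hz (4, 4) (by decide)] at ht
  -- Summing these inequalities around the doubling cycle `(2, 1), (4, 2), (3, 4), (1, 3)` bounds
  -- its four fibres by `8 * q`. The other four have at most `20 * q`, so all bounds are tight;
  -- going once round the equalities `2 * x g + x (g + g) = 6 * q` then forces the value `2 * q`.
  have key : ∀ g g' : ZMod 5 × ZMod 5, g + g = g' → 0 < x g → 0 < x g' →
      x g + x g + x g' ≤ 6 * q := by
    rintro g g' rfl hg hg'
    exact Certificate.three_le P.pos (fun m hm => P.triple g g m hg hg hg' hm) hg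
  have k1 := key (2, 1) (4, 2) (by decide) h1 h2
  have k2 := key (4, 2) (3, 4) (by decide) h2 h4
  have k3 := key (3, 4) (1, 3) (by decide) h4 h3
  have k4 := key (1, 3) (2, 1) (by decide) h3 h1
  have b1 := P.bound (1, 0)
  have b2 := P.bound (4, 0)
  have b3 := P.bound (0, 1)
  have b4 := P.bound (0, 4)
  omega

/-- Membership in `Λ` in coordinates. -/
theorem mem_Lambda_iff (a b c : ZMod 5) : ![a, b, c] ∈ Lambda ↔
    ((a, b) = (1, 0) ∨ (a, b) = (4, 0) ∨ (a, b) = (0, 1) ∨ (a, b) = (0, 4)) ∨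
    ((a, b) = (2, 1) ∧ c ∈ ({1, 2} : Finset (ZMod 5))) ∨
    ((a, b) = (4, 2) ∧ c ∈ ({0, 1} : Finset (ZMod 5))) ∨
    ((a, b) = (1, 3) ∧ c ∈ ({0, 4} : Finset (ZMod 5))) ∨
    ((a, b) = (3, 4) ∧ c ∈ ({3, 4} : Finset (ZMod 5))) := by
  have hv : ∀ a b c a' b' c' : ZMod 5, ![a, b, c] = ![a', b', c'] ↔ a = a' ∧ b = b' ∧ c = c' := by
    simp
  simp only [Lambda, Set.mem_union, Set.mem_ofPred_eq, Set.mem_insert_iff, Set.mem_singleton_iff,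
    hv, exists_or, exists_and_left, exists_eq', and_true, Prod.mk.injEq, Finset.mem_insert,
    Finset.mem_singleton]
  revert a b c
  set_option synthInstance.maxSize 1000 in
  decide

variable {G : Type*} [AddCommGroup G] [Module (ZMod 5) G] [Fintype G]
  {A : Finset G} {d : ℕ}

/-- Coordinates in which a sum-free set with exceptional profile is the preimage of `Λ`. -/
theorem exists_map_Lambda (hA : ∀ x ∈ A, ∀ y ∈ A, x + y ∉ A)
    {φ : G →ₗ[ZMod 5] ZMod 5 × ZMod 5} (hsurj : Function.Surjective φ)
    (hker : Nat.card (LinearMap.ker φ) = 5 * 5 ^ d) (P : Profile (fun g => #(fibre A φ g)) (5 ^ d))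
    (hS : ExceptionalSupport fun g => #(fibre A φ g)) :
    ∃ Φ : G →ₗ[ZMod 5] (Fin 3 → ZMod 5), Function.Surjective Φ ∧ ∀ z, z ∈ A ↔ Φ z ∈ Lambda := by
  obtain ⟨⟨m1, m2, m3, m4⟩, v1, v2, v3, v4⟩ := hS.values P
  have hq : 0 < 5 ^ d := by positivity
  obtain ⟨K, hKle, hK, hstab⟩ := exists_stable_double hA hker v1 v2
  rw [show ((2, 1) + (2, 1) : ZMod 5 × ZMod 5) = (4, 2) by decide] at hstab
  obtain ⟨h₀, hh₀⟩ := exists_ker_prod_eq φ hKle (by rw [hker, hK])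
  have hI := card_eq_card_image_mul (φ.prod h₀) (X := fibre A φ (4, 2)) (by rwa [hh₀])
  rw [hh₀, hK, v2] at hI
  obtain ⟨p, p', hne, hpp⟩ := card_eq_two.1 (Nat.eq_of_mul_eq_mul_right hq hI).symm
  have hp1 : ∀ r ∈ ({p, p'} : Finset _), ∃ w ∈ A, φ w = (4, 2) ∧ r = ((4, 2), h₀ w) := by
    intro r hr
    rw [← hpp] at hr
    obtain ⟨w, hw, rfl⟩ := mem_image.1 hr
    obtain ⟨hwA, hwφ⟩ := mem_fibre.1 hw
    exact ⟨w, hwA, hwφ, Prod.ext hwφ rfl⟩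
  obtain ⟨w, hwA, hwφ, hw⟩ := hp1 p (by simp)
  obtain ⟨w', hwA', hwφ', hw'⟩ := hp1 p' (by simp)
  have hδ : h₀ w' - h₀ w ≠ 0 := by
    intro h
    rw [sub_eq_zero] at h
    exact hne (by rw [hw, hw', h])
  have hback : ∀ z, φ z = (4, 2) → ∀ v ∈ A, φ v = (4, 2) → h₀ z = h₀ v → z ∈ A := by
    intro z hz v hv hvφ hzv
    have := hstab v (mem_fibre.2 ⟨hv, hvφ⟩) (z - v) (by
      rw [← hh₀, LinearMap.ker_prod, Submodule.mem_inf, LinearMap.mem_ker, LinearMap.mem_ker,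
        map_sub, map_sub, hz, hvφ, hzv, sub_self, sub_self]
      exact ⟨rfl, rfl⟩)
    rw [add_sub_cancel] at this
    exact (mem_fibre.1 this).1
  -- The functional is normalised to take the values `0` at `w` and `1` at `w'`. Over `(4, 2)` the
  -- correction equals `h₀ w`, because `3 * 2 = 1` in `𝔽₅`.
  let h : G →ₗ[ZMod 5] ZMod 5 := (h₀ w' - h₀ w)⁻¹ •
    (h₀ - (3 * h₀ w) • (LinearMap.snd (ZMod 5) (ZMod 5) (ZMod 5) ∘ₗ φ))
  have hval : ∀ z, h z = (h₀ w' - h₀ w)⁻¹ * (h₀ z - 3 * h₀ w * (φ z).2) := fun z => rfl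
  have hkerh : LinearMap.ker (φ.prod h) = K := by
    rw [← hh₀]
    ext z
    simp only [LinearMap.ker_prod, Submodule.mem_inf, LinearMap.mem_ker]
    refine and_congr_right fun hz => ?_
    rw [hval, hz]
    simp [hδ]
  have hG := card_eq_card_mul_card_ker φ hsurj
  have hsurjh : Function.Surjective (φ.prod h) := surjective_of_card _ (by
    rw [hG, hker, hkerh, hK, Nat.card_prod (ZMod 5 × ZMod 5), Nat.card_zmod]; ring)
  have hkerc : Nat.card (LinearMap.ker (φ.prod h)) = 5 ^ d := by rw [hkerh, hK]
  have e6 : ∀ c : ZMod 5, 3 * c * 2 = c := by decide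
  have h42 : ∀ z, φ z = (4, 2) → h z ∈ ({0, 1} : Finset (ZMod 5)) → z ∈ A := by
    intro z hz hz'
    rw [hval, hz, e6, mem_insert, mem_singleton] at hz'
    rcases hz' with h' | h'
    · refine hback z hz w hwA hwφ (sub_eq_zero.1 ?_)
      simpa [hδ] using h'
    · refine hback z hz w' hwA' hwφ' ?_
      rw [inv_mul_eq_one₀ hδ] at h'
      simpa using h'.symm
  -- Each value set is the complement of the sumset of the previous one with itself: `{0, 1}`, `{3,
  -- 4}`, `{0, 4}`, `{1, 2}`, and `{0, 1}` again. Closing the cycle gives the converse over `(4,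
  -- 2)`, where only one inclusion was known.
  have h34 := mem_double_iff hA hsurjh hkerc (g := (4, 2)) (g' := (3, 4)) (S := {0, 1})
    (T := {3, 4}) (by decide) v4 (by decide) (by decide) h42
  have h13 := mem_double_iff hA hsurjh hkerc (g := (3, 4)) (g' := (1, 3)) (S := {3, 4})
    (T := {0, 4}) (by decide) v3 (by decide) (by decide) fun z hz => (h34 z hz).2
  have h21 := mem_double_iff hA hsurjh hkerc (g := (1, 3)) (g' := (2, 1)) (S := {0, 4})
    (T := {1, 2}) (by decide) v1 (by decide) (by decide) fun z hz => (h13 z hz).2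
  have h42' := mem_double_iff hA hsurjh hkerc (g := (2, 1)) (g' := (4, 2)) (S := {1, 2})
    (T := {0, 1}) (by decide) v2 (by decide) (by decide) fun z hz => (h21 z hz).2
  have hfull : ∀ g, #(fibre A φ g) = 5 * 5 ^ d → ∀ z, φ z = g → z ∈ A := fun g hg z hz =>
    (mem_fibre.1 (mem_of_card_fibre_eq (fun b hb => (mem_fibre.1 hb).2) (by rw [hker, hg]) hz)).1
  let Φ : G →ₗ[ZMod 5] (Fin 3 → ZMod 5) := LinearMap.pi
    ![LinearMap.fst _ _ _ ∘ₗ φ, LinearMap.snd _ _ _ ∘ₗ φ, h]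
  have hΦ : ∀ z, Φ z = ![(φ z).1, (φ z).2, h z] := by
    intro z
    ext i
    fin_cases i <;> rfl
  refine ⟨Φ, fun u => ?_, fun z => ?_⟩
  · obtain ⟨z, hz⟩ := hsurjh ((u 0, u 1), u 2)
    have e1 : φ z = (u 0, u 1) := congrArg Prod.fst hz
    have e2 : h z = u 2 := congrArg Prod.snd hz
    refine ⟨z, ?_⟩
    rw [hΦ, e1, e2]
    ext i
    fin_cases i <;> rfl
  · rw [hΦ, mem_Lambda_iff, Prod.mk.eta]
    constructor
    · intro hz
      have hne : #(fibre A φ (φ z)) ≠ 0 := card_ne_zero.2 ⟨z, mem_fibre.2 ⟨hz, rfl⟩⟩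
      rcases hS.1 _ hne with h' | h' | h' | h' | h' | h' | h' | h'
      · exact Or.inl (Or.inl h')
      · exact Or.inl (Or.inr (Or.inl h'))
      · exact Or.inl (Or.inr (Or.inr (Or.inl h')))
      · exact Or.inl (Or.inr (Or.inr (Or.inr h')))
      · exact Or.inr (Or.inl ⟨h', (h21 z h').1 hz⟩)
      · exact Or.inr (Or.inr (Or.inl ⟨h', (h42' z h').1 hz⟩))
      · exact Or.inr (Or.inr (Or.inr (Or.inl ⟨h', (h13 z h').1 hz⟩)))
      · exact Or.inr (Or.inr (Or.inr (Or.inr ⟨h', (h34 z h').1 hz⟩)))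
    · rintro ((h' | h' | h' | h') | ⟨h', hc⟩ | ⟨h', hc⟩ | ⟨h', hc⟩ | ⟨h', hc⟩)
      · exact hfull _ m1 z h'
      · exact hfull _ m2 z h'
      · exact hfull _ m3 z h'
      · exact hfull _ m4 z h'
      · exact (h21 z h').2 hc
      · exact (h42' z h').2 hc
      · exact (h13 z h').2 hc
      · exact (h34 z h').2 hc

end Exceptional

/-! ### Translation to affine hyperplanes and VL-sets, and the conclusion. -/

theorem isVLSet_of_map {n : ℕ} (hn : 3 ≤ n) {A : Set (Fin n → ZMod 5)}
    (Φ : (Fin n → ZMod 5) →ₗ[ZMod 5] (Fin 3 → ZMod 5)) (hΦ : Function.Surjective Φ)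
    (hA : ∀ z, z ∈ A ↔ Φ z ∈ Lambda) : IsVLSet A := by
  have := fact_prime_five
  -- Projecting along a complement onto the kernel of `Φ`, which has dimension `n - 3`, supplies the
  -- remaining coordinates.
  obtain ⟨C, hC⟩ := (LinearMap.ker Φ).exists_isCompl
  have hrank : Module.finrank (ZMod 5) (LinearMap.ker Φ) =
      Module.finrank (ZMod 5) (Fin (n - 3) → ZMod 5) := by
    have := LinearMap.finrank_range_add_finrank_ker Φ
    rw [LinearMap.range_eq_top.2 hΦ, finrank_top, Module.finrank_fin_fun, Module.finrank_fin_fun]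
      at this
    rw [Module.finrank_fin_fun]
    omega
  let ε := LinearEquiv.ofFinrankEq _ _ hrank
  let Ψ := ε.toLinearMap ∘ₗ (LinearMap.ker Φ).projectionOnto C hC
  have hΨ : LinearMap.range Ψ = ⊤ := LinearMap.range_eq_top.2
    (ε.surjective.comp (LinearMap.range_eq_top.1 (Submodule.range_projectionOnto hC)))
  have hker : LinearMap.ker Ψ = C := by
    rw [LinearEquiv.ker_comp, Submodule.ker_projectionOnto]
  refine ⟨LinearMap.equivProdOfSurjectiveOfIsCompl Φ Ψ (LinearMap.range_eq_top.2 hΦ) hΨ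
    (hker ▸ hC), ?_⟩
  ext ⟨u, v⟩
  simp only [Set.mem_image, Set.mem_prod, Set.mem_univ, and_true]
  constructor
  · rintro ⟨z, hz, hzu⟩
    have : Φ z = u := congrArg Prod.fst hzu
    exact this ▸ (hA z).1 hz
  · intro hu
    obtain ⟨z, hz⟩ := (LinearMap.equivProdOfSurjectiveOfIsCompl Φ Ψ (LinearMap.range_eq_top.2 hΦ)
      hΨ (hker ▸ hC)).surjective (u, v)
    have : Φ z = u := congrArg Prod.fst hz
    exact ⟨z, (hA z).2 (this ▸ hu), hz⟩

/-- The hyperplane is the level set of `f` at `1`, and its negative is the level set at `4 = -1`.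
Nonemptiness of `A` ensures that `f` is not zero. -/
theorem isNormal_of_functional {n : ℕ} {A : Set (Fin n → ZMod 5)} (hA : IsSumFree A)
    (hne : A.Nonempty) (f : (Fin n → ZMod 5) →ₗ[ZMod 5] ZMod 5) (hf : ∀ a ∈ A, f a = 1 ∨ f a = 4) :
    IsNormalSumFree A := by
  have h4 : (-4 : ZMod 5) = 1 := by decide
  have h0 : (0 : ZMod 5) ≠ 1 := by decide
  have := fact_prime_five
  obtain ⟨p, hp⟩ : ∃ p, f p = 1 := by
    obtain ⟨a, ha⟩ := hne
    rcases hf a ha with h | h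
    · exact ⟨a, h⟩
    · exact ⟨-a, by rw [map_neg, h]; exact h4⟩
  have hmem : ∀ x, x ∈ AffineSubspace.mk' p (LinearMap.ker f) ↔ f x = 1 := by
    intro x
    rw [AffineSubspace.mem_mk', LinearMap.mem_ker, vsub_eq_sub, map_sub, hp, sub_eq_zero]
  refine ⟨hA, AffineSubspace.mk' p (LinearMap.ker f), ⟨⟨p, AffineSubspace.self_mem_mk' _ _⟩, ?_⟩,
    ?_, fun x hx => ?_⟩
  · rw [AffineSubspace.direction_mk']
    have h1 := LinearMap.finrank_range_add_finrank_ker f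
    have hsurj : Function.Surjective f := fun c =>
      ⟨c • p, by rw [map_smul, hp, smul_eq_mul, mul_one]⟩
    rw [LinearMap.range_eq_top.2 hsurj, finrank_top, Module.finrank_self, Module.finrank_fin_fun]
      at h1
    omega
  · rw [hmem, map_zero]; exact h0
  · rw [hmem, hmem, map_neg]
    rcases hf x hx with h | h
    · exact Or.inl h
    · exact Or.inr (by rw [h]; exact h4)

theorem proposition2p4 (n : ℕ) (hn : 3 ≤ n) (A : Set (Fin n → ZMod 5))
    (hA : IsSumFree A) (hcard : 28 * 5 ^ (n - 3) ≤ A.ncard)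
    (hT : ∃ T : AffineSubspace (ZMod 5) (Fin n → ZMod 5),
      HasCodim T 2 ∧ 3 * 5 ^ (n - 3) < (A ∩ (T : Set (Fin n → ZMod 5))).ncard) :
    IsNormalSumFree A ∨ IsVLSet A := by
  classical
  have := fact_prime_five
  by_cases hnorm : IsNormalSumFree A
  · exact Or.inl hnorm
  refine Or.inr ?_
  have hq : 0 < 5 ^ (n - 3) := by positivity
  have hne : A.Nonempty := Set.nonempty_of_ncard_ne_zero (by omega)
  obtain ⟨B, rfl⟩ : ∃ B : Finset (Fin n → ZMod 5), A = B := ⟨A.toFinset, by simp⟩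
  rw [Set.ncard_coe_finset] at hcard
  obtain ⟨T, ⟨⟨t, ht⟩, hrank⟩, hTA⟩ := hT
  have hpow : 5 ^ n = 125 * 5 ^ (n - 3) := by
    rw [show (125 : ℕ) = 5 ^ 3 by norm_num, ← pow_add]; congr 1; omega
  have hG : Nat.card (Fin n → ZMod 5) = 125 * 5 ^ (n - 3) := by simp [hpow]
  have hV : Nat.card T.direction = 5 * 5 ^ (n - 3) := by
    rw [Module.natCard_eq_pow_finrank (K := ZMod 5), Nat.card_zmod, ← pow_succ']
    congr 1
    omega
  have hdense : 3 * 5 ^ (n - 3) < (B.filter fun a => a - t ∈ T.direction).card := by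
    rw [← Set.ncard_coe_finset]
    convert hTA using 2
    ext a
    simp only [Finset.coe_filter, Set.mem_ofPred_eq, Set.mem_inter_iff, SetLike.mem_coe]
    exact and_congr_right fun _ => AffineSubspace.vsub_right_mem_direction_iff_mem ht a
  have hA' : ∀ x ∈ B, ∀ y ∈ B, x + y ∉ B := hA
  -- Non-normality enters the argument only in this form.
  have hN : ∀ f : (Fin n → ZMod 5) →ₗ[ZMod 5] ZMod 5, ∃ a ∈ B, f a ≠ 1 ∧ f a ≠ 4 := by
    by_contra h
    push Not at h
    obtain ⟨f, hf⟩ := h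
    exact hnorm (isNormal_of_functional hA hne f fun a ha => or_iff_not_imp_left.2 (hf a ha))
  obtain ⟨U, b, hU, hUb⟩ := exists_denser hA' hN hcard hG hV hdense
  obtain ⟨φ, hsurj, hker, P, hS⟩ := exists_exceptional hA' hN hcard hG hU hUb
  obtain ⟨Φ, hΦ, hmem⟩ := exists_map_Lambda hA' hsurj hker P hS
  exact isVLSet_of_map hn Φ hΦ hmem
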